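/- **Theorem (Bifurcation of inertia-gravity waves for $Q\neq 0$).** Let $g,H_0,b,d,Q>0$ and $f\in\mathbb{R}$. Consider the rotating shallow water equations on $\mathbb{R}^2$ with isotropic backscatter and bottom drag, for $\mathbf v=\mathbf v(t,\mathbf x)\in\mathbb{R}^2$, $\eta=\eta(t,\mathbf x)\in\mathbb{R}$ with $H_0+\eta>0$, $$\partial_t\mathbf v+(\mathbf v\cdot\nabla)\mathbf v=-f\mathbf v^\perp-g\nabla\eta-(d\Delta^2+b\Delta)\mathbf v-\frac{C+Q|\mathbf v|}{H_0+\eta}\mathbf v,\qquad \partial_t\eta+(\mathbf v\cdot\nabla)\eta=-(H_0+\eta)\nabla\cdot\mathbf v,$$ where $(v_1,v_2)^\perp=(-v_2,v_1)$. Put $$k_c=\sqrt{\tfrac{b}{2d}},\quad C_c=\frac{b^2H_0}{4d},\quad \omega_c=\sqrt{gH_0k_c^2+f^2},\quad C=C_c-\alpha H_0,\quad \mu=(\alpha,s,\kappa)\in\mathbb{R}^3 ,$$ $$I_1=\frac1{2\pi}\int_0^{2\pi}\!\!\sqrt{f^2+k_c^2gH_0\cos^2\chi}\,d\chi,\quad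 I_2=\frac1{2\pi}\int_0^{2\pi}\!\!\sqrt{f^2+k_c^2gH_0\cos^2\chi}\,\cos(2\chi)\,d\chi,\quad c=\frac{2Qk_c}{H_0}\Bigl(I_1+\frac{k_c^2gH_0}{2f^2+k_c^2gH_0}I_2\Bigr).$$ For $\mathbf k_c=(k_x',k_y')\in\mathbb{R}^2$ with $|\mathbf k_c|=k_c$ consider travelling waves $(\mathbf v,\eta)(t,\mathbf x)=U(\zeta)$, $\zeta=(1+\kappa)\bigl(\mathbf k_c\cdot\mathbf x-(\omega_c-s)t\bigr)$, whose profile $U$ is $2\pi$-periodic, lies in $X=H^4_{per}\times H^4_{per}\times H^1_{per}$ and has $\eta$-component of mean zero; here the equations are meant almost everywhere. Then $I_1>0$ and $I_2>0$, and there are $\varepsilon\in(0,1)$, $\delta,M>0$ and continuous functions $R_1,R_2$ of $(\mu,A_1)\in(-\varepsilon,\varepsilon)^4$ with $|R_j|\le M(|A_1|^2+|\mu|^2)$, all independent of the direction of $\mathbf k_c$, such that the following holds with the bifurcation equations $$0=A_1\Bigl(-s+\kappa\frac{f^2}{\omega_c}+R_1\Bigr),\qquad 0=A_1\bigl(\alpha-c|A_1|+R_2\bigr).\tag{B}$$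 1. (Correspondence.) For every such $\mathbf k_c$ there are a set $N$ of profiles that contains the $\delta$-ball around $0$ of $X$, and profiles $\Phi_{\mu,A_1}$, such that for all $\alpha,s,\kappa\in(-\varepsilon,\varepsilon)$: if $A_1\in(-\varepsilon,\varepsilon)$ solves (B), then $\Phi_{\mu,A_1}\in N$ is the profile of such a wave, $-A_1$ solves (B) too, and $\Phi_{\mu,-A_1}=\Phi_{\mu,A_1}(\cdot+\pi)$; conversely, the profile in $N$ of any such wave is a translate of $\Phi_{\mu,A_1}$ for exactly one solution $A_1\in[0,\varepsilon)$ of (B). That is, up to translation, the waves near zero (pairs of $s$ and a profile) are in one-to-one correspondence with the solutions $(s,A_1)$ of (B) near zero, where $A_1$ and $-A_1$ are identified as they give the same wave up to a translation. 2. (Form of the waves.) These waves satisfy, with an error measured in the norm of $X$ and bounded by $M|A_1|(|A_1|+|\alpha|+|s|+|\kappa|)$, $$\Phi_{\mu,A_1}(\zeta)=2A_1\begin{pmatrix}\omega_ck_x'\cos\zeta-fk_y'\sin\zeta\\ \omega_ck_y'\cos\zeta+fk_x'\sin\zeta\\ k_c^2H_0\cos\zeta\end{pmatrix}+\mathcal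 O\bigl(|A_1|(|A_1|+|\mu|)\bigr).$$ 3. (Supercriticality.) The solutions of (B) in $(-\varepsilon,\varepsilon)^4$ with $A_1\neq0$ are exactly those with $\alpha=\hat\alpha(|A_1|,\kappa)$, $s=\hat s(|A_1|,\kappa)$, where $\hat\alpha,\hat s$ are continuous functions of $(a,\kappa)\in[0,\varepsilon)\times(-\varepsilon,\varepsilon)$, independent of the direction of $\mathbf k_c$, with $|\hat\alpha(a,\kappa)-ca|\le M(a^2+\kappa^2)$, $|\hat s(a,\kappa)-\kappa f^2/\omega_c|\le M(a^2+\kappa^2)$ and $\hat\alpha$ strictly increasing in $a$; and the trivial flow $(\mathbf v,\eta)=(0,0)$ is linearly unstable against perturbations with wave vector $(1+\kappa)\mathbf k_c$ if and only if $\alpha>\hat\alpha(0,\kappa)$ (for $\kappa=0$: if and only if $\alpha>0$). Thus the bifurcation is supercritical: the waves branch off, with amplitude linear in $\alpha$ at leading order, on the side where the trivial flow is unstable. -/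

import Mathlib

open MeasureTheory Set

noncomputable section

namespace ShallowWater

/-! ### The rotating shallow water equations with backscatter and bottom drag -/

/-- Parameters: gravity `g`, mean depth `H₀`, Coriolis parameter `f`, backscatter (hyperviscosity
`d₁, d₂`, negative viscosity `b₁, b₂`), linear and quadratic bottom drag `C`, `Q`. -/
structure Params where
  g : ℝ
  H₀ : ℝ
  f : ℝ
  d₁ : ℝ
  d₂ : ℝ
  b₁ : ℝ
  b₂ : ℝ
  C : ℝ
  Q : ℝ

/-- A scalar field, as a function of `t`, `x`, `y`. -/
abbrev Field : Type := ℝ → ℝ → ℝ → ℝ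

/-- Time derivative. -/
def dt (w : Field) : Field := fun t x y => deriv (fun τ => w τ x y) t

/-- Derivative in `x`. -/
def dx (w : Field) : Field := fun t x y => deriv (fun ξ => w t ξ y) x

/-- Derivative in `y`. -/
def dy (w : Field) : Field := fun t x y => deriv (fun ξ => w t x ξ) y

/-- Horizontal Laplacian. -/
def lap (w : Field) : Field := fun t x y => dx (dx w) t x y + dy (dy w) t x y

/-- The equations hold at the point `(t, x, y)` for the velocity field `(u, v)` and the surface
deviation `η`; the fluid layer has positive thickness there. -/
structure SolvesAt (p : Params) (u v η : Field) (t x y : ℝ) : Prop where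
  thickness : 0 < p.H₀ + η t x y
  momentum_x :
    dt u t x y + (u t x y * dx u t x y + v t x y * dy u t x y)
      = p.f * v t x y - p.g * dx η t x y
        - (p.d₁ * lap (lap u) t x y + p.b₁ * lap u t x y)
        - (p.C + p.Q * √(u t x y ^ 2 + v t x y ^ 2)) / (p.H₀ + η t x y) * u t x y
  momentum_y :
    dt v t x y + (u t x y * dx v t x y + v t x y * dy v t x y)
      = -p.f * u t x y - p.g * dy η t x y
        - (p.d₂ * lap (lap v) t x y + p.b₂ * lap v t x y)
        - (p.C + p.Q * √(u t x y ^ 2 + v t x y ^ 2)) / (p.H₀ + η t x y) * v t x y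
  mass :
    dt η t x y + (u t x y * dx η t x y + v t x y * dy η t x y)
      = -(p.H₀ + η t x y) * (dx u t x y + dy v t x y)

/-- The equations hold almost everywhere in space-time. (Used for travelling waves whose profiles
lie in `H⁴ × H⁴ × H¹`, for which the partial derivatives exist almost everywhere and are the weak
derivatives.) -/
def IsStrongSolution (p : Params) (u v η : Field) : Prop :=
  ∀ᵐ z : ℝ × ℝ × ℝ, SolvesAt p u v η z.1 z.2.1 z.2.2

/-- The symbol, at the wave vector `(ℓ₁, ℓ₂)`, of the linearisation at the trivial flow: it acts
on the amplitude of perturbations proportional to `exp (i (ℓ₁ x + ℓ₂ y))`. -/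
def symbol (p : Params) (ℓ₁ ℓ₂ : ℝ) : Matrix (Fin 3) (Fin 3) ℂ :=
  !![-((p.d₁ * (ℓ₁ ^ 2 + ℓ₂ ^ 2) ^ 2 - p.b₁ * (ℓ₁ ^ 2 + ℓ₂ ^ 2) + p.C / p.H₀ : ℝ) : ℂ),
      (p.f : ℂ), -(p.g : ℂ) * (Complex.I * ℓ₁);
    -(p.f : ℂ),
      -((p.d₂ * (ℓ₁ ^ 2 + ℓ₂ ^ 2) ^ 2 - p.b₂ * (ℓ₁ ^ 2 + ℓ₂ ^ 2) + p.C / p.H₀ : ℝ) : ℂ),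
      -(p.g : ℂ) * (Complex.I * ℓ₂);
    -(p.H₀ : ℂ) * (Complex.I * ℓ₁), -(p.H₀ : ℂ) * (Complex.I * ℓ₂), 0]

/-- The trivial flow is linearly unstable against perturbations with wave vector `(ℓ₁, ℓ₂)`. -/
def TrivialFlowUnstable (p : Params) (ℓ₁ ℓ₂ : ℝ) : Prop :=
  ∃ lam ∈ spectrum ℂ (symbol p ℓ₁ ℓ₂), 0 < lam.re

/-! ### Periodic wave profiles -/

/-- `w` is (the continuous representative of) an element of `H^(m+1)` of the circle of length
`2π`: it is `2π`-periodic and of class `C^m`, and its `m`-th derivative is absolutely continuous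
with square integrable derivative. -/
def IsPerSobolevSucc (m : ℕ) (w : ℝ → ℝ) : Prop :=
  Function.Periodic w (2 * Real.pi) ∧ ContDiff ℝ m w ∧
    AbsolutelyContinuousOnInterval (iteratedDeriv m w) 0 (2 * Real.pi) ∧
    MemLp (iteratedDeriv (m + 1) w) 2 (volume.restrict (Ioc 0 (2 * Real.pi)))

/-- Square of the `H^m` norm on the circle of length `2π`. -/
def sobolevSq (m : ℕ) (w : ℝ → ℝ) : ℝ :=
  ∑ j ∈ Finset.range (m + 1), ∫ ξ in (0 : ℝ)..(2 * Real.pi), iteratedDeriv j w ξ ^ 2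

/-- The profile of a wave: two velocity components and the surface deviation, as functions of
the phase. -/
@[ext]
structure Profile where
  u : ℝ → ℝ
  v : ℝ → ℝ
  η : ℝ → ℝ

namespace Profile

instance : Sub Profile :=
  ⟨fun U V => ⟨fun ξ => U.u ξ - V.u ξ, fun ξ => U.v ξ - V.v ξ, fun ξ => U.η ξ - V.η ξ⟩⟩

/-- Translation of a profile. -/
def shift (θ : ℝ) (U : Profile) : Profile :=
  ⟨fun ξ => U.u (ξ + θ), fun ξ => U.v (ξ + θ), fun ξ => U.η (ξ + θ)⟩

/-- Membership in `H⁴ × H⁴ × H¹` (periodic). -/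
def MemX (U : Profile) : Prop :=
  IsPerSobolevSucc 3 U.u ∧ IsPerSobolevSucc 3 U.v ∧ IsPerSobolevSucc 0 U.η

/-- The norm of `H⁴ × H⁴ × H¹`. -/
def normX (U : Profile) : ℝ :=
  √(sobolevSq 4 U.u + sobolevSq 4 U.v + sobolevSq 1 U.η)

end Profile

/-- The field `w (ℓ₁ x + ℓ₂ y - ω t)`. -/
def travel (w : ℝ → ℝ) (ℓ₁ ℓ₂ ω : ℝ) : Field := fun t x y => w (ℓ₁ * x + ℓ₂ * y - ω * t)

/-! ### Isotropic backscatter near criticality -/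

/-- The fixed parameters in the isotropic case. -/
structure IsoData where
  g : ℝ
  H₀ : ℝ
  f : ℝ
  b : ℝ
  d : ℝ
  Q : ℝ

namespace IsoData

variable (D : IsoData)

/-- Critical wave number. -/
def kc : ℝ := √(D.b / (2 * D.d))

/-- Critical linear bottom drag. -/
def Cc : ℝ := D.b ^ 2 * D.H₀ / (4 * D.d)

/-- Critical frequency. -/
def ωc : ℝ := √(D.g * D.H₀ * D.kc ^ 2 + D.f ^ 2)

/-- The parameters of the equations with isotropic backscatter and drag `C = Cc - α H₀`. -/
def params (α : ℝ) : Params where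
  g := D.g
  H₀ := D.H₀
  f := D.f
  d₁ := D.d
  d₂ := D.d
  b₁ := D.b
  b₂ := D.b
  C := D.Cc - α * D.H₀
  Q := D.Q

def I₁ : ℝ :=
  1 / (2 * Real.pi) * ∫ ξ in (0 : ℝ)..(2 * Real.pi),
    √(D.f ^ 2 + D.kc ^ 2 * D.g * D.H₀ * Real.cos ξ ^ 2)

def I₂ : ℝ :=
  1 / (2 * Real.pi) * ∫ ξ in (0 : ℝ)..(2 * Real.pi),
    √(D.f ^ 2 + D.kc ^ 2 * D.g * D.H₀ * Real.cos ξ ^ 2) * Real.cos (2 * ξ)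

/-- The coefficient of `|A|` in the amplitude equation. -/
def ampCoeff : ℝ :=
  2 * D.Q * D.kc / D.H₀ *
    (D.I₁ + D.kc ^ 2 * D.g * D.H₀ / (2 * D.f ^ 2 + D.kc ^ 2 * D.g * D.H₀) * D.I₂)

/-- The bifurcation equations for `(α, s, κ, A)` with remainder terms `R₁`, `R₂`: the first one
corrects the speed, the second one determines the amplitude. -/
def BifEqs (R₁ R₂ : ℝ × ℝ × ℝ × ℝ → ℝ) (α s κ A : ℝ) : Prop :=
  0 = A * (-s + κ * (D.f ^ 2 / D.ωc) + R₁ (α, s, κ, A)) ∧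
    0 = A * (α - D.ampCoeff * |A| + R₂ (α, s, κ, A))

/-- `U` is the profile, in `H⁴ × H⁴ × H¹` and with mean zero surface deviation, of a travelling
wave of the shallow water equations with phase `(1 + κ) (k₁ x + k₂ y - (ωc - s) t)`. -/
def IsWave (k₁ k₂ α s κ : ℝ) (U : Profile) : Prop :=
  U.MemX ∧ (∫ ξ in (0 : ℝ)..(2 * Real.pi), U.η ξ) = 0 ∧
    IsStrongSolution (D.params α)
      (travel U.u ((1 + κ) * k₁) ((1 + κ) * k₂) ((1 + κ) * (D.ωc - s)))
      (travel U.v ((1 + κ) * k₁) ((1 + κ) * k₂) ((1 + κ) * (D.ωc - s)))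
      (travel U.η ((1 + κ) * k₁) ((1 + κ) * k₂) ((1 + κ) * (D.ωc - s)))

/-- The leading order profile with amplitude `A`. -/
def leading (k₁ k₂ A : ℝ) : Profile where
  u := fun ζ => 2 * A * (D.ωc * k₁ * Real.cos ζ - D.f * k₂ * Real.sin ζ)
  v := fun ζ => 2 * A * (D.ωc * k₂ * Real.cos ζ + D.f * k₁ * Real.sin ζ)
  η := fun ζ => 2 * A * (D.kc ^ 2 * D.H₀ * Real.cos ζ)

end IsoData

end ShallowWater

end

open ShallowWater

/-!
# Inertia-gravity waves bifurcating from the trivial flow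

*Reduction.* For a travelling wave, the conservation of mass says that the layer thickness times
`ωc - s - k · v` is constant. Together with the mean zero condition this expresses the surface
deviation through the component of the velocity along the wave vector (`elev`, `eq_elev_of_mass`).
What remains are the two momentum equations for the velocity components `p`, `q` along and across the
wave vector; no direction appears in them, whence all constants are independent of it. We substitute
`(p, q) = (1 + ∂)⁻⁴ w` with `w` a pair of continuous periodic functions, so that the residual of the
equations is a map of the Banach space `PerC2` (`residual`). Solutions of the reduced equations are
profiles of waves (`isWave_profile`). Conversely a wave with profile in `H⁴ × H⁴ × H¹` has this form
(`exists_eq_profile`), since its fourth derivatives are continuous by the equation.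

*The branch.* The linearisation at criticality has a two-dimensional kernel, spanned by the critical
eigenfunction `φ` and its derivative, that is, by its translates. The drag `|v| v` is not of class
`C²`, but of homogeneity two: after the ansatz `(p, q) = t (φ + y)`, with `y` in a complement of the
kernel, and division of the equations by the amplitude `t ≥ 0`, it enters with a factor `t`. The
resulting map is a smooth one plus `t` times a Lipschitz one, hence strictly differentiable with a
rate (`QuadApprox`). The unknowns are `α`, `s` and `y`; the parameters are `t` and `κ`. The derivative
in the unknowns is the linearisation bordered by the derivatives in `α` and `s`. It is a compact
perturbation of a multiple of the identity, and injective by an energy identity, hence invertible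
(`bordered_isInvertible`). The implicit function theorem gives a Lipschitz branch `ψ` over `(t, κ)`,
and pairing the linearised equation with the kernel gives the slopes of `α` and `s`
(`exists_branch`). The slope of `α` in `t` is the pairing of the drag of `φ` with `φ`
(`pair_amplitude`): it is the coefficient `c = ampCoeff`, which is positive since `I₁` and `I₂` are.

*Bifurcation equations and correspondence.* With `α = αb (|A|, κ)` and `s = sb (|A|, κ)` along the
branch, the remainders are `R₁ = sb - κ f² / ωc` and `R₂ = c |A| - αb`. They are quadratically small by
the rate in `QuadApprox`, which also gives strict monotonicity of `αb` in the amplitude. All small waves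
are translates of waves on the branch (`exists_classification`): a small solution is close to its
projection to the kernel (`exists_norm_sub_proj_le`), a translation makes this projection a
nonnegative multiple of `φ`, and division by the amplitude leads to a solution to which the uniqueness
in the implicit function theorem applies. The amplitude, the modulus of the projection to the kernel,
is invariant under translation, which makes it unique.

*Stability.* At zero amplitude the equation on the branch is linear and has a nontrivial solution in
the first Fourier modes, which forces `α` to be the value `threshold κ` at which the dissipation at
the wave number `(1 + κ) kc` vanishes. By an energy balance, the trivial flow is unstable exactly
above this value (`trivialFlowUnstable_iff`).
-/


noncomputable section
namespace ShallowWater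

/-! ### Continuous functions on the circle -/

/-- The circle has positive length. -/
instance factTwoPiPos : Fact (0 < 2 * Real.pi) := ⟨Real.two_pi_pos⟩

/-- The Banach algebra of continuous `2π`-periodic functions. -/
abbrev PerC : Type := C(AddCircle (2 * Real.pi), ℝ)

namespace PerC

/-- A continuous `2π`-periodic function on the line, as an element of `PerC`. -/
def ofPeriodic (f : ℝ → ℝ) (hf : Continuous f) (hp : Function.Periodic f (2 * Real.pi)) : PerC where
  toFun := hp.lift
  continuous_toFun := continuous_coinduced_dom.mpr hf

theorem ext_coe {f g : PerC} (h : ∀ x : ℝ, f (x : AddCircle _) = g (x : AddCircle _)) : f = g := by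
  ext y
  obtain ⟨x, rfl⟩ := QuotientAddGroup.mk_surjective y
  exact h x

theorem norm_le_iff {f : PerC} {C : ℝ} (hC : 0 ≤ C) :
    ‖f‖ ≤ C ↔ ∀ x : ℝ, |f (x : AddCircle _)| ≤ C := by
  rw [ContinuousMap.norm_le _ hC]
  constructor
  · intro h x
    exact h x
  · intro h y
    obtain ⟨x, rfl⟩ := QuotientAddGroup.mk_surjective y
    exact h x

theorem abs_apply_le (f : PerC) (x : ℝ) : |f (x : AddCircle _)| ≤ ‖f‖ :=
  ContinuousMap.norm_coe_le_norm f _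

theorem continuous_coe (f : PerC) : Continuous fun x : ℝ => f (x : AddCircle (2 * Real.pi)) :=
  f.continuous.comp (AddCircle.continuous_mk' _)

theorem periodic_coe (f : PerC) :
    Function.Periodic (fun x : ℝ => f (x : AddCircle (2 * Real.pi))) (2 * Real.pi) := by
  intro x
  simp

theorem intervalIntegrable_coe (f : PerC) (a b : ℝ) :
    IntervalIntegrable (fun x : ℝ => f (x : AddCircle (2 * Real.pi))) volume a b :=
  (continuous_coe f).intervalIntegrable _ _

/-- The mean value of a periodic function. -/
def avg : PerC →L[ℝ] ℝ :=
  LinearMap.mkContinuous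
    { toFun := fun f => 1 / (2 * Real.pi) * ∫ x in (0 : ℝ)..(2 * Real.pi), f (x : AddCircle _)
      map_add' := by
        intro f g
        have := intervalIntegral.integral_add (intervalIntegrable_coe f 0 (2 * Real.pi))
          (intervalIntegrable_coe g 0 (2 * Real.pi))
        simp only [ContinuousMap.add_apply]
        rw [this]
        ring
      map_smul' := by
        intro c f
        simp only [ContinuousMap.smul_apply, smul_eq_mul, intervalIntegral.integral_const_mul,
          RingHom.id_apply]
        ring } 1 (by
    intro f
    have h := intervalIntegral.norm_integral_le_of_norm_le_const (a := 0) (b := 2 * Real.pi)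
      (f := fun x : ℝ => f (x : AddCircle (2 * Real.pi))) (C := ‖f‖)
      (fun x _ => abs_apply_le f x)
    have hpi := Real.two_pi_pos
    simp only [LinearMap.coe_mk, AddHom.coe_mk, norm_mul, one_mul]
    rw [sub_zero, abs_of_pos hpi] at h
    rw [Real.norm_of_nonneg (by positivity), one_div, inv_mul_le_iff₀ hpi]
    linarith)

theorem avg_apply (f : PerC) :
    avg f = 1 / (2 * Real.pi) * ∫ x in (0 : ℝ)..(2 * Real.pi), f (x : AddCircle _) := rfl

theorem avg_eq_of_coe {f : PerC} {g : ℝ → ℝ} (h : ∀ x : ℝ, f (x : AddCircle _) = g x) :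
    avg f = 1 / (2 * Real.pi) * ∫ x in (0 : ℝ)..(2 * Real.pi), g x := by
  rw [avg_apply]
  simp only [h]

@[simp] theorem avg_one : avg 1 = 1 := by
  rw [avg_apply]
  simp only [ContinuousMap.one_apply, intervalIntegral.integral_const, smul_eq_mul]
  have := Real.pi_pos
  field_simp
  ring

theorem avg_nonneg {f : PerC} (h : ∀ x : ℝ, 0 ≤ f (x : AddCircle _)) : 0 ≤ avg f := by
  rw [avg_apply]
  have := Real.pi_pos
  exact mul_nonneg (by positivity)
    (intervalIntegral.integral_nonneg (by positivity) (fun x _ => h x))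

theorem avg_pos {f : PerC} (h : ∀ x : ℝ, 0 ≤ f (x : AddCircle _)) (hne : f ≠ 0) : 0 < avg f := by
  have hpi := Real.two_pi_pos
  obtain ⟨x₀, hx₀⟩ : ∃ x : ℝ, f (x : AddCircle _) ≠ 0 := by
    by_contra! hall
    exact hne (ext_coe fun x => by simpa using hall x)
  -- the point may be moved into the period interval
  obtain ⟨y, hy, hxy⟩ := (periodic_coe f).exists_mem_Ico₀ hpi x₀
  rw [avg_apply]
  refine mul_pos (by positivity) ?_
  refine intervalIntegral.integral_pos hpi (continuous_coe f).continuousOn (fun x _ => h x)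
    ⟨y, Ico_subset_Icc_self hy, ?_⟩
  have hxy' : f (x₀ : AddCircle (2 * Real.pi)) = f (y : AddCircle (2 * Real.pi)) := hxy
  rw [← hxy']
  exact lt_of_le_of_ne (h x₀) (Ne.symm hx₀)

theorem eq_zero_of_avg_mul_self {f : PerC} (h : avg (f * f) = 0) : f = 0 := by
  by_contra hne
  have : f * f ≠ 0 := by
    intro h0
    apply hne
    apply ext_coe
    intro x
    have := congrArg (fun g : PerC => g (x : AddCircle _)) h0
    simpa using this
  have := avg_pos (f := f * f) (fun x => by simpa using mul_self_nonneg _) this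
  linarith

/-- `f'` is the derivative of the periodic function `f`. -/
def IsDeriv (f f' : PerC) : Prop :=
  ∀ x : ℝ, HasDerivAt (fun y : ℝ => f (y : AddCircle (2 * Real.pi))) (f' (x : AddCircle _)) x

namespace IsDeriv

variable {f f' g g' : PerC}

theorem add (hf : IsDeriv f f') (hg : IsDeriv g g') : IsDeriv (f + g) (f' + g') :=
  fun x => (hf x).add (hg x)

theorem sub (hf : IsDeriv f f') (hg : IsDeriv g g') : IsDeriv (f - g) (f' - g') :=
  fun x => (hf x).sub (hg x)

theorem smul (c : ℝ) (hf : IsDeriv f f') : IsDeriv (c • f) (c • f') :=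
  fun x => (hf x).const_mul c

theorem mul (hf : IsDeriv f f') (hg : IsDeriv g g') : IsDeriv (f * g) (f' * g + f * g') :=
  fun x => (hf x).mul (hg x)

theorem avg_eq_zero (hf : IsDeriv f f') : avg f' = 0 := by
  rw [avg_apply, intervalIntegral.integral_eq_sub_of_hasDerivAt (fun x _ => hf x)
    (intervalIntegrable_coe f' _ _)]
  have := periodic_coe f 0
  simp only [zero_add] at this
  rw [this]
  simp

/-- Integration by parts over a period. -/
theorem avg_mul (hf : IsDeriv f f') (hg : IsDeriv g g') : avg (f' * g) = - avg (f * g') := by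
  have := (hf.mul hg).avg_eq_zero
  rw [map_add] at this
  linarith

theorem unique {f'' : PerC} (hf : IsDeriv f f') (hf2 : IsDeriv f f'') : f' = f'' :=
  ext_coe fun x => (hf x).unique (hf2 x)

theorem avg_mul_self (hf : IsDeriv f f') : avg (f' * f) = 0 := by
  have := hf.avg_mul hf
  rw [mul_comm f f'] at this
  linarith

end IsDeriv

/-- The cosine as a periodic function. -/
def cosC : PerC := ofPeriodic Real.cos Real.continuous_cos Real.cos_periodic

/-- The sine as a periodic function. -/
def sinC : PerC := ofPeriodic Real.sin Real.continuous_sin Real.sin_periodic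

@[simp] theorem cosC_coe (x : ℝ) : cosC (x : AddCircle _) = Real.cos x := rfl
@[simp] theorem sinC_coe (x : ℝ) : sinC (x : AddCircle _) = Real.sin x := rfl

theorem isDeriv_cosC : IsDeriv cosC (-sinC) := fun x => Real.hasDerivAt_cos x
theorem isDeriv_sinC : IsDeriv sinC cosC := fun x => Real.hasDerivAt_sin x

theorem avg_cos_mul_cos : avg (cosC * cosC) = 1 / 2 := by
  rw [avg_eq_of_coe (g := fun x => Real.cos x ^ 2) (fun x => by simp [sq]), integral_cos_sq]
  have := Real.pi_pos
  simp
  field_simp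

theorem avg_sin_mul_sin : avg (sinC * sinC) = 1 / 2 := by
  rw [avg_eq_of_coe (g := fun x => Real.sin x ^ 2) (fun x => by simp [sq]), integral_sin_sq]
  have := Real.pi_pos
  simp
  field_simp

theorem avg_sin_mul_cos : avg (sinC * cosC) = 0 := by
  rw [mul_comm sinC cosC]
  exact isDeriv_sinC.avg_mul_self

theorem avg_cos_mul_sin : avg (cosC * sinC) = 0 := isDeriv_sinC.avg_mul_self

theorem avg_cos : avg cosC = 0 := isDeriv_sinC.avg_eq_zero

/-- Translation of periodic functions. -/
def shift (θ : ℝ) (f : PerC) : PerC :=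
  f.comp ⟨fun x => x + (θ : AddCircle (2 * Real.pi)), by fun_prop⟩

@[simp] theorem shift_coe (θ : ℝ) (f : PerC) (x : ℝ) :
    shift θ f (x : AddCircle _) = f ((x + θ : ℝ) : AddCircle _) := by
  simp [shift]

theorem avg_shift (θ : ℝ) (f : PerC) : avg (shift θ f) = avg f := by
  rw [avg_eq_of_coe (g := fun x : ℝ => (fun y : ℝ => f (y : AddCircle (2 * Real.pi))) (x + θ))
    (fun x => shift_coe θ f x), avg_apply]
  congr 1
  rw [intervalIntegral.integral_comp_add_right (fun y : ℝ => f (y : AddCircle (2 * Real.pi)))]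
  have := (periodic_coe f).intervalIntegral_add_eq θ 0
  simp only [zero_add] at this ⊢
  rw [← this]
  congr 1
  ring

theorem shift_mul (θ : ℝ) (f g : PerC) : shift θ (f * g) = shift θ f * shift θ g := rfl

theorem shift_pi_cosC : shift Real.pi cosC = -cosC :=
  ext_coe fun x => by rw [shift_coe, cosC_coe, Real.cos_add_pi]; rfl

theorem shift_pi_sinC : shift Real.pi sinC = -sinC :=
  ext_coe fun x => by rw [shift_coe, sinC_coe, Real.sin_add_pi]; rfl

/-- A function that changes sign under translation by half a period has mean zero. -/
theorem avg_eq_zero_of_shift_pi {f : PerC} (h : shift Real.pi f = -f) : avg f = 0 := by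
  have := avg_shift Real.pi f
  rw [h, map_neg] at this
  linarith

end PerC
end ShallowWater
end

noncomputable section
namespace ShallowWater
namespace PerC

/-! ### The resolvent of the derivative -/

/-- The integral of `exp y * w y` over the period interval, divided by `exp (2π) - 1`: the initial
value of the periodic solution of `P' + P = w`. -/
def resolventInit (w : PerC) : ℝ :=
  (Real.exp (2 * Real.pi) - 1)⁻¹ * ∫ y in (0 : ℝ)..(2 * Real.pi), Real.exp y * w (y : AddCircle _)

/-- The periodic solution of `P' + P = w`, by variation of constants. -/
def resolventFun (w : PerC) (x : ℝ) : ℝ :=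
  Real.exp (-x) * (resolventInit w + ∫ y in (0 : ℝ)..x, Real.exp y * w (y : AddCircle _))

theorem continuous_exp_mul (w : PerC) :
    Continuous fun y : ℝ => Real.exp y * w (y : AddCircle (2 * Real.pi)) :=
  Real.continuous_exp.mul (continuous_coe w)

theorem hasDerivAt_resolventFun (w : PerC) (x : ℝ) :
    HasDerivAt (resolventFun w) (w (x : AddCircle _) - resolventFun w x) x := by
  have h1 := intervalIntegral.integral_hasDerivAt_right
    ((continuous_exp_mul w).intervalIntegrable 0 x)
    ((continuous_exp_mul w).stronglyMeasurableAtFilter _ _) (continuous_exp_mul w).continuousAt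
  have h2 := (hasDerivAt_neg x).exp
  have h3 := h2.mul (h1.const_add (resolventInit w))
  refine h3.congr_deriv ?_
  simp only [resolventFun]
  have : Real.exp (-x) * Real.exp x = 1 := by rw [← Real.exp_add]; simp
  linear_combination (w (x : AddCircle _)) * this

theorem periodic_resolventFun (w : PerC) :
    Function.Periodic (resolventFun w) (2 * Real.pi) := by
  intro x
  have hii := fun a b => (continuous_exp_mul w).intervalIntegrable (μ := volume) a b
  have hsplit := intervalIntegral.integral_add_adjacent_intervals (hii 0 (2 * Real.pi))
    (hii (2 * Real.pi) (x + 2 * Real.pi))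
  have hshift : ∫ y in (2 * Real.pi)..(x + 2 * Real.pi), Real.exp y * w (y : AddCircle _)
      = Real.exp (2 * Real.pi) * ∫ y in (0 : ℝ)..x, Real.exp y * w (y : AddCircle _) := by
    have := intervalIntegral.integral_comp_add_right (a := 0) (b := x)
      (fun y : ℝ => Real.exp y * w (y : AddCircle (2 * Real.pi))) (2 * Real.pi)
    rw [zero_add] at this
    rw [← this, ← intervalIntegral.integral_const_mul]
    congr 1
    ext y
    rw [Real.exp_add]
    have := periodic_coe w y
    simp only at this
    rw [this]
    ring
  have hne : Real.exp (2 * Real.pi) - 1 ≠ 0 := by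
    have := Real.add_one_lt_exp (x := 2 * Real.pi) (by have := Real.pi_pos; positivity)
    have := Real.pi_pos
    linarith
  have hinit : ∫ y in (0 : ℝ)..(2 * Real.pi), Real.exp y * w (y : AddCircle _)
      = (Real.exp (2 * Real.pi) - 1) * resolventInit w := by
    rw [resolventInit, mul_inv_cancel_left₀ hne]
  have hexp : Real.exp (-(x + 2 * Real.pi)) * Real.exp (2 * Real.pi) = Real.exp (-x) := by
    rw [← Real.exp_add]; congr 1; ring
  simp only [resolventFun]
  rw [← hsplit, hshift, hinit, ← hexp]
  ring

theorem continuous_resolventFun (w : PerC) : Continuous (resolventFun w) :=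
  continuous_iff_continuousAt.mpr fun x => (hasDerivAt_resolventFun w x).continuousAt

theorem abs_resolventFun_le (w : PerC) (x : ℝ) :
    |resolventFun w x| ≤ (((Real.exp (2 * Real.pi) - 1)⁻¹ + 1) *
      (Real.exp (2 * Real.pi) * (2 * Real.pi))) * ‖w‖ := by
  have hpi := Real.two_pi_pos
  obtain ⟨y, hy, hxy⟩ := (periodic_resolventFun w).exists_mem_Ico₀ hpi x
  rw [hxy]
  have hE : 0 < Real.exp (2 * Real.pi) - 1 := by
    have := Real.add_one_lt_exp (x := 2 * Real.pi) hpi.ne'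
    linarith
  have hint : ∀ z ∈ Icc 0 (2 * Real.pi),
      |∫ y in (0 : ℝ)..z, Real.exp y * w (y : AddCircle _)|
        ≤ Real.exp (2 * Real.pi) * (2 * Real.pi) * ‖w‖ := by
    intro z hz
    have := intervalIntegral.norm_integral_le_of_norm_le_const (a := 0) (b := z)
      (f := fun y : ℝ => Real.exp y * w (y : AddCircle (2 * Real.pi)))
      (C := Real.exp (2 * Real.pi) * ‖w‖) (by
        intro t ht
        rw [uIoc_of_le hz.1] at ht
        rw [norm_mul, Real.norm_of_nonneg (Real.exp_pos t).le]
        gcongr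
        · exact ht.2.trans hz.2
        · exact abs_apply_le w t)
    rw [sub_zero, abs_of_nonneg hz.1, Real.norm_eq_abs] at this
    refine this.trans ?_
    have h1 : Real.exp (2 * Real.pi) * ‖w‖ * z ≤ Real.exp (2 * Real.pi) * ‖w‖ * (2 * Real.pi) := by
      gcongr; exact hz.2
    linarith
  have hinit : |resolventInit w| ≤ (Real.exp (2 * Real.pi) - 1)⁻¹ *
      (Real.exp (2 * Real.pi) * (2 * Real.pi) * ‖w‖) := by
    rw [resolventInit, abs_mul, abs_of_pos (inv_pos.mpr hE)]
    gcongr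
    exact hint _ ⟨hpi.le, le_rfl⟩
  have h2 := hint y (Ico_subset_Icc_self hy)
  have hexp : Real.exp (-y) ≤ 1 := Real.exp_le_one_iff.mpr (by linarith [hy.1])
  rw [resolventFun, abs_mul, abs_of_pos (Real.exp_pos _)]
  calc Real.exp (-y) * |resolventInit w + ∫ y in (0 : ℝ)..y, Real.exp y * w (y : AddCircle _)|
      ≤ 1 * (|resolventInit w| + |∫ y in (0 : ℝ)..y, Real.exp y * w (y : AddCircle _)|) := by
        gcongr
        exact abs_add_le _ _
    _ ≤ _ := by rw [one_mul]; refine (add_le_add hinit h2).trans (le_of_eq (by ring))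

/-- The bounded operator `(1 + ∂)⁻¹` on periodic functions. -/
def resolvent : PerC →L[ℝ] PerC :=
  LinearMap.mkContinuous
    { toFun := fun w =>
        ofPeriodic (resolventFun w) (continuous_resolventFun w) (periodic_resolventFun w)
      map_add' := by
        intro v w
        refine ext_coe fun x => ?_
        have hint : ∀ a b : ℝ, ∫ y in a..b, Real.exp y * (v + w) (y : AddCircle _)
            = (∫ y in a..b, Real.exp y * v (y : AddCircle _))
              + ∫ y in a..b, Real.exp y * w (y : AddCircle _) := by
          intro a b
          rw [← intervalIntegral.integral_add ((continuous_exp_mul v).intervalIntegrable a b)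
            ((continuous_exp_mul w).intervalIntegrable a b)]
          simp only [ContinuousMap.add_apply, mul_add]
        change resolventFun (v + w) x = resolventFun v x + resolventFun w x
        simp only [resolventFun, resolventInit]
        rw [hint, hint]
        ring
      map_smul' := by
        intro c w
        refine ext_coe fun x => ?_
        have hint : ∀ a b : ℝ, ∫ y in a..b, Real.exp y * (c • w) (y : AddCircle _)
            = c * ∫ y in a..b, Real.exp y * w (y : AddCircle _) := by
          intro a b
          rw [← intervalIntegral.integral_const_mul]
          congr 1
          ext y
          simp only [ContinuousMap.smul_apply, smul_eq_mul]
          ring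
        change resolventFun (c • w) x = c * resolventFun w x
        simp only [resolventFun, resolventInit]
        rw [hint, hint]
        ring } _ (by
    intro w
    have hE : 0 < Real.exp (2 * Real.pi) - 1 := by
      have := Real.add_one_lt_exp (x := 2 * Real.pi) Real.two_pi_pos.ne'
      linarith [Real.two_pi_pos]
    have hpi := Real.pi_pos
    exact (norm_le_iff (by positivity)).mpr (fun x => abs_resolventFun_le w x))

theorem isDeriv_resolvent (w : PerC) : IsDeriv (resolvent w) (w - resolvent w) :=
  fun x => hasDerivAt_resolventFun w x

theorem eq_zero_of_isDeriv_neg {f : PerC} (h : IsDeriv f (-f)) : f = 0 := by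
  apply eq_zero_of_avg_mul_self
  have := h.avg_mul_self
  rw [neg_mul, map_neg] at this
  linarith

/-- The resolvent is a left inverse of `1 + ∂`: there are no periodic solutions of `f' = -f` other
than zero. -/
theorem resolvent_add_deriv {f f' : PerC} (h : IsDeriv f f') : resolvent (f + f') = f := by
  have h1 := (isDeriv_resolvent (f + f')).sub h
  have h2 : f + f' - resolvent (f + f') - f' = -(resolvent (f + f') - f) := by abel
  rw [h2] at h1
  exact sub_eq_zero.mp (eq_zero_of_isDeriv_neg h1)

theorem eq_zero_of_resolvent_eq_zero {w : PerC} (h : resolvent w = 0) : w = 0 := by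
  have h1 := isDeriv_resolvent w
  rw [h, sub_zero] at h1
  have h0 : IsDeriv (0 : PerC) 0 := fun x => hasDerivAt_const x (0 : ℝ)
  exact h1.unique h0

theorem IsDeriv.shift {f f' : PerC} (h : IsDeriv f f') (θ : ℝ) :
    IsDeriv (shift θ f) (shift θ f') := by
  intro x
  simp only [shift_coe]
  exact (h (x + θ)).comp_add_const x θ

theorem resolvent_shift (θ : ℝ) (w : PerC) : resolvent (shift θ w) = shift θ (resolvent w) := by
  have h := (isDeriv_resolvent w).shift θ
  have h2 := resolvent_add_deriv h
  rw [← h2]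
  congr 1
  exact ext_coe fun x => by simp

/-- The operator `(1 + ∂)⁻¹` is compact, by the Arzelà–Ascoli theorem. -/
theorem isCompactOperator_resolvent : IsCompactOperator resolvent := by
  refine (isCompactOperator_iff_isCompact_closure_image_closedBall (𝕜₁ := ℝ)
    resolvent.toLinearMap zero_lt_one).mpr ?_
  set e := ContinuousMap.isometryEquivBoundedOfCompact (AddCircle (2 * Real.pi)) ℝ
  set B : Set PerC := resolvent.toLinearMap '' Metric.closedBall 0 1
  have hB : ∀ f ∈ B, ∃ w : PerC, ‖w‖ ≤ 1 ∧ resolvent w = f := by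
    rintro f ⟨w, hw, rfl⟩
    exact ⟨w, by simpa using hw, rfl⟩
  have hcomp : IsCompact (closure (e '' B)) := by
    refine BoundedContinuousFunction.arzela_ascoli (Icc (-‖resolvent‖) ‖resolvent‖) isCompact_Icc
      (e '' B) ?_ ?_
    · rintro _ y ⟨f, hf, rfl⟩
      obtain ⟨w, hw, rfl⟩ := hB f hf
      have h1 : ‖resolvent w‖ ≤ ‖resolvent‖ := by
        simpa using (resolvent.le_opNorm w).trans
          (mul_le_mul_of_nonneg_left hw (norm_nonneg resolvent))
      exact abs_le.mp ((ContinuousMap.norm_coe_le_norm (resolvent w) y).trans h1)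
    -- equicontinuity: the derivative `w - resolvent w` is bounded uniformly on the unit ball
    · intro y
      obtain ⟨x, rfl⟩ := QuotientAddGroup.mk_surjective y
      rw [Metric.equicontinuousAt_iff_right]
      intro ε hε
      have hnhds : nhds ((x : ℝ) : AddCircle (2 * Real.pi)) =
          Filter.map (fun y : ℝ => (y : AddCircle (2 * Real.pi))) (nhds x) :=
        QuotientAddGroup.nhds_eq _ x
      change ∀ᶠ y in nhds ((x : ℝ) : AddCircle (2 * Real.pi)), _
      rw [hnhds, Filter.eventually_map]
      set C := 1 + ‖resolvent‖ with hC
      have hCpos : 0 < C := by positivity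
      filter_upwards [Metric.ball_mem_nhds x (div_pos hε hCpos)] with y hy
      rintro ⟨_, f, hf, rfl⟩
      obtain ⟨w, hw, rfl⟩ := hB f hf
      have hbound : ∀ z : ℝ, ‖(w - resolvent w) (z : AddCircle (2 * Real.pi))‖ ≤ C := by
        intro z
        refine (ContinuousMap.norm_coe_le_norm _ _).trans ((norm_sub_le _ _).trans ?_)
        have := (resolvent.le_opNorm w).trans
          (mul_le_mul_of_nonneg_left hw (norm_nonneg resolvent))
        rw [mul_one] at this
        exact add_le_add hw this
      have hmv := Convex.norm_image_sub_le_of_norm_hasDerivWithin_le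
        (f := fun z : ℝ => resolvent w (z : AddCircle (2 * Real.pi)))
        (f' := fun z : ℝ => (w - resolvent w) (z : AddCircle (2 * Real.pi))) (s := univ) (C := C)
        (fun z _ => (isDeriv_resolvent w z).hasDerivWithinAt) (fun z _ => hbound z)
        convex_univ (mem_univ y) (mem_univ x)
      have hlt : C * ‖x - y‖ < ε := by
        rw [Metric.mem_ball, dist_comm, Real.dist_eq] at hy
        rw [Real.norm_eq_abs]
        have := (lt_div_iff₀ hCpos).mp hy
        linarith
      exact lt_of_le_of_lt hmv hlt
  have h2 : closure B = e ⁻¹' (closure (e '' B)) := by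
    have := e.toHomeomorph.image_closure B
    have h3 : e '' closure B = closure (e '' B) := this
    change closure B = e ⁻¹' closure (e '' B)
    rw [← h3, preimage_image_eq _ e.injective]
  rw [h2]
  exact e.toHomeomorph.isCompact_preimage.mpr hcomp

/-! ### Jets -/

/-- The `j`-th derivative (`j ≤ 4`) of `(1 + ∂)⁻⁴ w`, as a bounded operator: since `∂` acts on the
range of the resolvent `S` as `1 - S` after cancelling one factor `S`, it is `(1 - S)^j S^(4-j)`. -/
def jet (j : ℕ) : PerC →L[ℝ] PerC := (1 - resolvent) ^ j * resolvent ^ (4 - j)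

theorem isDeriv_jet {j : ℕ} (hj : j < 4) (w : PerC) : IsDeriv (jet j w) (jet (j + 1) w) := by
  obtain ⟨k, hk⟩ : ∃ k, 4 - j = k + 1 := ⟨3 - j, by omega⟩
  have hk' : 4 - (j + 1) = k := by omega
  have hc : Commute ((1 - resolvent) ^ j) resolvent :=
    ((Commute.one_left _).sub_left (Commute.refl _)).pow_left j
  have h1 : jet j = resolvent * ((1 - resolvent) ^ j * resolvent ^ k) := by
    rw [jet, hk, pow_succ', ← mul_assoc, hc.eq, mul_assoc]
  have h2 : jet (j + 1) = (1 - resolvent) * ((1 - resolvent) ^ j * resolvent ^ k) := by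
    rw [jet, hk', pow_succ', mul_assoc]
  rw [h1, h2]
  exact isDeriv_resolvent _

theorem eq_zero_of_jet_zero_eq_zero {w : PerC} (h : jet 0 w = 0) : w = 0 := by
  have h1 : resolvent (resolvent (resolvent (resolvent w))) = 0 := h
  exact eq_zero_of_resolvent_eq_zero (eq_zero_of_resolvent_eq_zero
    (eq_zero_of_resolvent_eq_zero (eq_zero_of_resolvent_eq_zero h1)))

theorem resolvent_pow_shift (θ : ℝ) (n : ℕ) (w : PerC) :
    (resolvent ^ n) (shift θ w) = shift θ ((resolvent ^ n) w) := by
  induction n with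
  | zero => rfl
  | succ n ih =>
    rw [pow_succ']
    change resolvent ((resolvent ^ n) (shift θ w)) = shift θ (resolvent ((resolvent ^ n) w))
    rw [ih, resolvent_shift]

theorem jet_zero_shift (θ : ℝ) (w : PerC) : jet 0 (shift θ w) = shift θ (jet 0 w) := by
  simpa [jet] using resolvent_pow_shift θ 4 w

/-- A function of class `C⁴` is recovered from `(1 + ∂)⁴` applied to it. -/
theorem exists_jet_eq {p₀ p₁ p₂ p₃ p₄ : PerC} (h₀ : IsDeriv p₀ p₁) (h₁ : IsDeriv p₁ p₂)
    (h₂ : IsDeriv p₂ p₃) (h₃ : IsDeriv p₃ p₄) :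
    jet 0 (p₀ + (4 : ℝ) • p₁ + (6 : ℝ) • p₂ + (4 : ℝ) • p₃ + p₄) = p₀ := by
  have e1 : resolvent (p₀ + (4 : ℝ) • p₁ + (6 : ℝ) • p₂ + (4 : ℝ) • p₃ + p₄)
      = p₀ + (3 : ℝ) • p₁ + (3 : ℝ) • p₂ + p₃ := by
    rw [← resolvent_add_deriv (((h₀.add (h₁.smul 3)).add (h₂.smul 3)).add h₃)]
    congr 1
    module
  have e2 : resolvent (p₀ + (3 : ℝ) • p₁ + (3 : ℝ) • p₂ + p₃) = p₀ + (2 : ℝ) • p₁ + p₂ := by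
    rw [← resolvent_add_deriv ((h₀.add (h₁.smul 2)).add h₂)]
    congr 1
    module
  have e3 : resolvent (p₀ + (2 : ℝ) • p₁ + p₂) = p₀ + p₁ := by
    rw [← resolvent_add_deriv (h₀.add h₁)]
    congr 1
    module
  have e4 := resolvent_add_deriv h₀
  change resolvent (resolvent (resolvent (resolvent _))) = p₀
  rw [e1, e2, e3, e4]

end PerC
end ShallowWater
end

noncomputable section
namespace ShallowWater
namespace PerC

/-! ### First Fourier coefficients -/

/-- Half the first cosine coefficient. -/
def coefC : PerC →L[ℝ] ℝ := avg ∘L ContinuousLinearMap.mul ℝ PerC cosC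

/-- Half the first sine coefficient. -/
def coefS : PerC →L[ℝ] ℝ := avg ∘L ContinuousLinearMap.mul ℝ PerC sinC

theorem coefC_apply (f : PerC) : coefC f = avg (cosC * f) := rfl
theorem coefS_apply (f : PerC) : coefS f = avg (sinC * f) := rfl

@[simp] theorem coefC_cosC : coefC cosC = 1 / 2 := avg_cos_mul_cos
@[simp] theorem coefC_sinC : coefC sinC = 0 := avg_cos_mul_sin
@[simp] theorem coefS_cosC : coefS cosC = 0 := avg_sin_mul_cos
@[simp] theorem coefS_sinC : coefS sinC = 1 / 2 := avg_sin_mul_sin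

theorem IsDeriv.coefC {f f' : PerC} (h : IsDeriv f f') : coefC f' = coefS f := by
  have := h.avg_mul isDeriv_cosC
  rw [coefC_apply, coefS_apply, mul_comm cosC, this, mul_neg, map_neg, neg_neg,
    mul_comm f]

theorem IsDeriv.coefS {f f' : PerC} (h : IsDeriv f f') : PerC.coefS f' = -PerC.coefC f := by
  have := h.avg_mul isDeriv_sinC
  rw [coefC_apply, coefS_apply, mul_comm sinC, this, mul_comm f]

/-- The coefficients transform under translation as those of `cos (x + θ)`, `sin (x + θ)`. -/
theorem coefC_shift (θ : ℝ) (f : PerC) :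
    coefC (shift θ f) = Real.cos θ * coefC f + Real.sin θ * coefS f := by
  have h : cosC * shift θ f = shift θ ((Real.cos θ • cosC + Real.sin θ • sinC) * f) := by
    refine ext_coe fun x => ?_
    simp only [ContinuousMap.mul_apply, shift_coe, cosC_coe, ContinuousMap.add_apply,
      ContinuousMap.smul_apply, sinC_coe, smul_eq_mul, Real.cos_add, Real.sin_add]
    linear_combination (-Real.cos x * f ((x + θ : ℝ) : AddCircle _)) * Real.sin_sq_add_cos_sq θ
  rw [coefC_apply, h, avg_shift, add_mul, map_add, smul_mul_assoc, smul_mul_assoc, map_smul,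
    map_smul]
  rfl

theorem coefS_shift (θ : ℝ) (f : PerC) :
    coefS (shift θ f) = Real.cos θ * coefS f - Real.sin θ * coefC f := by
  have h : sinC * shift θ f = shift θ ((Real.cos θ • sinC - Real.sin θ • cosC) * f) := by
    refine ext_coe fun x => ?_
    simp only [ContinuousMap.mul_apply, shift_coe, cosC_coe, ContinuousMap.sub_apply,
      ContinuousMap.smul_apply, sinC_coe, smul_eq_mul, Real.cos_add, Real.sin_add]
    linear_combination (-Real.sin x * f ((x + θ : ℝ) : AddCircle _)) * Real.sin_sq_add_cos_sq θ
  rw [coefS_apply, h, avg_shift, sub_mul, map_sub, smul_mul_assoc, smul_mul_assoc, map_smul,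
    map_smul]
  rfl

theorem coefC_jet (w : PerC) :
    coefC (jet 1 w) = coefS (jet 0 w) ∧ coefC (jet 2 w) = -coefC (jet 0 w) ∧
      coefC (jet 4 w) = coefC (jet 0 w) := by
  have h0 := isDeriv_jet (j := 0) (by norm_num) w
  have h1 := isDeriv_jet (j := 1) (by norm_num) w
  have h2 := isDeriv_jet (j := 2) (by norm_num) w
  have h3 := isDeriv_jet (j := 3) (by norm_num) w
  refine ⟨h0.coefC, ?_, ?_⟩
  · rw [h1.coefC, h0.coefS]
  · rw [h3.coefC, h2.coefS, h1.coefC, h0.coefS, neg_neg]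

theorem coefS_jet (w : PerC) :
    coefS (jet 1 w) = -coefC (jet 0 w) ∧ coefS (jet 2 w) = -coefS (jet 0 w) ∧
      coefS (jet 4 w) = coefS (jet 0 w) := by
  have h0 := isDeriv_jet (j := 0) (by norm_num) w
  have h1 := isDeriv_jet (j := 1) (by norm_num) w
  have h2 := isDeriv_jet (j := 2) (by norm_num) w
  have h3 := isDeriv_jet (j := 3) (by norm_num) w
  refine ⟨h0.coefS, ?_, ?_⟩
  · rw [h1.coefS, h0.coefC]
  · rw [h3.coefS, h2.coefC, h1.coefS, h0.coefC, neg_neg]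

theorem eq_avg_of_isDeriv_zero {f : PerC} (h : IsDeriv f 0) (x : ℝ) :
    f (x : AddCircle _) = avg f := by
  have hc := fun y : ℝ => is_const_of_deriv_eq_zero (fun z => (h z).differentiableAt)
    (fun z => (h z).deriv) y x
  rw [avg_eq_of_coe (f := f) (g := fun _ => f (x : AddCircle _)) hc]
  simp only [intervalIntegral.integral_const, smul_eq_mul]
  have := Real.pi_pos
  field_simp
  ring

/-- Periodic solutions of `f'' + f = 0`. -/
theorem eq_of_harmonic {f f₁ : PerC} (h : IsDeriv f f₁) (h₁ : IsDeriv f₁ (-f)) :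
    f = (2 * coefC f) • cosC + (2 * coefS f) • sinC := by
  have ha : IsDeriv (f * cosC - f₁ * sinC) 0 := by
    have := (h.mul isDeriv_cosC).sub (h₁.mul isDeriv_sinC)
    convert this using 1
    ring
  have hb : IsDeriv (f * sinC + f₁ * cosC) 0 := by
    have := (h.mul isDeriv_sinC).add (h₁.mul isDeriv_cosC)
    convert this using 1
    ring
  have hA : avg (f * cosC - f₁ * sinC) = 2 * coefC f := by
    rw [map_sub, mul_comm f, mul_comm f₁, ← coefC_apply, ← coefS_apply, h.coefS]; ring
  have hB : avg (f * sinC + f₁ * cosC) = 2 * coefS f := by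
    rw [map_add, mul_comm f, mul_comm f₁, ← coefC_apply, ← coefS_apply, h.coefC]; ring
  refine ext_coe fun x => ?_
  have h1 := eq_avg_of_isDeriv_zero ha x
  have h2 := eq_avg_of_isDeriv_zero hb x
  rw [hA] at h1
  rw [hB] at h2
  simp only [ContinuousMap.sub_apply, ContinuousMap.add_apply, ContinuousMap.mul_apply, cosC_coe,
    sinC_coe, ContinuousMap.smul_apply, smul_eq_mul] at h1 h2 ⊢
  linear_combination (-f (x : AddCircle _)) * Real.sin_sq_add_cos_sq x + Real.cos x * h1
    + Real.sin x * h2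

theorem jet_smul_cosC_sinC :
    (jet 0 ((-4 : ℝ) • cosC) = cosC ∧ jet 1 ((-4 : ℝ) • cosC) = -sinC ∧
      jet 2 ((-4 : ℝ) • cosC) = -cosC ∧ jet 3 ((-4 : ℝ) • cosC) = sinC ∧
      jet 4 ((-4 : ℝ) • cosC) = cosC) ∧
    (jet 0 ((-4 : ℝ) • sinC) = sinC ∧ jet 1 ((-4 : ℝ) • sinC) = cosC ∧
      jet 2 ((-4 : ℝ) • sinC) = -sinC ∧ jet 3 ((-4 : ℝ) • sinC) = -cosC ∧
      jet 4 ((-4 : ℝ) • sinC) = sinC) := by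
  have hns : IsDeriv (-sinC) (-cosC) := by simpa using isDeriv_sinC.smul (-1)
  have hnc : IsDeriv (-cosC) sinC := by simpa using isDeriv_cosC.smul (-1)
  have c0 : jet 0 ((-4 : ℝ) • cosC) = cosC :=
    (congrArg (jet 0) (by module)).trans (exists_jet_eq isDeriv_cosC hns hnc isDeriv_sinC)
  have s0 : jet 0 ((-4 : ℝ) • sinC) = sinC :=
    (congrArg (jet 0) (by module)).trans (exists_jet_eq isDeriv_sinC isDeriv_cosC hns hnc)
  have step : ∀ {j : ℕ} {w f f' : PerC}, j < 4 → jet j w = f → IsDeriv f f' →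
      jet (j + 1) w = f' := by
    intro j w f f' hj hf hd
    have := isDeriv_jet hj w
    rw [hf] at this
    exact this.unique hd
  have c1 := step (by norm_num) c0 isDeriv_cosC
  have c2 := step (by norm_num) c1 hns
  have c3 := step (by norm_num) c2 hnc
  have c4 := step (by norm_num) c3 isDeriv_sinC
  have s1 := step (by norm_num) s0 isDeriv_sinC
  have s2 := step (by norm_num) s1 isDeriv_cosC
  have s3 := step (by norm_num) s2 hns
  have s4 := step (by norm_num) s3 hnc
  exact ⟨⟨c0, c1, c2, c3, c4⟩, s0, s1, s2, s3, s4⟩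

theorem isCompactOperator_jet {j : ℕ} (hj : j < 4) : IsCompactOperator (jet j) := by
  obtain ⟨k, hk⟩ : ∃ k, 4 - j = k + 1 := ⟨3 - j, by omega⟩
  have hc : Commute ((1 - resolvent) ^ j) resolvent :=
    ((Commute.one_left _).sub_left (Commute.refl _)).pow_left j
  have h1 : jet j = resolvent ∘L ((1 - resolvent) ^ j * resolvent ^ k) := by
    rw [jet, hk, pow_succ', ← mul_assoc, hc.eq, mul_assoc]
    rfl
  rw [h1]
  exact isCompactOperator_resolvent.comp_clm _

theorem isCompactOperator_jet_four_sub : IsCompactOperator (jet 4 - 1 : PerC →L[ℝ] PerC) := by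
  have h1 : jet 4 - 1 = resolvent ∘L
      ((-4 : ℝ) • (1 : PerC →L[ℝ] PerC) + (6 : ℝ) • resolvent - (4 : ℝ) • resolvent ^ 2
        + resolvent ^ 3) := by
    ext1 w
    simp only [jet, pow_succ, pow_zero, one_mul, mul_one, Nat.sub_self,
      _root_.sub_apply, mul_apply_eq_comp, one_apply_eq_self,
      ContinuousLinearMap.comp_apply, _root_.add_apply,
      _root_.smul_apply, map_add, map_sub, map_smul]
    module
  rw [h1]
  exact isCompactOperator_resolvent.comp_clm _

end PerC
end ShallowWater
end

noncomputable section
namespace ShallowWater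
open PerC

/-! ### The linearisation at criticality -/

/-- The positivity assumptions on the fixed parameters. -/
structure IsoData.Pos (D : IsoData) : Prop where
  g : 0 < D.g
  H₀ : 0 < D.H₀
  b : 0 < D.b
  d : 0 < D.d
  Q : 0 < D.Q

/-- Pairs of periodic functions. For the unknown `w : PerC2` of the reduced problem, the velocity
components parallel and orthogonal to the wave vector are `jet 0 w.1` and `jet 0 w.2`. -/
abbrev PerC2 : Type := PerC × PerC

namespace IsoData

variable {D : IsoData}

theorem Pos.kc_pos (hD : D.Pos) : 0 < D.kc := Real.sqrt_pos.mpr (div_pos hD.b (by linarith [hD.d]))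

theorem Pos.kc_sq (hD : D.Pos) : D.b = 2 * D.d * D.kc ^ 2 := by
  have hd := hD.d
  have hb := hD.b
  rw [kc, Real.sq_sqrt (by positivity)]
  field_simp

theorem Pos.ωc_sq (hD : D.Pos) : D.ωc ^ 2 = D.g * D.H₀ * D.kc ^ 2 + D.f ^ 2 := by
  have hg := hD.g
  have hH := hD.H₀
  rw [ωc, Real.sq_sqrt (by positivity)]

theorem Pos.ωc_pos (hD : D.Pos) : 0 < D.ωc := by
  have hg := hD.g
  have hH := hD.H₀
  have hk := hD.kc_pos
  exact Real.sqrt_pos.mpr (by positivity)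

theorem Pos.Cc_eq (hD : D.Pos) : D.Cc = D.d * D.kc ^ 4 * D.H₀ := by
  have hd := hD.d
  have h := hD.kc_sq
  rw [Cc, h]
  field_simp
  ring

variable (D)

/-- The critical eigenfunction (velocity components parallel and orthogonal to the wave vector). -/
def eig : PerC2 := ((2 * D.kc * D.ωc) • cosC, (2 * D.kc * D.f) • sinC)

/-- The derivative of the critical eigenfunction. -/
def eigDeriv : PerC2 := (-(2 * D.kc * D.ωc) • sinC, (2 * D.kc * D.f) • cosC)

/-- Coordinate along the critical eigenfunction of the projection to the kernel. -/
def coord₁ : PerC2 →L[ℝ] ℝ :=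
  (D.ωc / (D.kc * (D.ωc ^ 2 + D.f ^ 2))) • (coefC ∘L jet 0 ∘L ContinuousLinearMap.fst ℝ PerC PerC)
  + (D.f / (D.kc * (D.ωc ^ 2 + D.f ^ 2))) • (coefS ∘L jet 0 ∘L ContinuousLinearMap.snd ℝ PerC PerC)

/-- Coordinate along the derivative of the critical eigenfunction of the projection to the
kernel. -/
def coord₂ : PerC2 →L[ℝ] ℝ :=
  (-(D.ωc / (D.kc * (D.ωc ^ 2 + D.f ^ 2)))) •
    (coefS ∘L jet 0 ∘L ContinuousLinearMap.fst ℝ PerC PerC)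
  + (D.f / (D.kc * (D.ωc ^ 2 + D.f ^ 2))) • (coefC ∘L jet 0 ∘L ContinuousLinearMap.snd ℝ PerC PerC)

theorem coord₁_apply (w : PerC2) : D.coord₁ w =
    (D.ωc * coefC (jet 0 w.1) + D.f * coefS (jet 0 w.2)) / (D.kc * (D.ωc ^ 2 + D.f ^ 2)) := by
  simp only [coord₁, _root_.add_apply, _root_.smul_apply, ContinuousLinearMap.comp_apply,
    ContinuousLinearMap.coe_fst', ContinuousLinearMap.coe_snd', smul_eq_mul]
  ring

theorem coord₂_apply (w : PerC2) : D.coord₂ w =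
    (-D.ωc * coefS (jet 0 w.1) + D.f * coefC (jet 0 w.2)) / (D.kc * (D.ωc ^ 2 + D.f ^ 2)) := by
  simp only [coord₂, _root_.add_apply, _root_.smul_apply, ContinuousLinearMap.comp_apply,
    ContinuousLinearMap.coe_fst', ContinuousLinearMap.coe_snd', smul_eq_mul]
  ring

/-- The element of the kernel with coordinates `(x, y)`; the factor `-4` is `(1 + i)⁴`, the symbol
of `(1 + ∂)⁴` at the first Fourier mode. -/
def kerElt (x y : ℝ) : PerC2 := (-4 : ℝ) • (x • D.eig + y • D.eigDeriv)

/-- The linearisation at criticality, as an operator on `w = (1 + ∂)⁴ (p, q)`. -/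
def lin : PerC2 →L[ℝ] PerC2 :=
  ((D.d * D.kc ^ 4) • ((jet 4 + (2 : ℝ) • jet 2 + jet 0) ∘L ContinuousLinearMap.fst ℝ PerC PerC)
    - (D.f ^ 2 / D.ωc) • (jet 1 ∘L ContinuousLinearMap.fst ℝ PerC PerC)
    - D.f • (jet 0 ∘L ContinuousLinearMap.snd ℝ PerC PerC)).prod
  ((D.d * D.kc ^ 4) • ((jet 4 + (2 : ℝ) • jet 2 + jet 0) ∘L ContinuousLinearMap.snd ℝ PerC PerC)
    - D.ωc • (jet 1 ∘L ContinuousLinearMap.snd ℝ PerC PerC)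
    + D.f • (jet 0 ∘L ContinuousLinearMap.fst ℝ PerC PerC))

theorem lin_fst (w : PerC2) : (D.lin w).1 = (D.d * D.kc ^ 4) • (jet 4 w.1 + (2 : ℝ) • jet 2 w.1
    + jet 0 w.1) - (D.f ^ 2 / D.ωc) • jet 1 w.1 - D.f • jet 0 w.2 := rfl

theorem lin_snd (w : PerC2) : (D.lin w).2 = (D.d * D.kc ^ 4) • (jet 4 w.2 + (2 : ℝ) • jet 2 w.2
    + jet 0 w.2) - D.ωc • jet 1 w.2 + D.f • jet 0 w.1 := rfl

/-- The derivative of the equations in the speed parameter `s`, at the critical eigenfunction. -/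
def speedDir : PerC2 :=
  (-(2 * D.kc * D.ωc * (2 - D.f ^ 2 / D.ωc ^ 2)) • sinC, (2 * D.kc * D.f) • cosC)

/-- The linearisation at criticality, bordered by the derivatives in the parameters `α` and `s`:
these two unknowns replace the two coordinates along the kernel. -/
def bordered : PerC2 →L[ℝ] PerC2 :=
  D.lin - D.coord₁.smulRight D.eig + D.coord₂.smulRight D.speedDir

theorem bordered_apply (w : PerC2) : D.bordered w = D.lin w - D.coord₁ w • D.eig
    + D.coord₂ w • D.speedDir := rfl

variable {D}

theorem jet_kerElt (x y : ℝ) :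
    jet 0 (D.kerElt x y).1 = (2 * D.kc * D.ωc) • (x • cosC - y • sinC) ∧
    jet 1 (D.kerElt x y).1 = (2 * D.kc * D.ωc) • (-x • sinC - y • cosC) ∧
    jet 2 (D.kerElt x y).1 = (2 * D.kc * D.ωc) • (-x • cosC + y • sinC) ∧
    jet 3 (D.kerElt x y).1 = (2 * D.kc * D.ωc) • (x • sinC + y • cosC) ∧
    jet 4 (D.kerElt x y).1 = (2 * D.kc * D.ωc) • (x • cosC - y • sinC) ∧
    jet 0 (D.kerElt x y).2 = (2 * D.kc * D.f) • (x • sinC + y • cosC) ∧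
    jet 1 (D.kerElt x y).2 = (2 * D.kc * D.f) • (x • cosC - y • sinC) ∧
    jet 2 (D.kerElt x y).2 = (2 * D.kc * D.f) • (-x • sinC - y • cosC) ∧
    jet 3 (D.kerElt x y).2 = (2 * D.kc * D.f) • (-x • cosC + y • sinC) ∧
    jet 4 (D.kerElt x y).2 = (2 * D.kc * D.f) • (x • sinC + y • cosC) := by
  obtain ⟨⟨c0, c1, c2, c3, c4⟩, s0, s1, s2, s3, s4⟩ := jet_smul_cosC_sinC
  have h1 : (D.kerElt x y).1 = (2 * D.kc * D.ωc * x) • ((-4 : ℝ) • cosC)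
      - (2 * D.kc * D.ωc * y) • ((-4 : ℝ) • sinC) := by
    simp only [kerElt, eig, eigDeriv, Prod.smul_fst, Prod.fst_add]
    module
  have h2 : (D.kerElt x y).2 = (2 * D.kc * D.f * x) • ((-4 : ℝ) • sinC)
      + (2 * D.kc * D.f * y) • ((-4 : ℝ) • cosC) := by
    simp only [kerElt, eig, eigDeriv, Prod.smul_snd, Prod.snd_add]
    module
  rw [h1, h2]
  simp only [map_add, map_sub, ContinuousLinearMap.map_smul_of_tower (jet _) (_ : ℝ) ((-4 : ℝ) • cosC),
    ContinuousLinearMap.map_smul_of_tower (jet _) (_ : ℝ) ((-4 : ℝ) • sinC),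
    c0, c1, c2, c3, c4, s0, s1, s2, s3, s4]
  refine ⟨?_, ?_, ?_, ?_, ?_, ?_, ?_, ?_, ?_, ?_⟩ <;> module

theorem coord_kerElt (hD : D.Pos) (x y : ℝ) :
    D.coord₁ (D.kerElt x y) = x ∧ D.coord₂ (D.kerElt x y) = y := by
  obtain ⟨p0, -, -, -, -, q0, -⟩ := jet_kerElt (D := D) x y
  have hω := hD.ωc_pos
  have hk := hD.kc_pos
  rw [coord₁_apply, coord₂_apply, p0, q0]
  simp only [map_smul, map_add, map_sub, coefC_cosC, coefC_sinC, coefS_cosC, coefS_sinC,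
    smul_eq_mul]
  constructor
  · field_simp
    ring
  · field_simp
    ring

theorem lin_kerElt (hD : D.Pos) (x y : ℝ) : D.lin (D.kerElt x y) = 0 := by
  obtain ⟨p0, p1, p2, -, p4, q0, q1, q2, -, q4⟩ := jet_kerElt (D := D) x y
  have hω := hD.ωc_pos
  refine Prod.ext ?_ ?_
  · rw [lin_fst, p0, p1, p2, p4, q0]
    refine ext_coe fun z => ?_
    simp
    field_simp
    ring
  · rw [lin_snd, p0, q1, q2, q4, q0]
    refine ext_coe fun z => ?_
    simp
    ring

/-- Testing against the first Fourier modes shows that an element of the kernel of the bordered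
operator has no component there, and that the two coordinates along the kernel vanish. -/
theorem coef_eq_zero_of_bordered_eq_zero (hD : D.Pos) {w : PerC2} (hw : D.bordered w = 0) :
    (D.coord₁ w = 0 ∧ D.coord₂ w = 0) ∧ (coefC (jet 0 w.1) = 0 ∧ coefS (jet 0 w.1) = 0) ∧
      coefC (jet 0 w.2) = 0 ∧ coefS (jet 0 w.2) = 0 := by
  have hω := hD.ωc_pos
  have hk := hD.kc_pos
  have e1 : (D.d * D.kc ^ 4) • (jet 4 w.1 + (2 : ℝ) • jet 2 w.1 + jet 0 w.1)
      - (D.f ^ 2 / D.ωc) • jet 1 w.1 - D.f • jet 0 w.2 - D.coord₁ w • ((2 * D.kc * D.ωc) • cosC)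
      + D.coord₂ w • (-(2 * D.kc * D.ωc * (2 - D.f ^ 2 / D.ωc ^ 2)) • sinC) = 0 :=
    congrArg Prod.fst hw
  have e2 : (D.d * D.kc ^ 4) • (jet 4 w.2 + (2 : ℝ) • jet 2 w.2 + jet 0 w.2)
      - D.ωc • jet 1 w.2 + D.f • jet 0 w.1 - D.coord₁ w • ((2 * D.kc * D.f) • sinC)
      + D.coord₂ w • ((2 * D.kc * D.f) • cosC) = 0 :=
    congrArg Prod.snd hw
  obtain ⟨pc1, pc2, pc4⟩ := coefC_jet w.1
  obtain ⟨ps1, ps2, ps4⟩ := coefS_jet w.1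
  obtain ⟨qc1, qc2, qc4⟩ := coefC_jet w.2
  obtain ⟨qs1, qs2, qs4⟩ := coefS_jet w.2
  have h1c := congrArg coefC e1
  have h1s := congrArg coefS e1
  have h2c := congrArg coefC e2
  have h2s := congrArg coefS e2
  simp only [map_add, map_sub, map_smul, map_zero, pc1, pc2, pc4, ps1, ps2, ps4, qc1, qc2, qc4,
    qs1, qs2, qs4, smul_eq_mul, coefC_cosC, coefC_sinC, coefS_cosC, coefS_sinC]
    at h1c h1s h2c h2s
  have hl1 := D.coord₁_apply w
  have hl2 := D.coord₂_apply w
  clear e1 e2 pc1 pc2 pc4 ps1 ps2 ps4 qc1 qc2 qc4 qs1 qs2 qs4 hw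
  generalize D.coord₁ w = l₁ at *
  generalize D.coord₂ w = l₂ at *
  generalize coefC (jet 0 w.1) = Pc at *
  generalize coefS (jet 0 w.1) = Ps at *
  generalize coefC (jet 0 w.2) = Qc at *
  generalize coefS (jet 0 w.2) = Qs at *
  -- the combinations of modes that are orthogonal to the range of the linearisation
  have hl1z : l₁ = 0 := by
    have : D.kc * (D.ωc ^ 2 + D.f ^ 2) * l₁ = 0 := by
      have h1c' := congrArg (D.ωc * ·) h1c
      simp only [mul_zero] at h1c'
      field_simp at h1c'
      linear_combination (-1 : ℝ) * h1c' - D.f * h2s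
    have h0 : D.kc * (D.ωc ^ 2 + D.f ^ 2) ≠ 0 := by positivity
    exact (mul_eq_zero.mp this).resolve_left h0
  have hl2z : l₂ = 0 := by
    have : 2 * D.kc * D.ωc ^ 2 * l₂ = 0 := by
      have h1s' := congrArg (D.ωc * ·) h1s
      simp only [mul_zero] at h1s'
      field_simp at h1s'
      linear_combination (-1 : ℝ) * h1s' + D.f * h2c
    have h0 : 2 * D.kc * D.ωc ^ 2 ≠ 0 := by positivity
    exact (mul_eq_zero.mp this).resolve_left h0
  subst hl1z hl2z
  have hN : D.kc * (D.ωc ^ 2 + D.f ^ 2) ≠ 0 := by positivity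
  have hl1' : D.ωc * Pc + D.f * Qs = 0 := (div_eq_zero_iff.mp hl1.symm).resolve_right hN
  have hl2' : -D.ωc * Ps + D.f * Qc = 0 := (div_eq_zero_iff.mp hl2.symm).resolve_right hN
  have hS : D.ωc ^ 2 + D.f ^ 2 ≠ 0 := by positivity
  -- vanishing coordinates and the orthogonal equations determine the remaining coefficients
  have hPc : Pc = 0 := by
    have : (D.ωc ^ 2 + D.f ^ 2) * Pc = 0 := by linear_combination D.ωc * hl1' + D.f * h2c
    exact (mul_eq_zero.mp this).resolve_left hS
  have hPs : Ps = 0 := by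
    have : (D.ωc ^ 2 + D.f ^ 2) * Ps = 0 := by linear_combination -D.ωc * hl2' + D.f * h2s
    exact (mul_eq_zero.mp this).resolve_left hS
  have hQs : Qs = 0 := by
    have : D.ωc * Qs = 0 := by linear_combination -h2c + D.f * hPc
    exact (mul_eq_zero.mp this).resolve_left hω.ne'
  have hQc : Qc = 0 := by
    have : D.ωc * Qc = 0 := by linear_combination h2s - D.f * hPs
    exact (mul_eq_zero.mp this).resolve_left hω.ne'
  exact ⟨⟨rfl, rfl⟩, ⟨hPc, hPs⟩, hQc, hQs⟩

/-- Integration by parts: at criticality, the dissipation is the square of `∂² + 1`. -/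
theorem avg_jet_mul_self (v : PerC) :
    avg ((jet 4 v + (2 : ℝ) • jet 2 v + jet 0 v) * jet 0 v)
      = avg ((jet 2 v + jet 0 v) * (jet 2 v + jet 0 v)) := by
  have i1 := (isDeriv_jet (j := 3) (by norm_num) v).avg_mul (isDeriv_jet (j := 0) (by norm_num) v)
  have i2 := (isDeriv_jet (j := 2) (by norm_num) v).avg_mul (isDeriv_jet (j := 1) (by norm_num) v)
  have i3 : avg (jet 4 v * jet 0 v) = avg (jet 2 v * jet 2 v) := by
    rw [i1, i2, neg_neg]
  have h1 : (jet 4 v + (2 : ℝ) • jet 2 v + jet 0 v) * jet 0 v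
      = jet 4 v * jet 0 v + (2 : ℝ) • (jet 2 v * jet 0 v) + jet 0 v * jet 0 v := by
    rw [add_mul, add_mul, smul_mul_assoc]
  have h2 : (jet 2 v + jet 0 v) * (jet 2 v + jet 0 v)
      = jet 2 v * jet 2 v + (2 : ℝ) • (jet 2 v * jet 0 v) + jet 0 v * jet 0 v := by
    rw [two_smul]; ring
  rw [h1, h2, map_add, map_add, map_add, map_add, i3]

/-- The energy identity: the Coriolis force and the gravity waves do not contribute. -/
theorem avg_lin_mul_self (w : PerC2) :
    avg ((D.lin w).1 * jet 0 w.1 + (D.lin w).2 * jet 0 w.2)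
      = D.d * D.kc ^ 4 * (avg ((jet 2 w.1 + jet 0 w.1) * (jet 2 w.1 + jet 0 w.1))
        + avg ((jet 2 w.2 + jet 0 w.2) * (jet 2 w.2 + jet 0 w.2))) := by
  have hexp : (D.lin w).1 * jet 0 w.1 + (D.lin w).2 * jet 0 w.2
      = (D.d * D.kc ^ 4) • ((jet 4 w.1 + (2 : ℝ) • jet 2 w.1 + jet 0 w.1) * jet 0 w.1)
        + (D.d * D.kc ^ 4) • ((jet 4 w.2 + (2 : ℝ) • jet 2 w.2 + jet 0 w.2) * jet 0 w.2)
        - (D.f ^ 2 / D.ωc) • (jet 1 w.1 * jet 0 w.1) - D.ωc • (jet 1 w.2 * jet 0 w.2) := by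
    rw [lin_fst, lin_snd]
    refine ext_coe fun z => ?_
    simp only [ContinuousMap.add_apply, ContinuousMap.sub_apply, ContinuousMap.mul_apply,
      ContinuousMap.smul_apply, smul_eq_mul]
    ring
  rw [hexp, map_sub, map_sub, map_add, map_smul, map_smul, map_smul, map_smul,
    (isDeriv_jet (j := 0) (by norm_num) w.1).avg_mul_self,
    (isDeriv_jet (j := 0) (by norm_num) w.2).avg_mul_self, avg_jet_mul_self, avg_jet_mul_self,
    smul_eq_mul, smul_eq_mul, smul_zero, smul_zero]
  ring

/-- The energy identity forces the velocities into the first Fourier modes, where they vanish. -/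
theorem bordered_injective (hD : D.Pos) : Function.Injective D.bordered := by
  rw [injective_iff_map_eq_zero]
  intro w hw
  have hk := hD.kc_pos
  have hd := hD.d
  obtain ⟨⟨hl1, hl2⟩, ⟨hPc, hPs⟩, hQc, hQs⟩ := coef_eq_zero_of_bordered_eq_zero hD hw
  have hlin : D.lin w = 0 := by
    rw [bordered_apply, hl1, hl2, zero_smul, zero_smul, sub_zero, add_zero] at hw
    exact hw
  have hsum := avg_lin_mul_self (D := D) w
  rw [hlin, Prod.fst_zero, Prod.snd_zero, zero_mul, zero_mul, add_zero, map_zero] at hsum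
  have hdk : D.d * D.kc ^ 4 ≠ 0 := by positivity
  have hsum' := (mul_eq_zero.mp hsum.symm).resolve_left hdk
  have n1 : 0 ≤ avg ((jet 2 w.1 + jet 0 w.1) * (jet 2 w.1 + jet 0 w.1)) :=
    avg_nonneg fun x => mul_self_nonneg _
  have n2 : 0 ≤ avg ((jet 2 w.2 + jet 0 w.2) * (jet 2 w.2 + jet 0 w.2)) :=
    avg_nonneg fun x => mul_self_nonneg _
  have hs1 : jet 2 w.1 + jet 0 w.1 = 0 := eq_zero_of_avg_mul_self (by linarith)
  have hs2 : jet 2 w.2 + jet 0 w.2 = 0 := eq_zero_of_avg_mul_self (by linarith)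
  have hz : ∀ v : PerC, jet 2 v + jet 0 v = 0 → coefC (jet 0 v) = 0 → coefS (jet 0 v) = 0 →
      v = 0 := by
    intro v hv hc hs
    have h2 := isDeriv_jet (j := 1) (by norm_num) v
    rw [eq_neg_of_add_eq_zero_left hv] at h2
    have := eq_of_harmonic (isDeriv_jet (j := 0) (by norm_num) v) h2
    rw [hc, hs, mul_zero, zero_smul, zero_smul, add_zero] at this
    exact eq_zero_of_jet_zero_eq_zero this
  exact Prod.ext (hz _ hs1 hPc hPs) (hz _ hs2 hQc hQs)

/-- The bordered operator is a multiple of the identity up to a compact operator. -/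
theorem isCompactOperator_bordered_sub :
    IsCompactOperator (D.bordered - (D.d * D.kc ^ 4) • (1 : PerC2 →L[ℝ] PerC2)) := by
  have h0 := isCompactOperator_jet (j := 0) (by norm_num)
  have h1 := isCompactOperator_jet (j := 1) (by norm_num)
  have h2 := isCompactOperator_jet (j := 2) (by norm_num)
  have h4 := isCompactOperator_jet_four_sub
  have hA := (((h4.add (h2.smul (2 : ℝ))).add h0).smul (D.d * D.kc ^ 4))
  have hA1 := ((hA.comp_clm (ContinuousLinearMap.fst ℝ PerC PerC)).sub
    ((h1.comp_clm (ContinuousLinearMap.fst ℝ PerC PerC)).smul (D.f ^ 2 / D.ωc))).sub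
    ((h0.comp_clm (ContinuousLinearMap.snd ℝ PerC PerC)).smul D.f)
  have hA2 := ((hA.comp_clm (ContinuousLinearMap.snd ℝ PerC PerC)).sub
    ((h1.comp_clm (ContinuousLinearMap.snd ℝ PerC PerC)).smul D.ωc)).add
    ((h0.comp_clm (ContinuousLinearMap.fst ℝ PerC PerC)).smul D.f)
  have c1 : IsCompactOperator D.coord₁ :=
    (((h0.comp_clm (ContinuousLinearMap.fst ℝ PerC PerC)).clm_comp coefC).smul
      (D.ωc / (D.kc * (D.ωc ^ 2 + D.f ^ 2)))).add
    (((h0.comp_clm (ContinuousLinearMap.snd ℝ PerC PerC)).clm_comp coefS).smul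
      (D.f / (D.kc * (D.ωc ^ 2 + D.f ^ 2))))
  have c2 : IsCompactOperator D.coord₂ :=
    (((h0.comp_clm (ContinuousLinearMap.fst ℝ PerC PerC)).clm_comp coefS).smul
      (-(D.ωc / (D.kc * (D.ωc ^ 2 + D.f ^ 2))))).add
    (((h0.comp_clm (ContinuousLinearMap.snd ℝ PerC PerC)).clm_comp coefC).smul
      (D.f / (D.kc * (D.ωc ^ 2 + D.f ^ 2))))
  have hsum := (((hA1.clm_comp (ContinuousLinearMap.inl ℝ PerC PerC)).add
    (hA2.clm_comp (ContinuousLinearMap.inr ℝ PerC PerC))).sub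
    (c1.clm_comp ((ContinuousLinearMap.id ℝ ℝ).smulRight D.eig))).add
    (c2.clm_comp ((ContinuousLinearMap.id ℝ ℝ).smulRight D.speedDir))
  convert hsum using 1
  · rfl
  funext w
  have hw : (D.bordered - (D.d * D.kc ^ 4) • (1 : PerC2 →L[ℝ] PerC2)) w
      = D.lin w - (D.d * D.kc ^ 4) • w - D.coord₁ w • D.eig + D.coord₂ w • D.speedDir := by
    change D.lin w - D.coord₁ w • D.eig + D.coord₂ w • D.speedDir - (D.d * D.kc ^ 4) • w = _
    abel
  rw [hw]
  simp only [Pi.add_apply, Pi.sub_apply, Function.comp_apply]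
  congr 2
  refine Prod.ext ?_ ?_
  · rw [Prod.fst_sub, lin_fst]
    simp
    module
  · rw [Prod.snd_sub, lin_snd]
    simp
    module

/-- The Fredholm alternative for the bordered operator. -/
theorem bordered_isInvertible (hD : D.Pos) : D.bordered.IsInvertible := by
  have hdk : 0 < D.d * D.kc ^ 4 := by have := hD.d; have := hD.kc_pos; positivity
  set T := D.bordered - (D.d * D.kc ^ 4) • (1 : PerC2 →L[ℝ] PerC2) with hT
  have hunit : IsUnit D.bordered := by
    rcases (isCompactOperator_bordered_sub (D := D)).hasEigenvalue_or_mem_resolventSet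
      (μ := -(D.d * D.kc ^ 4)) (neg_ne_zero.mpr hdk.ne') with h | h
    · exfalso
      obtain ⟨v, hv⟩ := h.exists_hasEigenvector
      have h1 := hv.apply_eq_smul
      have h2 : D.bordered v = 0 := by
        have h3 : D.bordered v - (D.d * D.kc ^ 4) • v = (-(D.d * D.kc ^ 4)) • v := h1
        rw [neg_smul, sub_eq_neg_self] at h3
        exact h3
      exact hv.2 (bordered_injective hD (by rw [h2, map_zero]))
    · rw [spectrum.mem_resolventSet_iff, ← IsUnit.neg_iff] at h
      convert h using 1
      rw [Algebra.algebraMap_eq_smul_one]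
      module
  obtain ⟨e, he⟩ := ContinuousLinearMap.isUnit_iff_bijective.mp hunit |> fun hb =>
    (⟨ContinuousLinearEquiv.ofBijective D.bordered
      (LinearMap.ker_eq_bot.mpr hb.1) (LinearMap.range_eq_top.mpr hb.2), rfl⟩ :
      ∃ e : PerC2 ≃L[ℝ] PerC2, (e : PerC2 → PerC2) = D.bordered)
  exact ⟨e, ContinuousLinearMap.ext fun x => congrFun he x⟩

end IsoData
end ShallowWater
end

noncomputable section
namespace ShallowWater

/-! ### Quadratic approximation by a linear map -/

section QuadApprox

variable {X Y : Type*} [NormedAddCommGroup X] [NormedSpace ℝ X] [NormedAddCommGroup Y]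
  [NormedSpace ℝ Y]

/-- On balls of small radius `r` around `z₀`, the map `f - L` is Lipschitz with a constant
proportional to `r`. This is strict differentiability with a rate; it holds for maps of class `C²`
and also for products `t * G` with `t` small and `G` merely Lipschitz. -/
def QuadApprox (f : X → Y) (L : X →L[ℝ] Y) (z₀ : X) : Prop :=
  ∃ C > 0, ∃ ρ > 0, ∀ r ≤ ρ, ∀ z z' : X, ‖z - z₀‖ ≤ r → ‖z' - z₀‖ ≤ r →
    ‖f z - f z' - L (z - z')‖ ≤ C * r * ‖z - z'‖

namespace QuadApprox

variable {f g : X → Y} {L L' : X →L[ℝ] Y} {z₀ : X}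

theorem add (hf : QuadApprox f L z₀) (hg : QuadApprox g L' z₀) :
    QuadApprox (fun z => f z + g z) (L + L') z₀ := by
  obtain ⟨C, hC, ρ, hρ, h⟩ := hf
  obtain ⟨C', hC', ρ', hρ', h'⟩ := hg
  refine ⟨C + C', by positivity, min ρ ρ', lt_min hρ hρ', fun r hr z z' hz hz' => ?_⟩
  have h1 := h r (hr.trans (min_le_left _ _)) z z' hz hz'
  have h2 := h' r (hr.trans (min_le_right _ _)) z z' hz hz'
  have e : f z + g z - (f z' + g z') - (L + L') (z - z')
      = (f z - f z' - L (z - z')) + (g z - g z' - L' (z - z')) := by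
    rw [_root_.add_apply]; abel
  rw [e]
  exact (norm_add_le _ _).trans ((add_le_add h1 h2).trans (le_of_eq (by ring)))

theorem of_contDiffAt (hf : ContDiffAt ℝ 2 f z₀) : QuadApprox f (fderiv ℝ f z₀) z₀ := by
  have h1 : ContDiffAt ℝ 1 (fderiv ℝ f) z₀ := hf.fderiv_right (by norm_num)
  obtain ⟨K, t, ht, hK⟩ := h1.exists_lipschitzOnWith
  have hd : ∀ᶠ z in nhds z₀, DifferentiableAt ℝ f z := by
    have := hf.eventually (by simp)
    exact this.mono fun z hz => hz.differentiableAt (by simp)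
  obtain ⟨ρ, hρ, hball⟩ := Metric.mem_nhds_iff.mp (Filter.inter_mem ht hd)
  refine ⟨K + 1, by positivity, ρ / 2, by positivity, fun r hr z z' hz hz' => ?_⟩
  have hr0 : 0 ≤ r := (norm_nonneg _).trans hz
  have hsub : Metric.closedBall z₀ r ⊆ t ∩ {z | DifferentiableAt ℝ f z} :=
    (Metric.closedBall_subset_ball (by linarith)).trans hball
  have hmem : z₀ ∈ t := (hsub (Metric.mem_closedBall_self hr0)).1
  refine Convex.norm_image_sub_le_of_norm_hasFDerivWithin_le' (s := Metric.closedBall z₀ r)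
    (f' := fderiv ℝ f) (C := (K + 1) * r)
    (fun x hx => ((hsub hx).2.hasFDerivAt).hasFDerivWithinAt) (fun x hx => ?_)
    (convex_closedBall _ _) (by simpa [dist_eq_norm] using hz') (by simpa [dist_eq_norm] using hz)
  have := hK.dist_le_mul x (hsub hx).1 z₀ hmem
  rw [dist_eq_norm] at this
  refine this.trans ?_
  have hx' : dist x z₀ ≤ r := hx
  have : (K : ℝ) * dist x z₀ ≤ K * r := by gcongr
  linarith

/-- A factor that vanishes at `z₀` makes a map that is merely Lipschitz strictly differentiable. -/
theorem smul_of_lipschitz {τ : X →L[ℝ] ℝ} (hτ : τ z₀ = 0) {K : NNReal} {s : Set X}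
    (hs : s ∈ nhds z₀) (hf : LipschitzOnWith K f s) :
    QuadApprox (fun z => τ z • f z) (τ.smulRight (f z₀)) z₀ := by
  obtain ⟨ρ, hρ, hball⟩ := Metric.mem_nhds_iff.mp hs
  refine ⟨2 * ‖τ‖ * K + 1, by positivity, ρ / 2, by positivity, fun r hr z z' hz hz' => ?_⟩
  have hr0 : 0 ≤ r := (norm_nonneg _).trans hz
  have hsub : Metric.closedBall z₀ r ⊆ s :=
    (Metric.closedBall_subset_ball (by linarith)).trans hball
  have hzs : z ∈ s := hsub (by simpa [dist_eq_norm] using hz)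
  have hzs' : z' ∈ s := hsub (by simpa [dist_eq_norm] using hz')
  have h0s : z₀ ∈ s := hsub (Metric.mem_closedBall_self hr0)
  have e : τ z • f z - τ z' • f z' - (τ.smulRight (f z₀)) (z - z')
      = τ z • (f z - f z') + τ (z - z') • (f z' - f z₀) := by
    rw [ContinuousLinearMap.smulRight_apply, map_sub]
    module
  have h1 : ‖f z - f z'‖ ≤ K * ‖z - z'‖ := by
    simpa [dist_eq_norm] using hf.dist_le_mul z hzs z' hzs'
  have h2 : ‖f z' - f z₀‖ ≤ K * r := by
    have := hf.dist_le_mul z' hzs' z₀ h0s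
    rw [dist_eq_norm, dist_eq_norm] at this
    exact this.trans (by gcongr)
  have h3 : ‖τ z‖ ≤ ‖τ‖ * r := by
    have := τ.le_opNorm (z - z₀)
    rw [map_sub, hτ, sub_zero] at this
    exact this.trans (by gcongr)
  have h4 := τ.le_opNorm (z - z')
  rw [e]
  calc ‖τ z • (f z - f z') + τ (z - z') • (f z' - f z₀)‖
      ≤ ‖τ z‖ * ‖f z - f z'‖ + ‖τ (z - z')‖ * ‖f z' - f z₀‖ := by
        refine (norm_add_le _ _).trans ?_
        rw [norm_smul, norm_smul]
    _ ≤ (‖τ‖ * r) * (K * ‖z - z'‖) + (‖τ‖ * ‖z - z'‖) * (K * r) := by gcongr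
    _ = (2 * ‖τ‖ * K) * r * ‖z - z'‖ := by ring
    _ ≤ _ := by gcongr; linarith

/-- Composition with an affine map. -/
theorem comp_affine {X' : Type*} [NormedAddCommGroup X'] [NormedSpace ℝ X']
    (hf : QuadApprox f L z₀) (T : X' →L[ℝ] X) :
    QuadApprox (fun y => f (z₀ + T y)) (L ∘L T) 0 := by
  obtain ⟨C, hC, ρ, hρ, h⟩ := hf
  set M := ‖T‖ + 1 with hM
  have hM0 : 0 < M := by positivity
  have hTle : ∀ y, ‖T y‖ ≤ M * ‖y‖ := fun y =>
    (T.le_opNorm y).trans (mul_le_mul_of_nonneg_right (by linarith) (norm_nonneg _))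
  refine ⟨C * M * M, by positivity, ρ / M, by positivity, fun r hr z z' hz hz' => ?_⟩
  rw [sub_zero] at hz hz'
  have hr' : M * r ≤ ρ := by rw [mul_comm]; exact (le_div_iff₀ hM0).mp hr
  have hr0 : 0 ≤ r := (norm_nonneg _).trans hz
  have h1 := h (M * r) hr' (z₀ + T z) (z₀ + T z')
    (by rw [add_sub_cancel_left]; exact (hTle z).trans (by gcongr))
    (by rw [add_sub_cancel_left]; exact (hTle z').trans (by gcongr))
  rw [add_sub_add_left_eq_sub, ← map_sub] at h1
  refine h1.trans ?_
  calc C * (M * r) * ‖T (z - z')‖ ≤ C * (M * r) * (M * ‖z - z'‖) := by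
        gcongr; exact hTle _
    _ = _ := by ring

theorem hasStrictFDerivAt (hf : QuadApprox f L z₀) : HasStrictFDerivAt f L z₀ := by
  obtain ⟨C, hC, ρ, hρ, h⟩ := hf
  rw [hasStrictFDerivAt_iff_isLittleO, Asymptotics.isLittleO_iff]
  intro c hc
  set r := min ρ (c / C) with hr
  have hr0 : 0 < r := lt_min hρ (by positivity)
  have hmem : Metric.ball z₀ r ×ˢ Metric.ball z₀ r ∈ nhds (z₀, z₀) :=
    prod_mem_nhds (Metric.ball_mem_nhds _ hr0) (Metric.ball_mem_nhds _ hr0)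
  filter_upwards [hmem] with p hp
  have h1 := h r (min_le_left _ _) p.1 p.2 (mem_ball_iff_norm.mp hp.1).le
    (mem_ball_iff_norm.mp hp.2).le
  refine h1.trans ?_
  have : C * r ≤ c := by
    have := min_le_right ρ (c / C)
    rw [← hr, le_div_iff₀ hC] at this
    linarith
  gcongr

end QuadApprox

/-- Zeros of a map close to its linearisation depend on the first variable in a Lipschitz way, when
the linearisation is bounded below in the second variable. -/
theorem lipschitz_of_quadApprox {X₁ X₂ : Type*} [NormedAddCommGroup X₁] [NormedSpace ℝ X₁]
    [NormedAddCommGroup X₂] [NormedSpace ℝ X₂] {f : X₁ × X₂ → Y} {L : X₁ × X₂ →L[ℝ] Y}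
    (hf : QuadApprox f L 0) {B : ℝ} (hB : 0 < B) (hL : ∀ y : X₂, ‖y‖ ≤ B * ‖L (0, y)‖) :
    ∃ ρ > 0, ∃ K > 0, ∀ z z' : X₁ × X₂, ‖z‖ ≤ ρ → ‖z'‖ ≤ ρ → f z = 0 → f z' = 0 →
      ‖z.2 - z'.2‖ ≤ K * ‖z.1 - z'.1‖ := by
  obtain ⟨C, hC, ρ, hρ, h⟩ := hf
  refine ⟨min ρ (1 / (2 * B * C)), lt_min hρ (by positivity), 2 * B * (‖L‖ + 1 / (2 * B)),
    by positivity, fun z z' hz hz' hfz hfz' => ?_⟩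
  have h1 := h _ (min_le_left _ _) z z' (by rw [sub_zero]; exact hz)
    (by rw [sub_zero]; exact hz')
  rw [hfz, hfz', sub_zero, zero_sub, norm_neg] at h1
  have hsplit : L (z - z') = L (z.1 - z'.1, 0) + L (0, z.2 - z'.2) := by
    rw [← map_add]; congr 1; ext <;> simp
  have h2 : ‖L (z.1 - z'.1, 0)‖ ≤ ‖L‖ * ‖z.1 - z'.1‖ := by
    refine (L.le_opNorm _).trans (le_of_eq ?_)
    simp [Prod.norm_def]
  have h3 : ‖z - z'‖ ≤ ‖z.1 - z'.1‖ + ‖z.2 - z'.2‖ := by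
    rw [Prod.norm_def]
    exact max_le_add_of_nonneg (norm_nonneg _) (norm_nonneg _)
  -- the radius is so small that the error of the linear approximation is absorbed by its lower bound
  have hCr : C * min ρ (1 / (2 * B * C)) ≤ 1 / (2 * B) := by
    have := mul_le_mul_of_nonneg_left (min_le_right ρ (1 / (2 * B * C))) hC.le
    refine this.trans (le_of_eq ?_)
    field_simp
  have h4 : ‖L (0, z.2 - z'.2)‖ ≤ ‖L‖ * ‖z.1 - z'.1‖
      + 1 / (2 * B) * (‖z.1 - z'.1‖ + ‖z.2 - z'.2‖) := by
    have e : L (0, z.2 - z'.2) = L (z - z') - L (z.1 - z'.1, 0) := by rw [hsplit]; abel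
    rw [e]
    have := (norm_sub_le (L (z - z')) (L (z.1 - z'.1, 0)))
    have h5 : C * min ρ (1 / (2 * B * C)) * ‖z - z'‖
        ≤ 1 / (2 * B) * (‖z.1 - z'.1‖ + ‖z.2 - z'.2‖) := by gcongr
    linarith
  have h5 := hL (z.2 - z'.2)
  have h6 := mul_le_mul_of_nonneg_left h4 hB.le
  have h7 : B * (‖L‖ * ‖z.1 - z'.1‖ + 1 / (2 * B) * (‖z.1 - z'.1‖ + ‖z.2 - z'.2‖))
      = B * (‖L‖ + 1 / (2 * B)) * ‖z.1 - z'.1‖ + 1 / 2 * ‖z.2 - z'.2‖ := by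
    field_simp; ring
  linarith

end QuadApprox

end ShallowWater
end

noncomputable section
namespace ShallowWater
open PerC

/-! ### The reduced equations -/

/-- The speed of the velocity field with components `p` and `q`. -/
def PerC.speed (p q : PerC) : PerC := ⟨fun x => √(p x ^ 2 + q x ^ 2), by fun_prop⟩

@[simp] theorem PerC.speed_apply (p q : PerC) (x : AddCircle (2 * Real.pi)) :
    speed p q x = √(p x ^ 2 + q x ^ 2) := rfl

theorem PerC.abs_sqrt_sub_le (a b c d : ℝ) :
    |√(a ^ 2 + b ^ 2) - √(c ^ 2 + d ^ 2)| ≤ |a - c| + |b - d| := by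
  have key : ∀ a b c d : ℝ, √(a ^ 2 + b ^ 2) ≤ √(c ^ 2 + d ^ 2) + (|a - c| + |b - d|) := by
    intro a b c d
    apply Real.sqrt_le_iff.mpr
    have h0 := Real.sqrt_nonneg (c ^ 2 + d ^ 2)
    have h1 := Real.sq_sqrt (show 0 ≤ c ^ 2 + d ^ 2 by positivity)
    have hc : |c| ≤ √(c ^ 2 + d ^ 2) := Real.abs_le_sqrt (by nlinarith)
    have hd : |d| ≤ √(c ^ 2 + d ^ 2) := Real.abs_le_sqrt (by nlinarith)
    refine ⟨by positivity, ?_⟩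
    have hac : c * (a - c) ≤ √(c ^ 2 + d ^ 2) * |a - c| := by
      refine (le_abs_self _).trans ?_
      rw [abs_mul]
      gcongr
    have hbd : d * (b - d) ≤ √(c ^ 2 + d ^ 2) * |b - d| := by
      refine (le_abs_self _).trans ?_
      rw [abs_mul]
      gcongr
    nlinarith [sq_abs (a - c), sq_abs (b - d), mul_nonneg (abs_nonneg (a - c)) (abs_nonneg (b - d))]
  rw [abs_le]
  have k1 := key a b c d
  have k2 := key c d a b
  rw [abs_sub_comm c a, abs_sub_comm d b] at k2
  constructor <;> linarith

theorem PerC.norm_speed_sub_le (p q p' q' : PerC) :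
    ‖speed p q - speed p' q'‖ ≤ ‖p - p'‖ + ‖q - q'‖ := by
  rw [ContinuousMap.norm_le _ (by positivity)]
  intro x
  refine (abs_sqrt_sub_le _ _ _ _).trans (add_le_add ?_ ?_)
  · exact ContinuousMap.norm_coe_le_norm (p - p') x
  · exact ContinuousMap.norm_coe_le_norm (q - q') x

namespace IsoData

variable (D : IsoData)

/-- The reciprocal of the phase speed of the wave. -/
def slowness (s : ℝ) : ℝ := D.kc / (D.ωc - s)

/-- By conservation of mass the layer thickness is inversely proportional to this function, for a
wave with velocity `t p` parallel to the wave vector. -/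
def thin (t s : ℝ) (p : PerC) : PerC := 1 - (t * D.slowness s) • p

/-- The reciprocal of `thin`. (The ring inverse is the pointwise one where `thin` has no zero.) -/
def thick (t s : ℝ) (p : PerC) : PerC := Ring.inverse (D.thin t s p)

/-- The mean of `thick`: the normalised layer thickness is `thick / thickAvg`. -/
def thickAvg (t s : ℝ) (p : PerC) : ℝ := avg (D.thick t s p)

/-- The smooth terms of the momentum equation parallel to the wave vector, for the velocity
`t (p, q)`, divided by `t`; `pⱼ` stands for the `j`-th derivative of `p`. The surface deviation is
eliminated by means of the conservation of mass. -/
def smooth₁ (t κ α s : ℝ) (p₀ p₁ p₂ p₄ q₀ : PerC) : PerC :=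
  (-((1 + κ) * (D.ωc - s))) • (D.thin t s p₀ * p₁) - D.f • q₀
    + (D.g * D.kc * (1 + κ) * D.H₀ * D.slowness s / D.thickAvg t s p₀) •
      (p₁ * (D.thick t s p₀ * D.thick t s p₀))
    + (D.d * (D.kc * (1 + κ)) ^ 4) • p₄ + (D.b * (D.kc * (1 + κ)) ^ 2) • p₂
    + ((D.d * D.kc ^ 4 - α) * D.thickAvg t s p₀) • (p₀ * D.thin t s p₀)

/-- The smooth terms of the momentum equation orthogonal to the wave vector. -/
def smooth₂ (t κ α s : ℝ) (p₀ q₀ q₁ q₂ q₄ : PerC) : PerC :=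
  (-((1 + κ) * (D.ωc - s))) • (D.thin t s p₀ * q₁) + D.f • p₀
    + (D.d * (D.kc * (1 + κ)) ^ 4) • q₄ + (D.b * (D.kc * (1 + κ)) ^ 2) • q₂
    + ((D.d * D.kc ^ 4 - α) * D.thickAvg t s p₀) • (q₀ * D.thin t s p₀)

/-- The quadratic drag in the direction of the velocity component `u`, divided by `t`. -/
def drag (t s : ℝ) (p₀ q₀ u : PerC) : PerC :=
  (D.Q / D.H₀ * D.thickAvg t s p₀) • (speed p₀ q₀ * (u * D.thin t s p₀))

/-- The residual of the momentum equations for the velocity `t (p, q)`, `(p, q) = (1 + ∂)⁻⁴ w`,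
divided by `t`. -/
def residual (t κ α s : ℝ) (w : PerC2) : PerC2 :=
  (D.smooth₁ t κ α s (jet 0 w.1) (jet 1 w.1) (jet 2 w.1) (jet 4 w.1) (jet 0 w.2)
      + t • D.drag t s (jet 0 w.1) (jet 0 w.2) (jet 0 w.1),
    D.smooth₂ t κ α s (jet 0 w.1) (jet 0 w.2) (jet 1 w.2) (jet 2 w.2) (jet 4 w.2)
      + t • D.drag t s (jet 0 w.1) (jet 0 w.2) (jet 0 w.2))

variable {D}

section Smoothness

variable {X : Type*} [NormedAddCommGroup X] [NormedSpace ℝ X] {x₀ : X} {n : WithTop ℕ∞}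
  {t κ α s : X → ℝ} {p₀ p₁ p₂ p₄ q₀ q₁ q₂ q₄ u : X → PerC}

theorem contDiffAt_slowness (hD : D.Pos) (hs : ContDiffAt ℝ n s x₀) (hs0 : s x₀ = 0) :
    ContDiffAt ℝ n (fun x => D.slowness (s x)) x₀ := by
  unfold slowness
  refine contDiffAt_const.div (contDiffAt_const.sub hs) ?_
  rw [hs0, sub_zero]
  exact hD.ωc_pos.ne'

theorem contDiffAt_thin (hD : D.Pos) (ht : ContDiffAt ℝ n t x₀) (hs : ContDiffAt ℝ n s x₀)
    (hs0 : s x₀ = 0) (hp₀ : ContDiffAt ℝ n p₀ x₀) :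
    ContDiffAt ℝ n (fun x => D.thin (t x) (s x) (p₀ x)) x₀ :=
  contDiffAt_const.sub ((ht.mul (contDiffAt_slowness hD hs hs0)).smul hp₀)

theorem thin_eq_one {t s : ℝ} {p : PerC} (h1 : t • p = 0) : D.thin t s p = 1 := by
  have : (t * D.slowness s) • p = D.slowness s • (t • p) := by
    rw [mul_comm t (D.slowness s), mul_smul]
  rw [thin, this, h1, smul_zero, sub_zero]

theorem contDiffAt_thick (hD : D.Pos) (ht : ContDiffAt ℝ n t x₀) (hs : ContDiffAt ℝ n s x₀)
    (hs0 : s x₀ = 0) (hp₀ : ContDiffAt ℝ n p₀ x₀) (h1 : t x₀ • p₀ x₀ = 0) :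
    ContDiffAt ℝ n (fun x => D.thick (t x) (s x) (p₀ x)) x₀ := by
  have hthin := contDiffAt_thin hD ht hs hs0 hp₀
  have hval : D.thin (t x₀) (s x₀) (p₀ x₀) = ((1 : PerCˣ) : PerC) := thin_eq_one h1
  have hinv : ContDiffAt ℝ n (Ring.inverse : PerC → PerC) (D.thin (t x₀) (s x₀) (p₀ x₀)) := by
    rw [hval]
    exact contDiffAt_ringInverse ℝ 1
  exact hinv.comp x₀ hthin

theorem thick_eq_one {t s : ℝ} {p : PerC} (h1 : t • p = 0) : D.thick t s p = 1 := by
  rw [thick, thin_eq_one h1, Ring.inverse_one]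

theorem thickAvg_eq_one {t s : ℝ} {p : PerC} (h1 : t • p = 0) : D.thickAvg t s p = 1 := by
  rw [thickAvg, thick_eq_one h1, avg_one]

theorem contDiffAt_thickAvg (hD : D.Pos) (ht : ContDiffAt ℝ n t x₀) (hs : ContDiffAt ℝ n s x₀)
    (hs0 : s x₀ = 0) (hp₀ : ContDiffAt ℝ n p₀ x₀) (h1 : t x₀ • p₀ x₀ = 0) :
    ContDiffAt ℝ n (fun x => D.thickAvg (t x) (s x) (p₀ x)) x₀ :=
  avg.contDiff.contDiffAt.comp x₀ (contDiffAt_thick hD ht hs hs0 hp₀ h1)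

theorem contDiffAt_smooth₁ (hD : D.Pos) (ht : ContDiffAt ℝ n t x₀) (hκ : ContDiffAt ℝ n κ x₀)
    (hα : ContDiffAt ℝ n α x₀) (hs : ContDiffAt ℝ n s x₀) (hs0 : s x₀ = 0)
    (hp₀ : ContDiffAt ℝ n p₀ x₀) (hp₁ : ContDiffAt ℝ n p₁ x₀) (hp₂ : ContDiffAt ℝ n p₂ x₀)
    (hp₄ : ContDiffAt ℝ n p₄ x₀) (hq₀ : ContDiffAt ℝ n q₀ x₀) (h1 : t x₀ • p₀ x₀ = 0) :
    ContDiffAt ℝ n (fun x => D.smooth₁ (t x) (κ x) (α x) (s x) (p₀ x) (p₁ x) (p₂ x) (p₄ x) (q₀ x))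
      x₀ := by
  have hthin := contDiffAt_thin hD ht hs hs0 hp₀
  have hthick := contDiffAt_thick hD ht hs hs0 hp₀ h1
  have havg := contDiffAt_thickAvg hD ht hs hs0 hp₀ h1
  have hslow := contDiffAt_slowness hD hs hs0
  have hκ1 : ContDiffAt ℝ n (fun x => 1 + κ x) x₀ := contDiffAt_const.add hκ
  have hne : D.thickAvg (t x₀) (s x₀) (p₀ x₀) ≠ 0 := by
    rw [thickAvg_eq_one h1]; exact one_ne_zero
  have a1 : ContDiffAt ℝ n (fun x => (-((1 + κ x) * (D.ωc - s x))) •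
      (D.thin (t x) (s x) (p₀ x) * p₁ x)) x₀ :=
    (hκ1.mul (contDiffAt_const.sub hs)).neg.smul (hthin.mul hp₁)
  have a2 : ContDiffAt ℝ n (fun x => D.f • q₀ x) x₀ := hq₀.const_smul D.f
  have c3 : ContDiffAt ℝ n (fun x => D.g * D.kc * (1 + κ x) * D.H₀ * D.slowness (s x)) x₀ :=
    ((contDiffAt_const.mul hκ1).mul contDiffAt_const).mul hslow
  have d3 : ContDiffAt ℝ n (fun x => D.g * D.kc * (1 + κ x) * D.H₀ * D.slowness (s x)
      / D.thickAvg (t x) (s x) (p₀ x)) x₀ := c3.div havg hne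
  have a3 : ContDiffAt ℝ n (fun x => (D.g * D.kc * (1 + κ x) * D.H₀ * D.slowness (s x)
      / D.thickAvg (t x) (s x) (p₀ x)) •
        (p₁ x * (D.thick (t x) (s x) (p₀ x) * D.thick (t x) (s x) (p₀ x)))) x₀ :=
    d3.smul (hp₁.mul (hthick.mul hthick))
  have c4 : ContDiffAt ℝ n (fun x => D.d * (D.kc * (1 + κ x)) ^ 4) x₀ :=
    contDiffAt_const.mul ((contDiffAt_const.mul hκ1).pow 4)
  have c5 : ContDiffAt ℝ n (fun x => D.b * (D.kc * (1 + κ x)) ^ 2) x₀ :=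
    contDiffAt_const.mul ((contDiffAt_const.mul hκ1).pow 2)
  have a6 : ContDiffAt ℝ n (fun x => ((D.d * D.kc ^ 4 - α x) * D.thickAvg (t x) (s x) (p₀ x)) •
      (p₀ x * D.thin (t x) (s x) (p₀ x))) x₀ :=
    ((contDiffAt_const.sub hα).mul havg).smul (hp₀.mul hthin)
  exact ((((a1.sub a2).add a3).add (c4.smul hp₄)).add (c5.smul hp₂)).add a6

theorem contDiffAt_smooth₂ (hD : D.Pos) (ht : ContDiffAt ℝ n t x₀) (hκ : ContDiffAt ℝ n κ x₀)
    (hα : ContDiffAt ℝ n α x₀) (hs : ContDiffAt ℝ n s x₀) (hs0 : s x₀ = 0)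
    (hp₀ : ContDiffAt ℝ n p₀ x₀) (hq₀ : ContDiffAt ℝ n q₀ x₀) (hq₁ : ContDiffAt ℝ n q₁ x₀)
    (hq₂ : ContDiffAt ℝ n q₂ x₀) (hq₄ : ContDiffAt ℝ n q₄ x₀) (h1 : t x₀ • p₀ x₀ = 0) :
    ContDiffAt ℝ n (fun x => D.smooth₂ (t x) (κ x) (α x) (s x) (p₀ x) (q₀ x) (q₁ x) (q₂ x) (q₄ x))
      x₀ := by
  have hthin := contDiffAt_thin hD ht hs hs0 hp₀
  have havg := contDiffAt_thickAvg hD ht hs hs0 hp₀ h1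
  have hκ1 : ContDiffAt ℝ n (fun x => 1 + κ x) x₀ := contDiffAt_const.add hκ
  have a1 : ContDiffAt ℝ n (fun x => (-((1 + κ x) * (D.ωc - s x))) •
      (D.thin (t x) (s x) (p₀ x) * q₁ x)) x₀ :=
    (hκ1.mul (contDiffAt_const.sub hs)).neg.smul (hthin.mul hq₁)
  have a2 : ContDiffAt ℝ n (fun x => D.f • p₀ x) x₀ := hp₀.const_smul D.f
  have c4 : ContDiffAt ℝ n (fun x => D.d * (D.kc * (1 + κ x)) ^ 4) x₀ :=
    contDiffAt_const.mul ((contDiffAt_const.mul hκ1).pow 4)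
  have c5 : ContDiffAt ℝ n (fun x => D.b * (D.kc * (1 + κ x)) ^ 2) x₀ :=
    contDiffAt_const.mul ((contDiffAt_const.mul hκ1).pow 2)
  have a6 : ContDiffAt ℝ n (fun x => ((D.d * D.kc ^ 4 - α x) * D.thickAvg (t x) (s x) (p₀ x)) •
      (q₀ x * D.thin (t x) (s x) (p₀ x))) x₀ :=
    ((contDiffAt_const.sub hα).mul havg).smul (hq₀.mul hthin)
  exact (((a1.add a2).add (c4.smul hq₄)).add (c5.smul hq₂)).add a6

end Smoothness

/-- Parameters `(t, κ, α, s)` together with the unknown `w`. -/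
abbrev Full : Type := ℝ × ℝ × ℝ × ℝ × PerC2

/-- A point of `Full` with vanishing parameters. -/
def fullPt (w : PerC2) : Full := (0, 0, 0, 0, w)

variable (D)

/-- The smooth part of the residual. -/
def smoothPart (z : Full) : PerC2 :=
  (D.smooth₁ z.1 z.2.1 z.2.2.1 z.2.2.2.1 (jet 0 z.2.2.2.2.1) (jet 1 z.2.2.2.2.1)
      (jet 2 z.2.2.2.2.1) (jet 4 z.2.2.2.2.1) (jet 0 z.2.2.2.2.2),
    D.smooth₂ z.1 z.2.1 z.2.2.1 z.2.2.2.1 (jet 0 z.2.2.2.2.1) (jet 0 z.2.2.2.2.2)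
      (jet 1 z.2.2.2.2.2) (jet 2 z.2.2.2.2.2) (jet 4 z.2.2.2.2.2))

/-- The quadratic drag, divided by `t`. -/
def dragPart (z : Full) : PerC2 :=
  (D.drag z.1 z.2.2.2.1 (jet 0 z.2.2.2.2.1) (jet 0 z.2.2.2.2.2) (jet 0 z.2.2.2.2.1),
    D.drag z.1 z.2.2.2.1 (jet 0 z.2.2.2.2.1) (jet 0 z.2.2.2.2.2) (jet 0 z.2.2.2.2.2))

theorem residual_eq (z : Full) : D.residual z.1 z.2.1 z.2.2.1 z.2.2.2.1 z.2.2.2.2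
    = D.smoothPart z + z.1 • D.dragPart z := rfl

variable {D}

theorem contDiffAt_smoothPart (hD : D.Pos) (w : PerC2) :
    ContDiffAt ℝ 2 D.smoothPart (fullPt w) := by
  have hj : ∀ j : ℕ, ContDiffAt ℝ 2 (fun z : Full => jet j z.2.2.2.2.1) (fullPt w) := fun j => by
    fun_prop
  have hj' : ∀ j : ℕ, ContDiffAt ℝ 2 (fun z : Full => jet j z.2.2.2.2.2) (fullPt w) := fun j => by
    fun_prop
  have h1 : (fullPt w).1 • jet 0 (fullPt w).2.2.2.2.1 = 0 := zero_smul _ _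
  have ht : ContDiffAt ℝ 2 (fun z : Full => z.1) (fullPt w) := by fun_prop
  have hκ : ContDiffAt ℝ 2 (fun z : Full => z.2.1) (fullPt w) := by fun_prop
  have hα : ContDiffAt ℝ 2 (fun z : Full => z.2.2.1) (fullPt w) := by fun_prop
  have hs : ContDiffAt ℝ 2 (fun z : Full => z.2.2.2.1) (fullPt w) := by fun_prop
  exact (contDiffAt_smooth₁ hD ht hκ hα hs rfl (hj 0) (hj 1) (hj 2) (hj 4) (hj' 0) h1).prodMk
    (contDiffAt_smooth₂ hD ht hκ hα hs rfl (hj 0) (hj' 0) (hj' 1) (hj' 2) (hj' 4) h1)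

theorem _root_.LipschitzOnWith.mul_bounded {X : Type*} [PseudoMetricSpace X] {f g : X → PerC}
    {K K' : NNReal} {s s' : Set X} {x₀ : X} (hs : s ∈ nhds x₀) (hs' : s' ∈ nhds x₀)
    (hf : LipschitzOnWith K f s) (hg : LipschitzOnWith K' g s') :
    ∃ K'' : NNReal, ∃ s'' ∈ nhds x₀, LipschitzOnWith K'' (fun x => f x * g x) s'' := by
  have hcf : ∀ᶠ x in nhds x₀, ‖f x‖ < ‖f x₀‖ + 1 :=
    (hf.continuousOn.continuousAt hs).norm.eventually_lt_const (by linarith)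
  have hcg : ∀ᶠ x in nhds x₀, ‖g x‖ < ‖g x₀‖ + 1 :=
    (hg.continuousOn.continuousAt hs').norm.eventually_lt_const (by linarith)
  refine ⟨Real.toNNReal ((‖f x₀‖ + 1) * K' + (‖g x₀‖ + 1) * K), _,
    Filter.inter_mem (Filter.inter_mem hs hs') (Filter.inter_mem hcf hcg),
    LipschitzOnWith.of_dist_le_mul fun x hx y hy => ?_⟩
  have e : f x * g x - f y * g y = f x * (g x - g y) + (f x - f y) * g y := by ring
  have h1 := hf.dist_le_mul x hx.1.1 y hy.1.1
  have h2 := hg.dist_le_mul x hx.1.2 y hy.1.2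
  have h3 : ‖f x‖ < ‖f x₀‖ + 1 := hx.2.1
  have h4 : ‖g y‖ < ‖g x₀‖ + 1 := hy.2.2
  rw [dist_eq_norm] at h1 h2 ⊢
  rw [e]
  calc ‖f x * (g x - g y) + (f x - f y) * g y‖
      ≤ ‖f x‖ * ‖g x - g y‖ + ‖f x - f y‖ * ‖g y‖ :=
        (norm_add_le _ _).trans (add_le_add (norm_mul_le _ _) (norm_mul_le _ _))
    _ ≤ (‖f x₀‖ + 1) * (K' * dist x y) + (K * dist x y) * (‖g x₀‖ + 1) := by gcongr
    _ = _ := by rw [Real.coe_toNNReal _ (by positivity)]; ring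

/-- The drag is Lipschitz since the modulus of the velocity is; it is not differentiable where the
velocity vanishes. -/
theorem lipschitz_dragPart (hD : D.Pos) (w : PerC2) :
    ∃ K : NNReal, ∃ s ∈ nhds (fullPt w), LipschitzOnWith K D.dragPart s := by
  have hj : ContDiffAt ℝ 1 (fun z : Full => jet 0 z.2.2.2.2.1) (fullPt w) := by fun_prop
  have hj' : ContDiffAt ℝ 1 (fun z : Full => jet 0 z.2.2.2.2.2) (fullPt w) := by fun_prop
  have h1 : (fullPt w).1 • jet 0 (fullPt w).2.2.2.2.1 = 0 := zero_smul _ _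
  have hthin := contDiffAt_thin (n := 1) (x₀ := fullPt w) (t := fun z : Full => z.1)
    (s := fun z : Full => z.2.2.2.1) hD (by fun_prop) (by fun_prop) rfl hj
  have havg := contDiffAt_thickAvg (n := 1) (x₀ := fullPt w) (t := fun z : Full => z.1)
    (s := fun z : Full => z.2.2.2.1) hD (by fun_prop) (by fun_prop) rfl hj h1
  have hspeed : ∃ K : NNReal, LipschitzWith K
      (fun z : Full => speed (jet 0 z.2.2.2.2.1) (jet 0 z.2.2.2.2.2)) := by
    refine ⟨2 * ‖jet 0‖₊, LipschitzWith.of_dist_le_mul fun z z' => ?_⟩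
    have hz : ‖z.2.2.2.2 - z'.2.2.2.2‖ ≤ dist z z' := by
      rw [← dist_eq_norm]
      exact (le_max_right _ _).trans ((le_max_right _ _).trans
        ((le_max_right _ _).trans (le_max_right _ _)))
    have hjet : ∀ v v' : PerC, ‖v - v'‖ ≤ dist z z' →
        ‖jet 0 v - jet 0 v'‖ ≤ ‖jet 0‖ * dist z z' := fun v v' hv => by
      rw [← map_sub]
      exact ((jet 0).le_opNorm _).trans (by gcongr)
    rw [dist_eq_norm]
    refine (norm_speed_sub_le _ _ _ _).trans ?_
    have h2 := hjet z.2.2.2.2.1 z'.2.2.2.2.1 ((norm_fst_le (z.2.2.2.2 - z'.2.2.2.2)).trans hz)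
    have h3 := hjet z.2.2.2.2.2 z'.2.2.2.2.2 ((norm_snd_le (z.2.2.2.2 - z'.2.2.2.2)).trans hz)
    push_cast
    linarith
  obtain ⟨K₀, hK₀⟩ := hspeed
  have hcomp : ∀ u : Full → PerC, ContDiffAt ℝ 1 u (fullPt w) →
      ∃ K : NNReal, ∃ s ∈ nhds (fullPt w), LipschitzOnWith K (fun z : Full =>
        D.drag z.1 z.2.2.2.1 (jet 0 z.2.2.2.2.1) (jet 0 z.2.2.2.2.2) (u z)) s := by
    intro u hu
    have hsm : ContDiffAt ℝ 1 (fun z : Full => (D.Q / D.H₀ * D.thickAvg z.1 z.2.2.2.1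
        (jet 0 z.2.2.2.2.1)) • (u z * D.thin z.1 z.2.2.2.1 (jet 0 z.2.2.2.2.1))) (fullPt w) :=
      (contDiffAt_const.mul havg).smul (hu.mul hthin)
    obtain ⟨K₁, s₁, hs₁, hK₁⟩ := hsm.exists_lipschitzOnWith
    obtain ⟨K₂, s₂, hs₂, hK₂⟩ := LipschitzOnWith.mul_bounded (x₀ := fullPt w) Filter.univ_mem hs₁
      (hK₀.lipschitzOnWith (s := univ)) hK₁
    refine ⟨K₂, s₂, hs₂, ?_⟩
    have e : (fun z : Full => D.drag z.1 z.2.2.2.1 (jet 0 z.2.2.2.2.1) (jet 0 z.2.2.2.2.2) (u z))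
        = fun z : Full => speed (jet 0 z.2.2.2.2.1) (jet 0 z.2.2.2.2.2) *
          ((D.Q / D.H₀ * D.thickAvg z.1 z.2.2.2.1 (jet 0 z.2.2.2.2.1)) •
            (u z * D.thin z.1 z.2.2.2.1 (jet 0 z.2.2.2.2.1))) :=
      funext fun z => (mul_smul_comm _ _ _).symm
    rw [e]
    exact hK₂
  obtain ⟨K₁, s₁, hs₁, hK₁⟩ := hcomp _ hj
  obtain ⟨K₂, s₂, hs₂, hK₂⟩ := hcomp _ hj'
  exact ⟨max K₁ K₂, s₁ ∩ s₂, Filter.inter_mem hs₁ hs₂,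
    (hK₁.mono inter_subset_left).prodMk (hK₂.mono inter_subset_right)⟩

end IsoData
end ShallowWater
end

noncomputable section
namespace ShallowWater
open PerC
namespace IsoData
variable {D : IsoData}

/-! ### The derivative of the residual -/

theorem smooth₁_zero_apply (κ α s : ℝ) (p₀ p₁ p₂ p₄ q₀ : PerC) (x : AddCircle (2 * Real.pi)) :
    D.smooth₁ 0 κ α s p₀ p₁ p₂ p₄ q₀ x = -((1 + κ) * (D.ωc - s)) * p₁ x - D.f * q₀ x
      + D.g * D.kc * (1 + κ) * D.H₀ * (D.kc / (D.ωc - s)) * p₁ x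
      + D.d * (D.kc * (1 + κ)) ^ 4 * p₄ x + D.b * (D.kc * (1 + κ)) ^ 2 * p₂ x
      + (D.d * D.kc ^ 4 - α) * p₀ x := by
  rw [smooth₁, thin_eq_one (zero_smul _ _), thick_eq_one (zero_smul _ _),
    thickAvg_eq_one (zero_smul _ _)]
  simp only [ContinuousMap.add_apply, ContinuousMap.sub_apply, ContinuousMap.smul_apply,
    ContinuousMap.mul_apply, ContinuousMap.one_apply, smul_eq_mul, slowness]
  ring

theorem smooth₂_zero_apply (κ α s : ℝ) (p₀ q₀ q₁ q₂ q₄ : PerC) (x : AddCircle (2 * Real.pi)) :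
    D.smooth₂ 0 κ α s p₀ q₀ q₁ q₂ q₄ x = -((1 + κ) * (D.ωc - s)) * q₁ x + D.f * p₀ x
      + D.d * (D.kc * (1 + κ)) ^ 4 * q₄ x + D.b * (D.kc * (1 + κ)) ^ 2 * q₂ x
      + (D.d * D.kc ^ 4 - α) * q₀ x := by
  rw [smooth₂, thin_eq_one (zero_smul _ _), thickAvg_eq_one (zero_smul _ _)]
  simp only [ContinuousMap.add_apply, ContinuousMap.smul_apply,
    ContinuousMap.mul_apply, ContinuousMap.one_apply, smul_eq_mul]
  ring

/-- The derivative of the smooth part in the parameters and the unknown, computed along lines and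
pointwise on the circle. At amplitude `t = 0` the smooth part is linear in the jets. -/
theorem fderiv_smoothPart_params (hD : D.Pos) (w₀ w : PerC2) (κ α s : ℝ) :
    fderiv ℝ D.smoothPart (fullPt w₀) (0, κ, α, s, w) = D.lin w
      + (κ • ((-(D.f ^ 2 / D.ωc)) • jet 1 w₀.1
            + (4 * D.d * D.kc ^ 4) • (jet 4 w₀.1 + jet 2 w₀.1))
          + (s * (2 - D.f ^ 2 / D.ωc ^ 2)) • jet 1 w₀.1 - α • jet 0 w₀.1,
        κ • ((-D.ωc) • jet 1 w₀.2 + (4 * D.d * D.kc ^ 4) • (jet 4 w₀.2 + jet 2 w₀.2))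
          + s • jet 1 w₀.2 - α • jet 0 w₀.2) := by
  have hω := hD.ωc_pos
  have hω2 := hD.ωc_sq
  have hb := hD.kc_sq
  have hdiff := ((contDiffAt_smoothPart hD w₀).differentiableAt (by norm_num)).hasFDerivAt
  have hline : HasDerivAt (fun ε : ℝ => fullPt w₀ + ε • ((0, κ, α, s, w) : Full))
      (0, κ, α, s, w) 0 := by
    simpa using ((hasDerivAt_id (0 : ℝ)).smul_const ((0, κ, α, s, w) : Full)).const_add (fullPt w₀)
  have hcurve : HasDerivAt (fun ε : ℝ => D.smoothPart (fullPt w₀ + ε • ((0, κ, α, s, w) : Full)))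
      (fderiv ℝ D.smoothPart (fullPt w₀) (0, κ, α, s, w)) 0 := by
    have hdiff' : HasFDerivAt D.smoothPart (fderiv ℝ D.smoothPart (fullPt w₀))
        (fullPt w₀ + (0 : ℝ) • ((0, κ, α, s, w) : Full)) := by
      rw [zero_smul, add_zero]; exact hdiff
    exact hdiff'.comp_hasDerivAt (0 : ℝ) hline
  -- the derivatives of the scalar coefficients along the line
  have k1 : HasDerivAt (fun ε : ℝ => 1 + ε * κ) κ 0 := by
    simpa using ((hasDerivAt_id (0 : ℝ)).mul_const κ).const_add 1
  have s1 : HasDerivAt (fun ε : ℝ => D.ωc - ε * s) (-s) 0 := by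
    simpa using ((hasDerivAt_id (0 : ℝ)).mul_const s).const_sub D.ωc
  have a1 : HasDerivAt (fun ε : ℝ => D.d * D.kc ^ 4 - ε * α) (-α) 0 := by
    simpa using ((hasDerivAt_id (0 : ℝ)).mul_const α).const_sub (D.d * D.kc ^ 4)
  have kc1 : HasDerivAt (fun ε : ℝ => D.kc * (1 + ε * κ)) (D.kc * κ) 0 := k1.const_mul D.kc
  have hsne : D.ωc - 0 * s ≠ 0 := by rw [zero_mul, sub_zero]; exact hω.ne'
  have v1 : ∀ a b : ℝ, HasDerivAt (fun ε : ℝ => a + ε * b) b 0 := fun a b => by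
    simpa using ((hasDerivAt_id (0 : ℝ)).mul_const b).const_add a
  have hval : ∀ ε : ℝ, fullPt w₀ + ε • ((0, κ, α, s, w) : Full)
      = (0, ε * κ, ε * α, ε * s, w₀ + ε • w) := by
    intro ε
    simp [fullPt]
  have hf : D.f ^ 2 = D.ωc ^ 2 - D.g * D.H₀ * D.kc ^ 2 := by linarith
  refine Prod.ext ?_ ?_
  · ext x
    have h1 : HasDerivAt (fun ε : ℝ =>
        (D.smoothPart (fullPt w₀ + ε • ((0, κ, α, s, w) : Full))).1 x)
        ((fderiv ℝ D.smoothPart (fullPt w₀) (0, κ, α, s, w)).1 x) 0 :=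
      ((ContinuousMap.evalCLM ℝ x) ∘L (ContinuousLinearMap.fst ℝ PerC PerC)).hasFDerivAt.comp_hasDerivAt
        (x := (0 : ℝ)) hcurve
    have h2 := ((((((k1.mul s1).neg.mul (v1 (jet 1 w₀.1 x) (jet 1 w.1 x))).sub
      ((v1 (jet 0 w₀.2 x) (jet 0 w.2 x)).const_mul D.f)).add
      ((((k1.const_mul (D.g * D.kc)).mul_const D.H₀).mul
        ((hasDerivAt_const (0 : ℝ) D.kc).div s1 hsne)).mul
        (v1 (jet 1 w₀.1 x) (jet 1 w.1 x)))).add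
      (((kc1.pow 4).const_mul D.d).mul (v1 (jet 4 w₀.1 x) (jet 4 w.1 x)))).add
      (((kc1.pow 2).const_mul D.b).mul (v1 (jet 2 w₀.1 x) (jet 2 w.1 x)))).add
      (a1.mul (v1 (jet 0 w₀.1 x) (jet 0 w.1 x)))
    have h3 := h1.unique (h2.congr_of_eventuallyEq (Filter.Eventually.of_forall fun ε => by
      simp only [hval, smoothPart, smooth₁_zero_apply, Prod.fst_add, Prod.smul_fst, Prod.snd_add,
        Prod.smul_snd, map_add, map_smul, ContinuousMap.add_apply, ContinuousMap.smul_apply,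
        smul_eq_mul, Pi.add_apply, Pi.mul_apply, Pi.neg_apply, Pi.sub_apply, Pi.pow_apply,
        Pi.div_apply]))
    rw [h3, Prod.fst_add, lin_fst]
    simp only [ContinuousMap.add_apply, ContinuousMap.sub_apply, ContinuousMap.smul_apply,
      smul_eq_mul]
    rw [hb]
    simp only [Pi.mul_apply, Pi.neg_apply, Pi.pow_apply, Pi.div_apply, zero_mul, add_zero,
      sub_zero]
    rw [hf]
    push_cast
    field_simp
    ring
  · ext x
    have h1 : HasDerivAt (fun ε : ℝ =>
        (D.smoothPart (fullPt w₀ + ε • ((0, κ, α, s, w) : Full))).2 x)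
        ((fderiv ℝ D.smoothPart (fullPt w₀) (0, κ, α, s, w)).2 x) 0 :=
      ((ContinuousMap.evalCLM ℝ x) ∘L (ContinuousLinearMap.snd ℝ PerC PerC)).hasFDerivAt.comp_hasDerivAt
        (x := (0 : ℝ)) hcurve
    have h2 := (((((k1.mul s1).neg.mul (v1 (jet 1 w₀.2 x) (jet 1 w.2 x))).add
      ((v1 (jet 0 w₀.1 x) (jet 0 w.1 x)).const_mul D.f)).add
      (((kc1.pow 4).const_mul D.d).mul (v1 (jet 4 w₀.2 x) (jet 4 w.2 x)))).add
      (((kc1.pow 2).const_mul D.b).mul (v1 (jet 2 w₀.2 x) (jet 2 w.2 x)))).add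
      (a1.mul (v1 (jet 0 w₀.2 x) (jet 0 w.2 x)))
    have h3 := h1.unique (h2.congr_of_eventuallyEq (Filter.Eventually.of_forall fun ε => by
      simp only [hval, smoothPart, smooth₂_zero_apply, Prod.fst_add, Prod.smul_fst, Prod.snd_add,
        Prod.smul_snd, map_add, map_smul, ContinuousMap.add_apply, ContinuousMap.smul_apply,
        smul_eq_mul, Pi.add_apply, Pi.mul_apply, Pi.neg_apply, Pi.pow_apply]))
    rw [h3, Prod.snd_add, lin_snd]
    simp only [ContinuousMap.add_apply, ContinuousMap.sub_apply, ContinuousMap.smul_apply,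
      smul_eq_mul]
    rw [hb]
    simp only [Pi.mul_apply, Pi.neg_apply, Pi.pow_apply, zero_mul, add_zero, sub_zero]
    push_cast
    ring

/-- The `t`-derivative of the smooth part consists of quadratic terms. -/
theorem exists_fderiv_smoothPart_amplitude (hD : D.Pos) (w₀ : PerC2)
    (havg : avg (jet 0 w₀.1) = 0) : ∃ a b c e : ℝ,
    fderiv ℝ D.smoothPart (fullPt w₀) (1, 0, 0, 0, 0)
      = (a • (jet 0 w₀.1 * jet 1 w₀.1) + b • (jet 0 w₀.1 * jet 0 w₀.1),
        c • (jet 0 w₀.1 * jet 1 w₀.2) + e • (jet 0 w₀.1 * jet 0 w₀.2)) := by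
  have hdiff := ((contDiffAt_smoothPart hD w₀).differentiableAt (by norm_num)).hasFDerivAt
  have hline : HasDerivAt (fun ε : ℝ => fullPt w₀ + ε • ((1, 0, 0, 0, 0) : Full))
      (1, 0, 0, 0, 0) 0 := by
    simpa using ((hasDerivAt_id (0 : ℝ)).smul_const ((1, 0, 0, 0, 0) : Full)).const_add (fullPt w₀)
  have hcurve : HasDerivAt (fun ε : ℝ => D.smoothPart (fullPt w₀ + ε • ((1, 0, 0, 0, 0) : Full)))
      (fderiv ℝ D.smoothPart (fullPt w₀) (1, 0, 0, 0, 0)) 0 := by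
    have hdiff' : HasFDerivAt D.smoothPart (fderiv ℝ D.smoothPart (fullPt w₀))
        (fullPt w₀ + (0 : ℝ) • ((1, 0, 0, 0, 0) : Full)) := by
      rw [zero_smul, add_zero]; exact hdiff
    exact hdiff'.comp_hasDerivAt (0 : ℝ) hline
  have hval : ∀ ε : ℝ, fullPt w₀ + ε • ((1, 0, 0, 0, 0) : Full) = (ε, 0, 0, 0, w₀) := by
    intro ε
    simp [fullPt]
  simp only [hval] at hcurve
  set p := jet 0 w₀.1 with hp
  set r := D.slowness 0 with hr
  have hthin : HasDerivAt (fun ε : ℝ => D.thin ε 0 p) (-(r • p)) 0 := by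
    have h1 : HasDerivAt (fun ε : ℝ => ε * r) r 0 := by
      simpa using (hasDerivAt_id (0 : ℝ)).mul_const r
    exact (h1.smul_const p).const_sub 1
  have hthin0 : D.thin 0 0 p = 1 := thin_eq_one (zero_smul _ _)
  have hthick0 : D.thick 0 0 p = 1 := thick_eq_one (zero_smul _ _)
  have havg0 : D.thickAvg 0 0 p = 1 := thickAvg_eq_one (zero_smul _ _)
  have hthick : HasDerivAt (fun ε : ℝ => D.thick ε 0 p) (r • p) 0 := by
    have hinv := hasFDerivAt_ringInverse (𝕜 := ℝ) (1 : PerCˣ)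
    rw [show ((1 : PerCˣ) : PerC) = D.thin 0 0 p from hthin0.symm] at hinv
    have h2 := hinv.comp_hasDerivAt (0 : ℝ) hthin
    refine h2.congr_deriv ?_
    simp
  -- the mean thickness does not change to first order, since `p` has mean zero
  have hm : HasDerivAt (fun ε : ℝ => D.thickAvg ε 0 p) 0 0 := by
    have := avg.hasFDerivAt.comp_hasDerivAt (0 : ℝ) hthick
    rw [map_smul, havg, smul_zero] at this
    exact this
  refine ⟨((1 + 0) * (D.ωc - 0)) * r + 2 * (D.g * D.kc * (1 + 0) * D.H₀ * r) * r,
    -((D.d * D.kc ^ 4 - 0) * r), ((1 + 0) * (D.ωc - 0)) * r, -((D.d * D.kc ^ 4 - 0) * r),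
    hcurve.unique (HasDerivAt.prodMk
    (f₁ := fun ε : ℝ => D.smooth₁ ε 0 0 0 p (jet 1 w₀.1) (jet 2 w₀.1) (jet 4 w₀.1) (jet 0 w₀.2))
    (f₂ := fun ε : ℝ => D.smooth₂ ε 0 0 0 p (jet 0 w₀.2) (jet 1 w₀.2) (jet 2 w₀.2) (jet 4 w₀.2))
    ?_ ?_)⟩
  · have h1 := (hthin.mul_const (jet 1 w₀.1)).const_smul (-((1 + 0) * (D.ωc - 0)))
    have hc : HasDerivAt (fun ε : ℝ => D.g * D.kc * (1 + 0) * D.H₀ * r / D.thickAvg ε 0 p)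
        0 0 := by
      have hne : D.thickAvg 0 0 p ≠ 0 := by rw [havg0]; exact one_ne_zero
      refine ((hasDerivAt_const (0 : ℝ) (D.g * D.kc * (1 + 0) * D.H₀ * r)).div hm
        hne).congr_deriv ?_
      simp
    have h3 := hc.smul ((hthick.mul hthick).const_mul (jet 1 w₀.1))
    have h6 := (hm.const_mul (D.d * D.kc ^ 4 - 0)).smul (hthin.const_mul p)
    have hall := ((((h1.sub_const (D.f • jet 0 w₀.2)).add h3).add_const
      ((D.d * (D.kc * (1 + 0)) ^ 4) • jet 4 w₀.1)).add_const
      ((D.b * (D.kc * (1 + 0)) ^ 2) • jet 2 w₀.1)).add h6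
    refine hall.congr_deriv ?_
    simp only [hthick0, havg0, hthin0]
    refine ext_coe fun x => ?_
    simp
    ring
  · have h1 := (hthin.mul_const (jet 1 w₀.2)).const_smul (-((1 + 0) * (D.ωc - 0)))
    have h6 := (hm.const_mul (D.d * D.kc ^ 4 - 0)).smul (hthin.const_mul (jet 0 w₀.2))
    have hall := (((h1.add_const (D.f • p)).add_const
      ((D.d * (D.kc * (1 + 0)) ^ 4) • jet 4 w₀.2)).add_const
      ((D.b * (D.kc * (1 + 0)) ^ 2) • jet 2 w₀.2)).add h6
    refine hall.congr_deriv ?_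
    simp only [havg0, hthin0]
    refine ext_coe fun x => ?_
    simp
    ring

/-- The residual as a function on `Full`. -/
def residualMap (D : IsoData) (z : Full) : PerC2 :=
  D.residual z.1 z.2.1 z.2.2.1 z.2.2.2.1 z.2.2.2.2

/-- The residual is strictly differentiable with a rate at vanishing parameters; the drag contributes
only to the derivative in the amplitude. -/
theorem exists_quadApprox_residualMap (hD : D.Pos) (w₀ : PerC2) :
    ∃ L : Full →L[ℝ] PerC2, QuadApprox D.residualMap L (fullPt w₀) ∧
      (∀ κ α s w, L (0, κ, α, s, w) = D.lin w
        + (κ • ((-(D.f ^ 2 / D.ωc)) • jet 1 w₀.1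
            + (4 * D.d * D.kc ^ 4) • (jet 4 w₀.1 + jet 2 w₀.1))
          + (s * (2 - D.f ^ 2 / D.ωc ^ 2)) • jet 1 w₀.1 - α • jet 0 w₀.1,
        κ • ((-D.ωc) • jet 1 w₀.2 + (4 * D.d * D.kc ^ 4) • (jet 4 w₀.2 + jet 2 w₀.2))
          + s • jet 1 w₀.2 - α • jet 0 w₀.2)) ∧
      L (1, 0, 0, 0, 0) = fderiv ℝ D.smoothPart (fullPt w₀) (1, 0, 0, 0, 0)
        + D.dragPart (fullPt w₀) := by
  obtain ⟨K, s, hs, hK⟩ := lipschitz_dragPart hD w₀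
  have h1 := QuadApprox.of_contDiffAt (contDiffAt_smoothPart hD w₀)
  have h2 := QuadApprox.smul_of_lipschitz (z₀ := fullPt w₀) (f := D.dragPart)
    (τ := ContinuousLinearMap.fst ℝ ℝ (ℝ × ℝ × ℝ × PerC2)) rfl hs hK
  have e : D.residualMap = fun z => D.smoothPart z
      + (ContinuousLinearMap.fst ℝ ℝ (ℝ × ℝ × ℝ × PerC2)) z • D.dragPart z :=
    funext fun z => D.residual_eq z
  rw [e]
  refine ⟨_, h1.add h2, ?_, ?_⟩
  · intro κ α s w
    rw [_root_.add_apply, fderiv_smoothPart_params hD, ContinuousLinearMap.smulRight_apply]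
    change _ + (0 : ℝ) • D.dragPart (fullPt w₀) = _
    rw [zero_smul, add_zero]
  · rw [_root_.add_apply, ContinuousLinearMap.smulRight_apply]
    change _ + (1 : ℝ) • D.dragPart (fullPt w₀) = _
    rw [one_smul]

end IsoData
end ShallowWater
end

noncomputable section
namespace ShallowWater
open PerC
namespace IsoData
variable {D : IsoData}

/-! ### The amplitude coefficient -/

theorem continuous_sqrt_cos (D : IsoData) :
    Continuous fun ξ => √(D.f ^ 2 + D.kc ^ 2 * D.g * D.H₀ * Real.cos ξ ^ 2) := by fun_prop

theorem I₁_pos (hD : D.Pos) : 0 < D.I₁ := by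
  have hk := hD.kc_pos
  have hg := hD.g
  have hH := hD.H₀
  rw [I₁]
  refine mul_pos (by positivity) ?_
  refine intervalIntegral.integral_pos Real.two_pi_pos (continuous_sqrt_cos D).continuousOn
    (fun x _ => Real.sqrt_nonneg _) ⟨0, ⟨le_rfl, Real.two_pi_pos.le⟩, ?_⟩
  rw [Real.cos_zero]
  positivity

/-- Translation by a quarter period exchanges `cos²` and `sin²` and changes the sign of `cos (2 ξ)`.
So `I₂` is half the mean of the product of `cos² - sin²` and a difference of the same sign. -/
theorem I₂_pos (hD : D.Pos) : 0 < D.I₂ := by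
  have hk := hD.kc_pos
  have hg := hD.g
  have hH := hD.H₀
  set B := D.kc ^ 2 * D.g * D.H₀ with hB
  have hBpos : 0 < B := by positivity
  set G : ℝ → ℝ := fun ξ => √(D.f ^ 2 + B * Real.cos ξ ^ 2) * Real.cos (2 * ξ) with hG
  have hGc : Continuous G := by fun_prop
  have hGp : Function.Periodic G (2 * Real.pi) := by
    intro x
    simp only [hG]
    rw [Real.cos_add_two_pi, mul_add, show 2 * (2 * Real.pi) = 2 * Real.pi + 2 * Real.pi by ring,
      ← add_assoc, Real.cos_add_two_pi, Real.cos_add_two_pi]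
  have hshift : ∫ ξ in (0 : ℝ)..(2 * Real.pi), G (ξ + Real.pi / 2)
      = ∫ ξ in (0 : ℝ)..(2 * Real.pi), G ξ := by
    rw [intervalIntegral.integral_comp_add_right G]
    have := hGp.intervalIntegral_add_eq (Real.pi / 2) 0
    rw [zero_add] at this ⊢
    rw [← this]
    congr 1
    ring
  have hsum : 2 * ∫ ξ in (0 : ℝ)..(2 * Real.pi), G ξ
      = ∫ ξ in (0 : ℝ)..(2 * Real.pi), (G ξ + G (ξ + Real.pi / 2)) := by
    have hi : IntervalIntegrable (fun ξ => G (ξ + Real.pi / 2)) volume 0 (2 * Real.pi) :=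
      (by fun_prop : Continuous fun ξ => G (ξ + Real.pi / 2)).intervalIntegrable _ _
    rw [intervalIntegral.integral_add (hGc.intervalIntegrable _ _) hi, hshift]
    ring
  have hform : ∀ ξ, G ξ + G (ξ + Real.pi / 2)
      = (√(D.f ^ 2 + B * Real.cos ξ ^ 2) - √(D.f ^ 2 + B * Real.sin ξ ^ 2))
        * (Real.cos ξ ^ 2 - Real.sin ξ ^ 2) := by
    intro ξ
    simp only [hG]
    rw [Real.cos_add_pi_div_two, mul_add, show 2 * (Real.pi / 2) = Real.pi by ring,
      Real.cos_add_pi, neg_sq, Real.cos_two_mul']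
    ring
  have hpos : 0 < ∫ ξ in (0 : ℝ)..(2 * Real.pi), (G ξ + G (ξ + Real.pi / 2)) := by
    refine intervalIntegral.integral_pos Real.two_pi_pos (by fun_prop) (fun ξ _ => ?_)
      ⟨0, ⟨le_rfl, Real.two_pi_pos.le⟩, ?_⟩
    · rw [hform]
      rcases le_total (Real.sin ξ ^ 2) (Real.cos ξ ^ 2) with h | h
      · refine mul_nonneg (sub_nonneg.mpr (Real.sqrt_le_sqrt ?_)) (sub_nonneg.mpr h)
        gcongr
      · refine mul_nonneg_of_nonpos_of_nonpos (sub_nonpos.mpr (Real.sqrt_le_sqrt ?_))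
          (sub_nonpos.mpr h)
        gcongr
    · rw [hform]
      simp only [Real.cos_zero, Real.sin_zero]
      have : √(D.f ^ 2 + B * 0 ^ 2) < √(D.f ^ 2 + B * 1 ^ 2) :=
        Real.sqrt_lt_sqrt (by positivity) (by linarith)
      linarith
  rw [I₂]
  refine mul_pos (by positivity) ?_
  linarith

theorem ampCoeff_pos (hD : D.Pos) : 0 < D.ampCoeff := by
  have hk := hD.kc_pos
  have hg := hD.g
  have hH := hD.H₀
  have hQ := hD.Q
  have h1 := I₁_pos hD
  have h2 := I₂_pos hD
  rw [ampCoeff]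
  positivity

variable (D)

/-- Pairing with the critical eigenfunction, up to normalisation. -/
def pair₁ : PerC2 →L[ℝ] ℝ :=
  D.ωc • (coefC ∘L ContinuousLinearMap.fst ℝ PerC PerC)
    + D.f • (coefS ∘L ContinuousLinearMap.snd ℝ PerC PerC)

/-- Pairing with the derivative of the critical eigenfunction, up to normalisation. -/
def pair₂ : PerC2 →L[ℝ] ℝ :=
  (-D.ωc) • (coefS ∘L ContinuousLinearMap.fst ℝ PerC PerC)
    + D.f • (coefC ∘L ContinuousLinearMap.snd ℝ PerC PerC)

theorem pair₁_apply (y : PerC2) : D.pair₁ y = D.ωc * coefC y.1 + D.f * coefS y.2 := rfl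
theorem pair₂_apply (y : PerC2) : D.pair₂ y = -D.ωc * coefS y.1 + D.f * coefC y.2 := rfl

variable {D}

theorem pair_lin (hD : D.Pos) (w : PerC2) : D.pair₁ (D.lin w) = 0 ∧ D.pair₂ (D.lin w) = 0 := by
  have hω := hD.ωc_pos
  obtain ⟨pc1, pc2, pc4⟩ := coefC_jet w.1
  obtain ⟨ps1, ps2, ps4⟩ := coefS_jet w.1
  obtain ⟨qc1, qc2, qc4⟩ := coefC_jet w.2
  obtain ⟨qs1, qs2, qs4⟩ := coefS_jet w.2
  rw [pair₁_apply, pair₂_apply, lin_fst, lin_snd]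
  simp only [map_add, map_sub, map_smul, pc1, pc2, pc4, ps1, ps2, ps4, qc1, qc2, qc4,
    qs1, qs2, qs4, smul_eq_mul]
  constructor <;> field_simp <;> ring

/-- The linearisation of the residual in the parameters, paired with the kernel. -/
theorem pair_params (hD : D.Pos) {L : Full →L[ℝ] PerC2}
    (hL : ∀ κ α s w, L (0, κ, α, s, w) = D.lin w
        + (κ • ((-(D.f ^ 2 / D.ωc)) • jet 1 (D.kerElt 1 0).1
            + (4 * D.d * D.kc ^ 4) • (jet 4 (D.kerElt 1 0).1 + jet 2 (D.kerElt 1 0).1))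
          + (s * (2 - D.f ^ 2 / D.ωc ^ 2)) • jet 1 (D.kerElt 1 0).1 - α • jet 0 (D.kerElt 1 0).1,
        κ • ((-D.ωc) • jet 1 (D.kerElt 1 0).2
            + (4 * D.d * D.kc ^ 4) • (jet 4 (D.kerElt 1 0).2 + jet 2 (D.kerElt 1 0).2))
          + s • jet 1 (D.kerElt 1 0).2 - α • jet 0 (D.kerElt 1 0).2)) :
    (∀ κ α s w, D.pair₁ (L (0, κ, α, s, w)) = -(D.kc * (D.ωc ^ 2 + D.f ^ 2)) * α ∧
      D.pair₂ (L (0, κ, α, s, w)) = 2 * D.kc * D.ωc ^ 2 * (s - κ * (D.f ^ 2 / D.ωc))) ∧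
    ∀ α s w, L (0, 0, α, s, w) = D.lin w - α • D.eig + s • D.speedDir := by
  have hω := hD.ωc_pos
  obtain ⟨p0, p1, p2, -, p4, q0, q1, q2, -, q4⟩ := jet_kerElt (D := D) 1 0
  simp only [p0, p1, p2, p4, q0, q1, q2, q4] at hL
  refine ⟨fun κ α s w => ?_, fun α s w => ?_⟩
  · rw [hL, map_add, map_add, (pair_lin hD w).1, (pair_lin hD w).2, pair₁_apply, pair₂_apply]
    simp only [map_add, map_sub, map_smul, coefC_cosC, coefC_sinC, coefS_cosC, coefS_sinC,
      smul_eq_mul]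
    constructor
    · ring
    · field_simp
      ring
  · rw [hL]
    refine Prod.ext ?_ ?_ <;> refine ext_coe fun x => ?_
    · simp [eig, speedDir]
      ring
    · simp [eig, speedDir]
      ring

/-- A product of two functions that change sign under translation by half a period has no component
in the first Fourier modes. -/
theorem coef_mul_mul_eq_zero {u v : PerC} (hu : shift Real.pi u = -u) (hv : shift Real.pi v = -v) :
    coefC (u * v) = 0 ∧ coefS (u * v) = 0 := by
  constructor
  · rw [coefC_apply]
    refine avg_eq_zero_of_shift_pi ?_
    rw [shift_mul, shift_mul, hu, hv, shift_pi_cosC]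
    ring
  · rw [coefS_apply]
    refine avg_eq_zero_of_shift_pi ?_
    rw [shift_mul, shift_mul, hu, hv, shift_pi_sinC]
    ring

theorem avg_eq_zero_of_odd {f : PerC} (h : ∀ x : ℝ, f ((-x : ℝ) : AddCircle _) = -f (x : AddCircle _)) :
    avg f = 0 := by
  have h1 := intervalIntegral.integral_comp_sub_left (a := 0) (b := 2 * Real.pi)
    (fun y : ℝ => f (y : AddCircle (2 * Real.pi))) (2 * Real.pi)
  have h2 : ∀ x : ℝ, f ((2 * Real.pi - x : ℝ) : AddCircle (2 * Real.pi)) = -f (x : AddCircle _) := by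
    intro x
    rw [← h x, sub_eq_neg_add]
    exact periodic_coe f (-x)
  simp only [h2, sub_self, sub_zero, intervalIntegral.integral_neg] at h1
  rw [avg_apply]
  have : ∫ x in (0 : ℝ)..(2 * Real.pi), f (x : AddCircle _) = 0 := by linarith
  rw [this, mul_zero]

/-- The linearisation in the amplitude, paired with the kernel: only the drag contributes, since the
smooth terms are quadratic in the first Fourier modes. -/
theorem pair_amplitude (hD : D.Pos) {L : Full →L[ℝ] PerC2}
    (hL : L (1, 0, 0, 0, 0) = fderiv ℝ D.smoothPart (fullPt (D.kerElt 1 0)) (1, 0, 0, 0, 0)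
        + D.dragPart (fullPt (D.kerElt 1 0))) :
    D.pair₁ (L (1, 0, 0, 0, 0)) = D.kc * (D.ωc ^ 2 + D.f ^ 2) * D.ampCoeff ∧
      D.pair₂ (L (1, 0, 0, 0, 0)) = 0 := by
  have hk := hD.kc_pos
  have hg := hD.g
  have hH := hD.H₀
  obtain ⟨p0, p1, -, -, -, q0, q1, -⟩ := jet_kerElt (D := D) 1 0
  have e0 : (2 * D.kc * D.ωc) • ((1 : ℝ) • cosC - (0 : ℝ) • sinC) = (2 * D.kc * D.ωc) • cosC := by
    module
  have e1 : (2 * D.kc * D.ωc) • ((-1 : ℝ) • sinC - (0 : ℝ) • cosC)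
      = (-(2 * D.kc * D.ωc)) • sinC := by module
  have e2 : (2 * D.kc * D.f) • ((1 : ℝ) • sinC + (0 : ℝ) • cosC) = (2 * D.kc * D.f) • sinC := by
    module
  have e3 : (2 * D.kc * D.f) • ((1 : ℝ) • cosC - (0 : ℝ) • sinC) = (2 * D.kc * D.f) • cosC := by
    module
  rw [e0] at p0
  rw [e1] at p1
  rw [e2] at q0
  rw [e3] at q1
  have hsc : ∀ a : ℝ, shift Real.pi (a • cosC) = -(a • cosC) := fun a => by
    rw [← smul_neg, ← shift_pi_cosC]; rfl
  have hss : ∀ a : ℝ, shift Real.pi (a • sinC) = -(a • sinC) := fun a => by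
    rw [← smul_neg, ← shift_pi_sinC]; rfl
  obtain ⟨a, b, c, e, hsm⟩ := exists_fderiv_smoothPart_amplitude hD (D.kerElt 1 0)
    (by rw [p0, map_smul, avg_cos, smul_zero])
  rw [p0, p1, q0, q1] at hsm
  have hsm1 := coef_mul_mul_eq_zero (hsc (2 * D.kc * D.ωc)) (hss (-(2 * D.kc * D.ωc)))
  have hsm2 := coef_mul_mul_eq_zero (hsc (2 * D.kc * D.ωc)) (hsc (2 * D.kc * D.ωc))
  have hsm3 := coef_mul_mul_eq_zero (hsc (2 * D.kc * D.ωc)) (hsc (2 * D.kc * D.f))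
  have hsm4 := coef_mul_mul_eq_zero (hsc (2 * D.kc * D.ωc)) (hss (2 * D.kc * D.f))
  have hdrag : D.dragPart (fullPt (D.kerElt 1 0))
      = ((D.Q / D.H₀) • (speed ((2 * D.kc * D.ωc) • cosC) ((2 * D.kc * D.f) • sinC)
          * ((2 * D.kc * D.ωc) • cosC)),
        (D.Q / D.H₀) • (speed ((2 * D.kc * D.ωc) • cosC) ((2 * D.kc * D.f) • sinC)
          * ((2 * D.kc * D.f) • sinC))) := by
    simp only [dragPart, drag, fullPt, thickAvg_eq_one (zero_smul ℝ _),
      thin_eq_one (zero_smul ℝ _), p0, q0, mul_one]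
  have hω2 := hD.ωc_sq
  -- the modulus of the velocity of the eigenfunction is the integrand of `I₁`
  have hspeed : ∀ x : ℝ, speed ((2 * D.kc * D.ωc) • cosC) ((2 * D.kc * D.f) • sinC)
      (x : AddCircle _) = 2 * D.kc * √(D.f ^ 2 + D.kc ^ 2 * D.g * D.H₀ * Real.cos x ^ 2) := by
    intro x
    rw [speed_apply]
    simp only [ContinuousMap.smul_apply, cosC_coe, sinC_coe, smul_eq_mul]
    rw [show (2 * D.kc * D.ωc * Real.cos x) ^ 2 + (2 * D.kc * D.f * Real.sin x) ^ 2
      = (2 * D.kc) ^ 2 * (D.f ^ 2 + D.kc ^ 2 * D.g * D.H₀ * Real.cos x ^ 2) by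
        linear_combination (4 * D.kc ^ 2 * Real.cos x ^ 2) * hω2
          + (4 * D.kc ^ 2 * D.f ^ 2) * Real.sin_sq_add_cos_sq x,
      Real.sqrt_mul (by positivity), Real.sqrt_sq (by positivity)]
  set sp := speed ((2 * D.kc * D.ωc) • cosC) ((2 * D.kc * D.f) • sinC) with hsp
  rw [hL, hsm, hdrag, map_add, map_add, pair₁_apply, pair₂_apply, pair₁_apply, pair₂_apply]
  simp only [map_add, map_smul, hsm1.1, hsm1.2, hsm2.1, hsm2.2, hsm3.1, hsm3.2, hsm4.1, hsm4.2,
    smul_zero, add_zero, mul_zero, zero_add]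
  simp only [mul_smul_comm, map_smul, smul_eq_mul]
  -- by parity, the drag of the eigenfunction has no component along its derivative
  have hodd : avg (sinC * (sp * cosC)) = 0 := by
    refine avg_eq_zero_of_odd fun x => ?_
    simp only [ContinuousMap.mul_apply, hspeed, sinC_coe, cosC_coe, Real.cos_neg, Real.sin_neg]
    ring
  constructor
  · have hC : D.ωc ^ 2 * coefC (sp * cosC) + D.f ^ 2 * coefS (sp * sinC)
        = 2 * D.kc * ((D.f ^ 2 + D.kc ^ 2 * D.g * D.H₀ / 2) * D.I₁
          + D.kc ^ 2 * D.g * D.H₀ / 2 * D.I₂) := by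
      rw [coefC_apply, coefS_apply, ← smul_eq_mul, ← smul_eq_mul (D.f ^ 2), ← map_smul, ← map_smul,
        ← map_add, avg_eq_of_coe (g := fun x => (2 * D.kc * (D.f ^ 2 + D.kc ^ 2 * D.g * D.H₀ / 2)) *
          √(D.f ^ 2 + D.kc ^ 2 * D.g * D.H₀ * Real.cos x ^ 2)
          + (2 * D.kc * (D.kc ^ 2 * D.g * D.H₀ / 2)) *
          (√(D.f ^ 2 + D.kc ^ 2 * D.g * D.H₀ * Real.cos x ^ 2) * Real.cos (2 * x))),
        intervalIntegral.integral_add, intervalIntegral.integral_const_mul,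
        intervalIntegral.integral_const_mul, I₁, I₂]
      · ring
      · exact (Continuous.intervalIntegrable (by fun_prop) _ _)
      · exact (Continuous.intervalIntegrable (by fun_prop) _ _)
      · intro x
        simp only [ContinuousMap.add_apply, ContinuousMap.smul_apply, ContinuousMap.mul_apply,
          hspeed, cosC_coe, sinC_coe, smul_eq_mul, Real.cos_two_mul]
        linear_combination (2 * D.kc * √(D.f ^ 2 + D.kc ^ 2 * D.g * D.H₀ * Real.cos x ^ 2)) *
          (Real.cos x ^ 2 * hω2 + D.f ^ 2 * Real.sin_sq_add_cos_sq x)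
    have hpos : 2 * D.f ^ 2 + D.kc ^ 2 * D.g * D.H₀ ≠ 0 := by positivity
    have h2 : D.ωc ^ 2 + D.f ^ 2 = 2 * D.f ^ 2 + D.kc ^ 2 * D.g * D.H₀ := by rw [hω2]; ring
    rw [ampCoeff, h2]
    have h3 : D.ωc * (D.Q / D.H₀ * (2 * D.kc * D.ωc * coefC (sp * cosC)))
        + D.f * (D.Q / D.H₀ * (2 * D.kc * D.f * coefS (sp * sinC)))
        = (D.Q / D.H₀ * (2 * D.kc)) *
          (D.ωc ^ 2 * coefC (sp * cosC) + D.f ^ 2 * coefS (sp * sinC)) := by ring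
    rw [h3, hC]
    field_simp
  · have h1 : coefS (sp * cosC) = 0 := hodd
    have h2 : coefC (sp * sinC) = 0 := by
      rw [coefC_apply, ← hodd]
      congr 1
      ring
    rw [h1, h2]
    ring

end IsoData
end ShallowWater
end

noncomputable section
namespace ShallowWater
open PerC
namespace IsoData
variable {D : IsoData}

/-! ### The branch of nontrivial solutions -/

variable (D)

/-- The projection to the kernel of the linearisation. -/
def proj : PerC2 →L[ℝ] PerC2 :=
  (-4 : ℝ) • (D.coord₁.smulRight D.eig + D.coord₂.smulRight D.eigDeriv)

theorem proj_apply (w : PerC2) : D.proj w = D.kerElt (D.coord₁ w) (D.coord₂ w) := rfl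

/-- The amplitude `t`, the wave number parameter `κ` and the unknown `x` as an increment in `Full`:
the coordinates of `x` along the kernel play the role of the parameters `α` and `s`. -/
def branchDir : (ℝ × ℝ) × PerC2 →L[ℝ] Full :=
  let x := ContinuousLinearMap.snd ℝ (ℝ × ℝ) PerC2
  (ContinuousLinearMap.fst ℝ ℝ ℝ ∘L ContinuousLinearMap.fst ℝ (ℝ × ℝ) PerC2).prod
    ((ContinuousLinearMap.snd ℝ ℝ ℝ ∘L ContinuousLinearMap.fst ℝ (ℝ × ℝ) PerC2).prod
      ((D.coord₁ ∘L x).prod ((D.coord₂ ∘L x).prod (x - D.proj ∘L x))))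

theorem branchDir_apply (t κ : ℝ) (x : PerC2) :
    D.branchDir ((t, κ), x) = (t, κ, D.coord₁ x, D.coord₂ x, x - D.proj x) := rfl

/-- The residual of the wave with profile `t (φ + x - proj x)`, where `φ` is the critical
eigenfunction, for the parameters given by the coordinates of `x`. -/
def branchMap (z : (ℝ × ℝ) × PerC2) : PerC2 :=
  D.residualMap (fullPt (D.kerElt 1 0) + D.branchDir z)

theorem branchMap_apply (t κ : ℝ) (x : PerC2) : D.branchMap ((t, κ), x)
    = D.residual t κ (D.coord₁ x) (D.coord₂ x) (D.kerElt 1 0 + (x - D.proj x)) := by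
  simp only [branchMap, residualMap, branchDir_apply, fullPt, Prod.mk_add_mk, zero_add]

variable {D}

theorem coord_proj (hD : D.Pos) (w : PerC2) :
    D.coord₁ (D.proj w) = D.coord₁ w ∧ D.coord₂ (D.proj w) = D.coord₂ w :=
  coord_kerElt hD _ _

theorem bordered_eq (hD : D.Pos) (w : PerC2) : D.bordered w
    = D.lin (w - D.proj w) - D.coord₁ w • D.eig + D.coord₂ w • D.speedDir := by
  rw [map_sub, proj_apply, lin_kerElt hD, sub_zero, bordered_apply]

/-- On the complement of the kernel, the linearisation is bounded below. -/
theorem exists_norm_le_bordered (hD : D.Pos) : ∃ B > 0, ∀ w, ‖w‖ ≤ B * ‖D.bordered w‖ := by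
  obtain ⟨e, he⟩ := bordered_isInvertible hD
  refine ⟨‖(e.symm : PerC2 →L[ℝ] PerC2)‖ + 1, by positivity, fun w => ?_⟩
  have h1 : w = (e.symm : PerC2 →L[ℝ] PerC2) (D.bordered w) := by
    rw [← he]
    exact (e.symm_apply_apply w).symm
  calc ‖w‖ = ‖(e.symm : PerC2 →L[ℝ] PerC2) (D.bordered w)‖ := by rw [← h1]
    _ ≤ ‖(e.symm : PerC2 →L[ℝ] PerC2)‖ * ‖D.bordered w‖ := ContinuousLinearMap.le_opNorm _ _
    _ ≤ _ := by gcongr; linarith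

/-- The linearisation of the branch equation is the bordered operator in the unknown; its pairings
with the kernel contain the amplitude coefficient and the group speed. -/
theorem exists_quadApprox_branchMap (hD : D.Pos) :
    ∃ L : (ℝ × ℝ) × PerC2 →L[ℝ] PerC2, QuadApprox D.branchMap L 0 ∧ (∀ x, L (0, x) = D.bordered x) ∧
      ∀ t κ x, D.pair₁ (L ((t, κ), x))
          = D.kc * (D.ωc ^ 2 + D.f ^ 2) * (D.ampCoeff * t - D.coord₁ x) ∧
        D.pair₂ (L ((t, κ), x)) = 2 * D.kc * D.ωc ^ 2 * (D.coord₂ x - κ * (D.f ^ 2 / D.ωc)) := by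
  obtain ⟨L, hL, h0, h1⟩ := exists_quadApprox_residualMap hD (D.kerElt 1 0)
  obtain ⟨a1, a2⟩ := pair_params hD h0
  obtain ⟨a3, a4⟩ := pair_amplitude hD h1
  refine ⟨L ∘L D.branchDir, hL.comp_affine D.branchDir, fun x => ?_, fun t κ x => ?_⟩
  · rw [ContinuousLinearMap.comp_apply, show ((0 : ℝ × ℝ), x) = (((0 : ℝ), (0 : ℝ)), x) from rfl,
      branchDir_apply, a2, bordered_eq hD]
  · have e : D.branchDir ((t, κ), x) = t • ((1, 0, 0, 0, 0) : Full)
        + (0, κ, D.coord₁ x, D.coord₂ x, x - D.proj x) := by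
      rw [branchDir_apply]
      simp
    rw [ContinuousLinearMap.comp_apply, e, map_add, map_smul, map_add, map_add, map_smul, map_smul,
      a3, a4, (a1 _ _ _ _).1, (a1 _ _ _ _).2]
    constructor <;> simp only [smul_eq_mul] <;> ring

theorem residual_zero (hD : D.Pos) (w : PerC2) : D.residual 0 0 0 0 w = D.lin w := by
  have hω := hD.ωc_pos
  have hω2 := hD.ωc_sq
  have hb := hD.kc_sq
  have hf : D.f ^ 2 = D.ωc ^ 2 - D.g * D.H₀ * D.kc ^ 2 := by linarith
  rw [residual, zero_smul, zero_smul, add_zero, add_zero]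
  refine Prod.ext ?_ ?_
  · ext x
    rw [lin_fst, smooth₁_zero_apply]
    simp only [ContinuousMap.add_apply, ContinuousMap.sub_apply, ContinuousMap.smul_apply,
      smul_eq_mul]
    rw [hb, hf, sub_zero D.ωc]
    field_simp
    ring
  · ext x
    rw [lin_snd, smooth₂_zero_apply]
    simp only [ContinuousMap.add_apply, ContinuousMap.sub_apply, ContinuousMap.smul_apply,
      smul_eq_mul]
    rw [hb]
    ring

theorem branchMap_zero (hD : D.Pos) : D.branchMap 0 = 0 := by
  have h0 : (0 : (ℝ × ℝ) × PerC2) = (((0 : ℝ), (0 : ℝ)), (0 : PerC2)) := rfl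
  rw [h0, branchMap_apply, map_zero, map_zero, map_zero, sub_zero, add_zero, residual_zero hD,
    lin_kerElt hD]

/-- The branch: the solutions of the branch equation near the origin are a Lipschitz graph over the
amplitude and the wave number parameter, with known slopes of the parameters `α` and `s`. -/
theorem exists_branch (hD : D.Pos) : ∃ ρ > 0, ∃ ρ' > 0, ∃ K ≥ 1, ∃ C > 0, ∃ ψ : ℝ × ℝ → PerC2,
    (∀ z, ‖z‖ < ρ → D.branchMap (z, ψ z) = 0) ∧
    (∀ z x, ‖z‖ < ρ → ‖x‖ < ρ' → D.branchMap (z, x) = 0 → x = ψ z) ∧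
    ψ 0 = 0 ∧
    (∀ z z', ‖z‖ < ρ → ‖z'‖ < ρ → ‖ψ z - ψ z'‖ ≤ K * ‖z - z'‖) ∧
    ∀ r < ρ, ∀ z z' : ℝ × ℝ, ‖z‖ ≤ r → ‖z'‖ ≤ r →
      |D.coord₁ (ψ z - ψ z') - D.ampCoeff * (z.1 - z'.1)| ≤ C * r * ‖z - z'‖ ∧
      |D.coord₂ (ψ z - ψ z') - (z.2 - z'.2) * (D.f ^ 2 / D.ωc)| ≤ C * r * ‖z - z'‖ := by
  obtain ⟨L, hL, hL0, hpair⟩ := exists_quadApprox_branchMap hD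
  obtain ⟨B, hB, hBle⟩ := exists_norm_le_bordered hD
  obtain ⟨ρ₁, hρ₁, K, hK, hlip⟩ := lipschitz_of_quadApprox hL hB fun x => by
    rw [hL0]
    exact hBle x
  have hF0 := branchMap_zero hD
  have hstrict := hL.hasStrictFDerivAt
  have hinv : (L ∘L .inr ℝ (ℝ × ℝ) PerC2).IsInvertible := by
    have : L ∘L .inr ℝ (ℝ × ℝ) PerC2 = D.bordered := ContinuousLinearMap.ext hL0
    rw [this]
    exact bordered_isInvertible hD
  set ψ := hstrict.implicitFunctionOfProdDomain hinv with hψ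
  have hev := hstrict.eventually_apply_implicitFunctionOfProdDomain hinv
  have hlim := hstrict.tendsto_implicitFunctionOfProdDomain hinv
  rw [hF0, ← hψ] at hev
  rw [← hψ] at hlim
  obtain ⟨C, hC, ρ₂, hρ₂, hquad⟩ := hL
  -- the neighbourhood in which `ψ` solves the equation and is Lipschitz
  have hsmall : ∀ᶠ z in nhds (0 : ℝ × ℝ), ‖ψ z‖ < ρ₁ := by
    have := hlim.norm.eventually_lt_const (u := ρ₁) (by simpa using hρ₁)
    exact this
  obtain ⟨ρ₃, hρ₃, hball⟩ := Metric.mem_nhds_iff.mp (hev.and hsmall)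
  set K' := max K 1 with hK'
  have hK'1 : 1 ≤ K' := le_max_right _ _
  have hK'0 : 0 < K' := by linarith
  set ρ := min (min ρ₁ ρ₃) (ρ₂ / K') with hρ
  have hρ0 : 0 < ρ := lt_min (lt_min hρ₁ hρ₃) (by positivity)
  have hin : ∀ z : ℝ × ℝ, ‖z‖ < ρ → D.branchMap (z, ψ z) = 0 ∧ ‖ψ z‖ < ρ₁ ∧ ‖(z, ψ z)‖ ≤ ρ₁ := by
    intro z hz
    have h3 : z ∈ Metric.ball 0 ρ₃ := by
      rw [mem_ball_zero_iff]
      exact hz.trans_le ((min_le_left _ _).trans (min_le_right _ _))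
    have h4 := hball h3
    exact ⟨h4.1, h4.2, max_le (hz.le.trans ((min_le_left _ _).trans (min_le_left _ _))) h4.2.le⟩
  -- uniqueness in a full ball is the Lipschitz estimate for two solutions over the same point
  have huniq : ∀ z x, ‖z‖ < ρ → ‖x‖ < ρ₁ → D.branchMap (z, x) = 0 → x = ψ z := by
    intro z x hz hx hzero
    obtain ⟨h1, h2, h3⟩ := hin z hz
    have h4 : ‖(z, x)‖ ≤ ρ₁ :=
      max_le (hz.le.trans ((min_le_left _ _).trans (min_le_left _ _))) hx.le
    have := hlip (z, x) (z, ψ z) h4 h3 hzero h1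
    simp only [sub_self, norm_zero, mul_zero] at this
    exact sub_eq_zero.mp (norm_le_zero_iff.mp this)
  have hψ0 : ψ 0 = 0 := by
    refine (huniq 0 0 (by simpa using hρ0) (by simpa using hρ₁) ?_).symm
    exact hF0
  have hlip' : ∀ z z', ‖z‖ < ρ → ‖z'‖ < ρ → ‖ψ z - ψ z'‖ ≤ K' * ‖z - z'‖ := by
    intro z z' hz hz'
    obtain ⟨h1, -, h3⟩ := hin z hz
    obtain ⟨h1', -, h3'⟩ := hin z' hz'
    refine (hlip _ _ h3 h3' h1 h1').trans ?_
    gcongr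
    exact le_max_left _ _
  have hk := hD.kc_pos
  have hω := hD.ωc_pos
  set N₁ := D.kc * (D.ωc ^ 2 + D.f ^ 2) with hN₁
  set N₂ := 2 * D.kc * D.ωc ^ 2 with hN₂
  have hN₁0 : 0 < N₁ := by positivity
  have hN₂0 : 0 < N₂ := by positivity
  refine ⟨ρ, hρ0, ρ₁, hρ₁, K', hK'1,
    (‖D.pair₁‖ / N₁ + ‖D.pair₂‖ / N₂ + 1) * (C * K' * K'), by positivity,
    ψ, fun z hz => (hin z hz).1, huniq, hψ0, hlip', ?_⟩
  intro r hr z z' hz hz'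
  have hr0 : 0 ≤ r := (norm_nonneg _).trans hz
  have hbig : ∀ y : ℝ × ℝ, ‖y‖ ≤ r → ‖(y, ψ y) - 0‖ ≤ K' * r := by
    intro y hy
    rw [sub_zero]
    refine max_le (hy.trans (le_mul_of_one_le_left hr0 hK'1)) ?_
    have := hlip' y 0 (hy.trans_lt hr) (by simpa using hρ0)
    rw [hψ0, sub_zero, sub_zero] at this
    exact this.trans (by gcongr)
  have hKr : K' * r ≤ ρ₂ := by
    have : r ≤ ρ₂ / K' := hr.le.trans (min_le_right _ _)
    rwa [le_div_iff₀ hK'0, mul_comm] at this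
  -- both points are zeros, so the linearisation itself is small on their difference
  have hq := hquad (K' * r) hKr (z, ψ z) (z', ψ z') (hbig z hz) (hbig z' hz')
  rw [(hin z (hz.trans_lt hr)).1, (hin z' (hz'.trans_lt hr)).1, sub_zero, zero_sub, norm_neg] at hq
  have hdiff : ‖(z, ψ z) - (z', ψ z')‖ ≤ K' * ‖z - z'‖ :=
    max_le (le_mul_of_one_le_left (norm_nonneg _) hK'1)
      (hlip' z z' (hz.trans_lt hr) (hz'.trans_lt hr))
  have hq' : ‖L ((z, ψ z) - (z', ψ z'))‖ ≤ (C * K' * K') * (r * ‖z - z'‖) := by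
    calc _ ≤ C * (K' * r) * ‖(z, ψ z) - (z', ψ z')‖ := hq
      _ ≤ C * (K' * r) * (K' * ‖z - z'‖) := by gcongr
      _ = _ := by ring
  obtain ⟨e1, e2⟩ := hpair (z.1 - z'.1) (z.2 - z'.2) (ψ z - ψ z')
  have e : (((z.1 - z'.1, z.2 - z'.2), ψ z - ψ z') : (ℝ × ℝ) × PerC2) = (z, ψ z) - (z', ψ z') := rfl
  rw [e] at e1 e2
  have b1 := (D.pair₁.le_opNorm (L ((z, ψ z) - (z', ψ z')))).trans
    (mul_le_mul_of_nonneg_left hq' (norm_nonneg D.pair₁))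
  have b2 := (D.pair₂.le_opNorm (L ((z, ψ z) - (z', ψ z')))).trans
    (mul_le_mul_of_nonneg_left hq' (norm_nonneg D.pair₂))
  rw [e1, Real.norm_eq_abs, abs_mul, abs_of_pos hN₁0] at b1
  rw [e2, Real.norm_eq_abs, abs_mul, abs_of_pos hN₂0] at b2
  set m := r * ‖z - z'‖ with hm
  have hm0 : 0 ≤ m := by positivity
  constructor
  · rw [abs_sub_comm]
    calc _ = (N₁ * |D.ampCoeff * (z.1 - z'.1) - D.coord₁ (ψ z - ψ z')|) / N₁ := by field_simp
      _ ≤ (‖D.pair₁‖ * ((C * K' * K') * m)) / N₁ := by gcongr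
      _ = ‖D.pair₁‖ / N₁ * ((C * K' * K') * m) := by ring
      _ ≤ (‖D.pair₁‖ / N₁ + ‖D.pair₂‖ / N₂ + 1) * ((C * K' * K') * m) := by
        gcongr
        have : 0 ≤ ‖D.pair₂‖ / N₂ := by positivity
        linarith
      _ = _ := by rw [hm]; ring
  · calc _ = (N₂ * |D.coord₂ (ψ z - ψ z') - (z.2 - z'.2) * (D.f ^ 2 / D.ωc)|) / N₂ := by field_simp
      _ ≤ (‖D.pair₂‖ * ((C * K' * K') * m)) / N₂ := by gcongr
      _ = ‖D.pair₂‖ / N₂ * ((C * K' * K') * m) := by ring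
      _ ≤ (‖D.pair₁‖ / N₁ + ‖D.pair₂‖ / N₂ + 1) * ((C * K' * K') * m) := by
        gcongr
        have : 0 ≤ ‖D.pair₁‖ / N₁ := by positivity
        linarith
      _ = _ := by rw [hm]; ring

end IsoData
end ShallowWater
end

noncomputable section
namespace ShallowWater
open PerC
namespace IsoData
variable {D : IsoData}

/-! ### Stability of the trivial flow -/

/-- The threshold of `α` for the instability of the trivial flow at the wave number
`(1 + κ) kc`. -/
def threshold (D : IsoData) (κ : ℝ) : ℝ :=
  D.d * (D.kc * (1 + κ)) ^ 4 - D.b * (D.kc * (1 + κ)) ^ 2 + D.d * D.kc ^ 4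

/-- The linear problem has solutions in the first Fourier modes only at the threshold: the terms
other than the dissipation are skew-symmetric in the Fourier coefficients. -/
theorem eq_threshold_of_residual_eq_zero {κ α s : ℝ} {w : PerC2}
    (h : D.residual 0 κ α s w = 0) (hw : D.coord₁ w ≠ 0) : α = D.threshold κ := by
  rw [residual, zero_smul, zero_smul, add_zero, add_zero] at h
  obtain ⟨pc1, pc2, pc4⟩ := coefC_jet w.1
  obtain ⟨ps1, ps2, ps4⟩ := coefS_jet w.1
  obtain ⟨qc1, qc2, qc4⟩ := coefC_jet w.2
  obtain ⟨qs1, qs2, qs4⟩ := coefS_jet w.2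
  have h1 := congrArg Prod.fst h
  have h2 := congrArg Prod.snd h
  simp only [smooth₁, smooth₂, thin_eq_one (zero_smul ℝ (jet 0 w.1)),
    thick_eq_one (zero_smul ℝ (jet 0 w.1)), thickAvg_eq_one (zero_smul ℝ (jet 0 w.1)),
    mul_one, one_mul, Prod.fst_zero, Prod.snd_zero] at h1 h2
  have e1 := congrArg coefC h1
  have e2 := congrArg coefS h1
  have e3 := congrArg coefC h2
  have e4 := congrArg coefS h2
  simp only [map_add, map_sub, map_smul, pc1, pc2, pc4, ps1, ps2, ps4, qc1, qc2, qc4,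
    qs1, qs2, qs4, smul_eq_mul, map_zero] at e1 e2 e3 e4
  rw [coord₁_apply] at hw
  generalize coefC (jet 0 w.1) = Pc at *
  generalize coefS (jet 0 w.1) = Ps at *
  generalize coefC (jet 0 w.2) = Qc at *
  generalize coefS (jet 0 w.2) = Qs at *
  have hsum : (D.threshold κ - α) * (Pc ^ 2 + Ps ^ 2 + Qc ^ 2 + Qs ^ 2) = 0 := by
    rw [threshold]
    linear_combination Pc * e1 + Ps * e2 + Qc * e3 + Qs * e4
  rcases mul_eq_zero.mp hsum with h0 | h0
  · linarith
  · exfalso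
    apply hw
    have hc : Pc = 0 := pow_eq_zero_iff two_ne_zero |>.mp
      (le_antisymm (by linarith [sq_nonneg Ps, sq_nonneg Qc, sq_nonneg Qs]) (sq_nonneg Pc))
    have hs : Qs = 0 := pow_eq_zero_iff two_ne_zero |>.mp
      (le_antisymm (by linarith [sq_nonneg Ps, sq_nonneg Qc, sq_nonneg Pc]) (sq_nonneg Qs))
    rw [hc, hs, mul_zero, mul_zero, add_zero, zero_div]

theorem exists_mulVec_of_mem_spectrum {n : Type*} [Fintype n] [DecidableEq n] {M : Matrix n n ℂ}
    {lam : ℂ} (h : lam ∈ spectrum ℂ M) : ∃ v : n → ℂ, v ≠ 0 ∧ M.mulVec v = lam • v := by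
  rw [spectrum.mem_iff, Matrix.isUnit_iff_isUnit_det, isUnit_iff_ne_zero, not_not,
    ← Matrix.exists_mulVec_eq_zero_iff] at h
  obtain ⟨v, hv, h0⟩ := h
  refine ⟨v, hv, ?_⟩
  rw [Matrix.sub_mulVec, sub_eq_zero, Algebra.algebraMap_eq_smul_one, Matrix.smul_mulVec,
    Matrix.one_mulVec] at h0
  exact h0.symm

/-- A matrix whose trace has positive real part has an eigenvalue with positive real part. -/
theorem exists_mem_spectrum_re_pos {n : Type*} [Fintype n] [DecidableEq n] {M : Matrix n n ℂ}
    (h : 0 < M.trace.re) : ∃ lam ∈ spectrum ℂ M, 0 < lam.re := by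
  by_contra! hcon
  rw [Matrix.trace_eq_sum_roots_charpoly] at h
  change 0 < Complex.reAddGroupHom _ at h
  rw [map_multiset_sum] at h
  refine absurd h (not_lt.mpr ((Multiset.sum_le_card_nsmul _ 0 fun x hx => ?_).trans
    (smul_zero _).le))
  obtain ⟨lam, hlam, rfl⟩ := Multiset.mem_map.mp hx
  exact hcon lam (Matrix.mem_spectrum_iff_isRoot_charpoly.mpr (Polynomial.isRoot_of_mem_roots hlam))

/-- Below the threshold an eigenvalue with positive real part contradicts the energy balance; above it
the trace of the symbol is positive. -/
theorem trivialFlowUnstable_iff (hD : D.Pos) {α κ ℓ₁ ℓ₂ : ℝ}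
    (hℓ : ℓ₁ ^ 2 + ℓ₂ ^ 2 = (D.kc * (1 + κ)) ^ 2) :
    TrivialFlowUnstable (D.params α) ℓ₁ ℓ₂ ↔ D.threshold κ < α := by
  have hg := hD.g
  have hH := hD.H₀
  have ha : -(D.d * (ℓ₁ ^ 2 + ℓ₂ ^ 2) ^ 2 - D.b * (ℓ₁ ^ 2 + ℓ₂ ^ 2)
      + (D.Cc - α * D.H₀) / D.H₀) = α - D.threshold κ := by
    rw [hℓ, hD.Cc_eq, threshold]
    field_simp
    ring
  have hM : symbol (D.params α) ℓ₁ ℓ₂ = !![((α - D.threshold κ : ℝ) : ℂ),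
      (D.f : ℂ), -(D.g : ℂ) * (Complex.I * ℓ₁);
    -(D.f : ℂ), ((α - D.threshold κ : ℝ) : ℂ), -(D.g : ℂ) * (Complex.I * ℓ₂);
    -(D.H₀ : ℂ) * (Complex.I * ℓ₁), -(D.H₀ : ℂ) * (Complex.I * ℓ₂), 0] := by
    rw [← ha, Complex.ofReal_neg]
    rfl
  rw [TrivialFlowUnstable, hM]
  set a := α - D.threshold κ with hadef
  rw [← sub_pos, ← hadef]
  constructor
  · rintro ⟨lam, hlam, hre⟩
    obtain ⟨v, hv, he⟩ := exists_mulVec_of_mem_spectrum hlam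
    by_contra! hneg
    apply hv
    have h0 := congrFun he 0
    have h1 := congrFun he 1
    have h2 := congrFun he 2
    simp [Matrix.mulVec, dotProduct, Fin.sum_univ_three, Complex.ext_iff, -neg_mul] at h0 h1 h2
    obtain ⟨h0r, h0i⟩ := h0
    obtain ⟨h1r, h1i⟩ := h1
    obtain ⟨h2r, h2i⟩ := h2
    -- energy balance, with the weight `g / H₀` on the surface deviation
    have hen : lam.re * (D.H₀ * ((v 0).re ^ 2 + (v 0).im ^ 2 + (v 1).re ^ 2 + (v 1).im ^ 2)
        + D.g * ((v 2).re ^ 2 + (v 2).im ^ 2))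
        = a * D.H₀ * ((v 0).re ^ 2 + (v 0).im ^ 2 + (v 1).re ^ 2 + (v 1).im ^ 2) := by
      linear_combination -D.H₀ * ((v 0).re * h0r + (v 0).im * h0i + (v 1).re * h1r
        + (v 1).im * h1i) - D.g * ((v 2).re * h2r + (v 2).im * h2i)
    have hle : lam.re * (D.H₀ * ((v 0).re ^ 2 + (v 0).im ^ 2 + (v 1).re ^ 2 + (v 1).im ^ 2)
        + D.g * ((v 2).re ^ 2 + (v 2).im ^ 2)) ≤ 0 := by
      rw [hen]
      exact mul_nonpos_of_nonpos_of_nonneg (mul_nonpos_of_nonpos_of_nonneg hneg hH.le)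
        (by positivity)
    have hz : D.H₀ * ((v 0).re ^ 2 + (v 0).im ^ 2 + (v 1).re ^ 2 + (v 1).im ^ 2)
        + D.g * ((v 2).re ^ 2 + (v 2).im ^ 2) ≤ 0 := by
      by_contra! hp
      exact absurd hle (not_le.mpr (mul_pos hre hp))
    set E := (v 0).re ^ 2 + (v 0).im ^ 2 + (v 1).re ^ 2 + (v 1).im ^ 2 with hE
    have hE0 : 0 ≤ E := by positivity
    have hz1 : E ≤ 0 := by
      have : 0 ≤ D.g * ((v 2).re ^ 2 + (v 2).im ^ 2) := by positivity
      exact nonpos_of_mul_nonpos_right (by linarith) hH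
    have hz2 : (v 2).re ^ 2 + (v 2).im ^ 2 ≤ 0 :=
      nonpos_of_mul_nonpos_right (by linarith [mul_nonneg hH.le hE0]) hg
    have key : ∀ z : ℂ, z.re ^ 2 + z.im ^ 2 ≤ 0 → z = 0 := fun z hz => by
      refine Complex.ext (pow_eq_zero_iff two_ne_zero |>.mp (le_antisymm ?_ (sq_nonneg _)))
        (pow_eq_zero_iff two_ne_zero |>.mp (le_antisymm ?_ (sq_nonneg _)))
      · linarith [sq_nonneg z.im]
      · linarith [sq_nonneg z.re]
    have c0 : v 0 = 0 := key _ (by linarith [sq_nonneg (v 1).re, sq_nonneg (v 1).im])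
    have c1 : v 1 = 0 := key _ (by linarith [sq_nonneg (v 0).re, sq_nonneg (v 0).im])
    funext i
    fin_cases i
    · exact c0
    · exact c1
    · exact key _ hz2
  · intro hpos
    refine exists_mem_spectrum_re_pos ?_
    rw [Matrix.trace_fin_three]
    simp
    linarith

end IsoData
end ShallowWater
end

noncomputable section
namespace ShallowWater
open PerC

/-! ### Travelling waves: reduction to an ordinary differential equation -/

/-- The chain rule along an affine phase, without any differentiability assumption. -/
theorem deriv_comp_affine (w : ℝ → ℝ) (a c x : ℝ) :
    deriv (fun ξ => w (a * ξ + c)) x = a * deriv w (a * x + c) := by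
  have h := deriv_comp_mul_left a (fun y => w (y + c)) x
  rwa [deriv_comp_add_const, smul_eq_mul] at h

section Travel

variable (w : ℝ → ℝ) (ℓ₁ ℓ₂ ω : ℝ)

theorem dx_travel : dx (travel w ℓ₁ ℓ₂ ω) = travel (fun ξ => ℓ₁ * deriv w ξ) ℓ₁ ℓ₂ ω := by
  funext t x y
  simp only [dx, travel]
  have h := deriv_comp_affine w ℓ₁ (ℓ₂ * y - ω * t) x
  simpa only [add_sub_assoc] using h

theorem dy_travel : dy (travel w ℓ₁ ℓ₂ ω) = travel (fun ξ => ℓ₂ * deriv w ξ) ℓ₁ ℓ₂ ω := by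
  funext t x y
  simp only [dy, travel]
  have h := deriv_comp_affine w ℓ₂ (ℓ₁ * x - ω * t) y
  have e : ∀ ξ, ℓ₁ * x + ℓ₂ * ξ - ω * t = ℓ₂ * ξ + (ℓ₁ * x - ω * t) := fun ξ => by ring
  simpa only [e] using h

theorem dt_travel : dt (travel w ℓ₁ ℓ₂ ω) = travel (fun ξ => -ω * deriv w ξ) ℓ₁ ℓ₂ ω := by
  funext t x y
  simp only [dt, travel]
  have h := deriv_comp_affine w (-ω) (ℓ₁ * x + ℓ₂ * y) t
  have e : ∀ ξ, ℓ₁ * x + ℓ₂ * y - ω * ξ = -ω * ξ + (ℓ₁ * x + ℓ₂ * y) := fun ξ => by ring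
  simpa only [e] using h

theorem lap_travel : lap (travel w ℓ₁ ℓ₂ ω)
    = travel (fun ξ => (ℓ₁ ^ 2 + ℓ₂ ^ 2) * deriv (deriv w) ξ) ℓ₁ ℓ₂ ω := by
  funext t x y
  rw [lap, dx_travel, dx_travel, dy_travel, dy_travel, deriv_const_mul_field',
    deriv_const_mul_field']
  simp only [travel]
  ring

theorem lap_lap_travel : lap (lap (travel w ℓ₁ ℓ₂ ω))
    = travel (fun ξ => (ℓ₁ ^ 2 + ℓ₂ ^ 2) ^ 2 * iteratedDeriv 4 w ξ) ℓ₁ ℓ₂ ω := by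
  rw [lap_travel, lap_travel]
  congr 1
  funext ξ
  rw [deriv_const_mul_field', deriv_const_mul_field', iteratedDeriv_succ, iteratedDeriv_succ,
    iteratedDeriv_succ, iteratedDeriv_one]
  ring

end Travel

namespace IsoData

/-- The equations for the profile of a travelling wave at the phase `ζ`. -/
structure ProfileEq (D : IsoData) (k₁ k₂ α s κ : ℝ) (U : Profile) (ζ : ℝ) : Prop where
  thickness : 0 < D.H₀ + U.η ζ
  momentum_x : (1 + κ) * (k₁ * U.u ζ + k₂ * U.v ζ - (D.ωc - s)) * deriv U.u ζ
    = D.f * U.v ζ - D.g * ((1 + κ) * k₁) * deriv U.η ζ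
      - (D.d * (D.kc * (1 + κ)) ^ 4 * iteratedDeriv 4 U.u ζ
        + D.b * (D.kc * (1 + κ)) ^ 2 * iteratedDeriv 2 U.u ζ)
      - (D.Cc - α * D.H₀ + D.Q * √(U.u ζ ^ 2 + U.v ζ ^ 2)) / (D.H₀ + U.η ζ) * U.u ζ
  momentum_y : (1 + κ) * (k₁ * U.u ζ + k₂ * U.v ζ - (D.ωc - s)) * deriv U.v ζ
    = -D.f * U.u ζ - D.g * ((1 + κ) * k₂) * deriv U.η ζ
      - (D.d * (D.kc * (1 + κ)) ^ 4 * iteratedDeriv 4 U.v ζ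
        + D.b * (D.kc * (1 + κ)) ^ 2 * iteratedDeriv 2 U.v ζ)
      - (D.Cc - α * D.H₀ + D.Q * √(U.u ζ ^ 2 + U.v ζ ^ 2)) / (D.H₀ + U.η ζ) * U.v ζ
  mass : (1 + κ) * (k₁ * U.u ζ + k₂ * U.v ζ - (D.ωc - s)) * deriv U.η ζ
    = -(D.H₀ + U.η ζ) * ((1 + κ) * (k₁ * deriv U.u ζ + k₂ * deriv U.v ζ))

variable {D : IsoData} {k₁ k₂ : ℝ}

theorem solvesAt_travel_iff (hk : k₁ ^ 2 + k₂ ^ 2 = D.kc ^ 2) (α s κ : ℝ) (U : Profile)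
    (t x y : ℝ) :
    SolvesAt (D.params α) (travel U.u ((1 + κ) * k₁) ((1 + κ) * k₂) ((1 + κ) * (D.ωc - s)))
      (travel U.v ((1 + κ) * k₁) ((1 + κ) * k₂) ((1 + κ) * (D.ωc - s)))
      (travel U.η ((1 + κ) * k₁) ((1 + κ) * k₂) ((1 + κ) * (D.ωc - s))) t x y ↔
    D.ProfileEq k₁ k₂ α s κ U
      ((1 + κ) * k₁ * x + (1 + κ) * k₂ * y - (1 + κ) * (D.ωc - s) * t) := by
  have hℓ : ((1 + κ) * k₁) ^ 2 + ((1 + κ) * k₂) ^ 2 = (D.kc * (1 + κ)) ^ 2 := by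
    linear_combination (1 + κ) ^ 2 * hk
  have h4 : ((D.kc * (1 + κ)) ^ 2) ^ 2 = (D.kc * (1 + κ)) ^ 4 := by ring
  have i2 : ∀ w : ℝ → ℝ, iteratedDeriv 2 w = deriv (deriv w) := fun w => by
    rw [iteratedDeriv_succ, iteratedDeriv_one]
  set ζ := (1 + κ) * k₁ * x + (1 + κ) * k₂ * y - (1 + κ) * (D.ωc - s) * t with hζ
  constructor
  · rintro ⟨h1, h2, h3, h5⟩
    rw [lap_lap_travel] at h2 h3
    simp only [lap_travel, dt_travel, dx_travel, dy_travel, hℓ, h4] at h1 h2 h3 h5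
    simp only [travel, params, ← hζ] at h1 h2 h3 h5
    refine ⟨h1, ?_, ?_, ?_⟩
    · rw [i2]
      linear_combination h2
    · rw [i2]
      linear_combination h3
    · linear_combination h5
  · rintro ⟨h1, h2, h3, h5⟩
    rw [i2] at h2 h3
    refine ⟨h1, ?_, ?_, ?_⟩
    · rw [lap_lap_travel]
      simp only [lap_travel, dt_travel, dx_travel, dy_travel, hℓ, h4]
      simp only [travel, params, ← hζ]
      linear_combination h2
    · rw [lap_lap_travel]
      simp only [lap_travel, dt_travel, dx_travel, dy_travel, hℓ, h4]
      simp only [travel, params, ← hζ]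
      linear_combination h3
    · simp only [dt_travel, dx_travel, dy_travel]
      simp only [travel, params, ← hζ]
      linear_combination h5

end IsoData

/-- A property of the phase that holds almost everywhere in space-time holds at almost every
phase. -/
theorem ae_of_ae_phase {P : ℝ → Prop} {ℓ₁ ℓ₂ ω : ℝ} (hω : ω ≠ 0)
    (h : ∀ᵐ z : ℝ × ℝ × ℝ, P (ℓ₁ * z.2.1 + ℓ₂ * z.2.2 - ω * z.1)) : ∀ᵐ ζ : ℝ, P ζ := by
  have h1 : ∀ᵐ z : (ℝ × ℝ) × ℝ, P (ℓ₁ * z.1.1 + ℓ₂ * z.1.2 - ω * z.2) :=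
    (Measure.measurePreserving_swap (μ := (volume : Measure (ℝ × ℝ)))
      (ν := (volume : Measure ℝ))).quasiMeasurePreserving.ae h
  obtain ⟨z, hz⟩ := (Measure.ae_ae_of_ae_prod h1).exists
  set c := ℓ₁ * z.1 + ℓ₂ * z.2 with hc
  have hmap : Measure.QuasiMeasurePreserving (fun ζ : ℝ => ω⁻¹ * ζ) volume volume := by
    refine ⟨by fun_prop, ?_⟩
    rw [Real.map_volume_mul_left (inv_ne_zero hω)]
    exact Measure.smul_absolutelyContinuous
  have h2 := ((hmap.comp
    (Measure.measurePreserving_sub_left volume c).quasiMeasurePreserving)).ae hz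
  refine h2.mono fun ζ hζ => ?_
  have e : ℓ₁ * z.1 + ℓ₂ * z.2 - ω * (ω⁻¹ * (c - ζ)) = ζ := by
    rw [← hc]
    field_simp
    ring
  simpa only [Function.comp_apply, e] using hζ

/-! ### Absolutely continuous periodic functions -/

/-- A periodic absolutely continuous function whose derivative agrees almost everywhere with a
continuous function is continuously differentiable. -/
theorem hasDerivAt_of_ae_deriv_eq {F : ℝ → ℝ} {g : PerC} (hper : Function.Periodic F (2 * Real.pi))
    (hac : AbsolutelyContinuousOnInterval F 0 (2 * Real.pi))
    (h : ∀ᵐ x : ℝ, x ∈ uIcc 0 (2 * Real.pi) → deriv F x = g (x : AddCircle (2 * Real.pi))) (x : ℝ) :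
    HasDerivAt F (g (x : AddCircle (2 * Real.pi))) x := by
  have hcont := continuous_coe g
  -- the primitive of `g` agrees with `F` on one period and is periodic
  set G : ℝ → ℝ := fun x => F 0 + ∫ y in (0 : ℝ)..x, g (y : AddCircle (2 * Real.pi)) with hG
  have hGd : ∀ x : ℝ, HasDerivAt G (g (x : AddCircle (2 * Real.pi))) x := fun x =>
    (hcont.integral_hasStrictDerivAt 0 x).hasDerivAt.const_add (F 0)
  have hFG : ∀ x ∈ Icc 0 (2 * Real.pi), F x = G x := by
    intro x hx
    have hsub : uIcc 0 x ⊆ uIcc 0 (2 * Real.pi) := by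
      rw [uIcc_of_le hx.1, uIcc_of_le Real.two_pi_pos.le]
      exact Icc_subset_Icc_right hx.2
    have h1 := (hac.mono hsub).integral_deriv_eq_sub
    have h2 : ∫ y in (0 : ℝ)..x, deriv F y = ∫ y in (0 : ℝ)..x, g (y : AddCircle (2 * Real.pi)) := by
      refine intervalIntegral.integral_congr_ae (h.mono fun y hy hyx => ?_)
      exact hy (hsub (uIoc_subset_uIcc hyx))
    simp only [hG]
    linarith
  have hint : ∫ y in (0 : ℝ)..(2 * Real.pi), g (y : AddCircle (2 * Real.pi)) = 0 := by
    have h1 := hFG (2 * Real.pi) ⟨Real.two_pi_pos.le, le_rfl⟩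
    have h2 := hper 0
    rw [zero_add] at h2
    simp only [hG] at h1
    linarith
  have hGper : Function.Periodic G (2 * Real.pi) := by
    intro x
    have h1 := (periodic_coe g).intervalIntegral_add_eq x 0
    rw [zero_add, hint] at h1
    have h2 := intervalIntegral.integral_add_adjacent_intervals
      (hcont.intervalIntegrable (μ := volume) 0 x) (hcont.intervalIntegrable x (x + 2 * Real.pi))
    simp only [hG]
    linarith
  have : F = G := by
    funext y
    obtain ⟨z, hz, he⟩ := (hper.sub hGper).exists_mem_Ico₀ Real.two_pi_pos y
    rw [Pi.sub_apply, Pi.sub_apply, hFG z (Ico_subset_Icc_self hz), sub_self] at he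
    exact sub_eq_zero.mp he
  rw [this]
  exact hGd x

/-- Pointwise bound of a function by its Sobolev norm of order one. -/
theorem sq_le_of_absolutelyContinuous {F : ℝ → ℝ}
    (hac : AbsolutelyContinuousOnInterval F 0 (2 * Real.pi))
    (hL2 : MemLp (deriv F) 2 (volume.restrict (Ioc 0 (2 * Real.pi)))) {x : ℝ}
    (hx : x ∈ Icc 0 (2 * Real.pi)) :
    F x ^ 2 ≤ 2 * ((∫ y in (0 : ℝ)..(2 * Real.pi), F y ^ 2)
      + ∫ y in (0 : ℝ)..(2 * Real.pi), deriv F y ^ 2) := by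
  have hpi := Real.two_pi_pos
  have hcont : ContinuousOn F (uIcc 0 (2 * Real.pi)) := hac.continuousOn
  have hi1 : IntervalIntegrable (fun y => F y ^ 2) volume 0 (2 * Real.pi) :=
    (hcont.pow 2).intervalIntegrable
  have hi2 : IntervalIntegrable (fun y => deriv F y ^ 2) volume 0 (2 * Real.pi) := by
    rw [intervalIntegrable_iff_integrableOn_Ioc_of_le hpi.le]
    exact hL2.integrable_sq
  set I := (∫ y in (0 : ℝ)..(2 * Real.pi), F y ^ 2)
      + ∫ y in (0 : ℝ)..(2 * Real.pi), deriv F y ^ 2 with hI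
  have hIint : I = ∫ y in (0 : ℝ)..(2 * Real.pi), (F y ^ 2 + deriv F y ^ 2) :=
    (intervalIntegral.integral_add hi1 hi2).symm
  -- `F ^ 2` is absolutely continuous with derivative bounded by the integrand of `I`
  have hsq : AbsolutelyContinuousOnInterval (fun y => F y * F y) 0 (2 * Real.pi) := hac.mul hac
  have hosc : ∀ y ∈ Icc 0 (2 * Real.pi), F x ^ 2 - F y ^ 2 ≤ I := by
    intro y hy
    have hsub : uIcc y x ⊆ uIcc 0 (2 * Real.pi) := by
      rw [uIcc_of_le hpi.le]
      exact uIcc_subset_Icc hy hx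
    have h1 := (hsq.mono hsub).integral_deriv_eq_sub
    have h2 : F x ^ 2 - F y ^ 2 = ∫ z in y..x, deriv (fun y => F y * F y) z := by
      rw [h1]; ring
    rw [h2, hIint]
    have hdiff := hac.boundedVariationOn.ae_differentiableAt_of_mem_uIcc
    have hbound : ∀ᵐ z, z ∈ uIoc y x →
        ‖deriv (fun y => F y * F y) z‖ ≤ F z ^ 2 + deriv F z ^ 2 := by
      refine hdiff.mono fun z hz hzy => ?_
      have hd := (hz (hsub (uIoc_subset_uIcc hzy))).hasDerivAt
      have e : deriv (fun y => F y * F y) z = 2 * (F z * deriv F z) := by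
        have h := (hd.mul hd).deriv
        change deriv (fun y => F y * F y) z = _ at h
        rw [h]
        ring
      rw [e, Real.norm_eq_abs, abs_le]
      constructor <;> nlinarith [sq_nonneg (F z + deriv F z), sq_nonneg (F z - deriv F z)]
    have hIoc : uIoc y x ⊆ uIoc 0 (2 * Real.pi) := by
      rw [uIoc_of_le hpi.le]
      exact fun z hz => ⟨(le_min hy.1 hx.1).trans_lt hz.1, hz.2.trans (max_le hy.2 hx.2)⟩
    have hi := hi1.add hi2
    refine (le_abs_self _).trans ((Real.norm_eq_abs _).symm.trans_le
      (intervalIntegral.norm_integral_le_abs_of_norm_le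
      (g := fun z => F z ^ 2 + deriv F z ^ 2) ?_ ?_) |>.trans
      ((intervalIntegral.abs_integral_mono_interval hIoc ?_ hi).trans_eq (abs_of_nonneg ?_)))
    · exact (ae_restrict_iff' measurableSet_uIoc).mpr hbound
    · exact hi.mono_set hsub
    · exact Filter.Eventually.of_forall fun z => by
        simp only [Pi.zero_apply]
        positivity
    · exact intervalIntegral.integral_nonneg hpi.le fun z _ => by positivity
  have h3 : ∫ y in (0 : ℝ)..(2 * Real.pi), F x ^ 2 ≤ ∫ y in (0 : ℝ)..(2 * Real.pi), (F y ^ 2 + I) :=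
    intervalIntegral.integral_mono_on hpi.le (by simp) (hi1.add (by simp)) fun y hy => by
      linarith [hosc y hy]
  rw [intervalIntegral.integral_add hi1 (by simp), intervalIntegral.integral_const,
    intervalIntegral.integral_const, sub_zero, smul_eq_mul, smul_eq_mul] at h3
  have h4 : ∫ y in (0 : ℝ)..(2 * Real.pi), F y ^ 2 ≤ I := by
    have : 0 ≤ ∫ y in (0 : ℝ)..(2 * Real.pi), deriv F y ^ 2 :=
      intervalIntegral.integral_nonneg hpi.le fun y _ => sq_nonneg _
    linarith
  have h5 : 0 ≤ I := by
    have a1 : 0 ≤ ∫ y in (0 : ℝ)..(2 * Real.pi), deriv F y ^ 2 :=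
      intervalIntegral.integral_nonneg hpi.le fun y _ => sq_nonneg _
    have a2 : 0 ≤ ∫ y in (0 : ℝ)..(2 * Real.pi), F y ^ 2 :=
      intervalIntegral.integral_nonneg hpi.le fun y _ => sq_nonneg _
    linarith
  have h6 : (1 : ℝ) ≤ 2 * Real.pi := by linarith [Real.pi_gt_three]
  have h7 : 2 * Real.pi * F x ^ 2 ≤ 2 * Real.pi * (2 * I) := by nlinarith
  exact le_of_mul_le_mul_left h7 hpi

end ShallowWater
end

noncomputable section
namespace ShallowWater
open PerC

/-! ### Periodic Sobolev spaces -/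

theorem iteratedDeriv_of_isDeriv {n : ℕ} {F : ℕ → PerC} (h : ∀ j < n, IsDeriv (F j) (F (j + 1)))
    {j : ℕ} (hj : j ≤ n) : iteratedDeriv j (fun x : ℝ => F 0 (x : AddCircle (2 * Real.pi)))
      = fun x : ℝ => F j (x : AddCircle (2 * Real.pi)) := by
  induction j with
  | zero => exact iteratedDeriv_zero
  | succ j ih =>
    rw [iteratedDeriv_succ, ih (by omega)]
    exact funext fun x => (h j (by omega) x).deriv

theorem isPerSobolevSucc_of_isDeriv {m : ℕ} {F : ℕ → PerC}
    (h : ∀ j < m + 1, IsDeriv (F j) (F (j + 1))) :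
    IsPerSobolevSucc m (fun x : ℝ => F 0 (x : AddCircle (2 * Real.pi))) := by
  have hit : ∀ j ≤ m + 1, iteratedDeriv j (fun x : ℝ => F 0 (x : AddCircle (2 * Real.pi)))
      = fun x : ℝ => F j (x : AddCircle (2 * Real.pi)) := fun j hj => iteratedDeriv_of_isDeriv h hj
  refine ⟨periodic_coe _, contDiff_nat_iff_iteratedDeriv.mpr ⟨fun j hj => ?_, fun j hj => ?_⟩,
    ?_, ?_⟩
  · rw [hit j (by omega)]
    exact continuous_coe _
  · rw [hit j (by omega)]
    exact fun x => (h j (by omega) x).differentiableAt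
  · rw [hit m (by omega)]
    refine ContDiffOn.absolutelyContinuousOnInterval (ContDiff.contDiffOn ?_)
    rw [contDiff_one_iff_deriv]
    refine ⟨fun x => (h m (by omega) x).differentiableAt, ?_⟩
    rw [funext fun x => (h m (by omega) x).deriv]
    exact continuous_coe _
  · rw [hit (m + 1) le_rfl]
    refine MemLp.of_bound (continuous_coe _).aestronglyMeasurable ‖F (m + 1)‖
      (Filter.Eventually.of_forall fun x => ?_)
    exact abs_apply_le _ x

theorem sobolevSq_nonneg (m : ℕ) (w : ℝ → ℝ) : 0 ≤ sobolevSq m w :=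
  Finset.sum_nonneg fun _ _ =>
    intervalIntegral.integral_nonneg Real.two_pi_pos.le fun _ _ => sq_nonneg _

theorem sobolevSq_le {m : ℕ} {w : ℝ → ℝ} {B : ℝ}
    (h : ∀ j ≤ m, ∀ x, |iteratedDeriv j w x| ≤ B) :
    sobolevSq m w ≤ (m + 1) * (2 * Real.pi * B ^ 2) := by
  have h1 : ∀ j ∈ Finset.range (m + 1),
      ∫ ξ in (0 : ℝ)..(2 * Real.pi), iteratedDeriv j w ξ ^ 2 ≤ 2 * Real.pi * B ^ 2 := by
    intro j hj
    have h2 := intervalIntegral.norm_integral_le_of_norm_le_const (a := 0) (b := 2 * Real.pi)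
      (f := fun ξ => iteratedDeriv j w ξ ^ 2) (C := B ^ 2) fun x _ => by
        rw [Real.norm_eq_abs, abs_pow]
        exact pow_le_pow_left₀ (abs_nonneg _) (h j (by simpa [Nat.lt_succ_iff] using hj) x) 2
    rw [sub_zero, abs_of_pos Real.two_pi_pos, mul_comm (B ^ 2)] at h2
    exact (le_abs_self _).trans h2
  refine (Finset.sum_le_card_nsmul _ _ _ h1).trans_eq ?_
  rw [Finset.card_range, nsmul_eq_mul]
  push_cast
  ring

theorem Profile.normX_le {U : Profile} {B : ℝ} (hB : 0 ≤ B)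
    (hu : ∀ j ≤ 4, ∀ x, |iteratedDeriv j U.u x| ≤ B)
    (hv : ∀ j ≤ 4, ∀ x, |iteratedDeriv j U.v x| ≤ B)
    (hη : ∀ j ≤ 1, ∀ x, |iteratedDeriv j U.η x| ≤ B) : U.normX ≤ 9 * B := by
  have h1 := sobolevSq_le hu
  have h2 := sobolevSq_le hv
  have h3 := sobolevSq_le hη
  push_cast at h1 h2 h3
  refine Real.sqrt_le_iff.mpr ⟨by positivity, ?_⟩
  have hpi : Real.pi ≤ 3.15 := Real.pi_lt_d2.le
  nlinarith [mul_le_mul_of_nonneg_right hpi (sq_nonneg B), sq_nonneg B]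

theorem periodic_iteratedDeriv {w : ℝ → ℝ} {c : ℝ} (h : Function.Periodic w c) (j : ℕ) :
    Function.Periodic (iteratedDeriv j w) c := by
  intro x
  have h1 := congrFun (iteratedDeriv_comp_add_const j w c) x
  rw [← h1]
  congr 1
  exact funext h

/-- Sobolev embedding: the derivatives of order at most `m` are bounded by the `H^(m+1)` norm. -/
theorem IsPerSobolevSucc.sq_iteratedDeriv_le {m : ℕ} {w : ℝ → ℝ} (h : IsPerSobolevSucc m w)
    {j : ℕ} (hj : j ≤ m) (x : ℝ) : iteratedDeriv j w x ^ 2 ≤ 2 * sobolevSq (m + 1) w := by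
  obtain ⟨hper, hC, hac, hL2⟩ := h
  have key : AbsolutelyContinuousOnInterval (iteratedDeriv j w) 0 (2 * Real.pi) ∧
      MemLp (deriv (iteratedDeriv j w)) 2 (volume.restrict (Ioc 0 (2 * Real.pi))) := by
    rw [← iteratedDeriv_succ]
    rcases hj.eq_or_lt with rfl | hlt
    · exact ⟨hac, hL2⟩
    · obtain ⟨hc, hd⟩ := contDiff_nat_iff_iteratedDeriv.mp hC
      refine ⟨ContDiffOn.absolutelyContinuousOnInterval (ContDiff.contDiffOn ?_), ?_⟩
      · rw [contDiff_one_iff_deriv, ← iteratedDeriv_succ]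
        exact ⟨hd j hlt, hc (j + 1) hlt⟩
      · obtain ⟨B, hB⟩ := (isCompact_Icc (a := 0) (b := 2 * Real.pi)).exists_bound_of_continuousOn
          (hc (j + 1) hlt).continuousOn
        refine MemLp.of_bound (hc (j + 1) hlt).aestronglyMeasurable B
          ((ae_restrict_iff' measurableSet_Ioc).mpr (Filter.Eventually.of_forall fun y hy => ?_))
        exact hB y (Ioc_subset_Icc_self hy)
  obtain ⟨y, hy, he⟩ := (periodic_iteratedDeriv hper j).exists_mem_Ico₀ Real.two_pi_pos x
  rw [he]
  refine (sq_le_of_absolutelyContinuous key.1 key.2 (Ico_subset_Icc_self hy)).trans ?_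
  rw [← iteratedDeriv_succ]
  refine mul_le_mul_of_nonneg_left ?_ (by norm_num)
  have hsub : ({j, j + 1} : Finset ℕ) ⊆ Finset.range (m + 1 + 1) := by
    intro i hi
    simp only [Finset.mem_insert, Finset.mem_singleton] at hi
    simp only [Finset.mem_range]
    omega
  have := Finset.sum_le_sum_of_subset_of_nonneg (f := fun i =>
    ∫ ξ in (0 : ℝ)..(2 * Real.pi), iteratedDeriv i w ξ ^ 2) hsub fun i _ _ =>
      intervalIntegral.integral_nonneg Real.two_pi_pos.le fun _ _ => sq_nonneg _
  rwa [Finset.sum_pair (by omega)] at this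

theorem Profile.MemX.abs_iteratedDeriv_le {U : Profile} (h : U.MemX) {j : ℕ} (hj : j ≤ 3) (x : ℝ) :
    |iteratedDeriv j U.u x| ≤ 2 * U.normX ∧ |iteratedDeriv j U.v x| ≤ 2 * U.normX := by
  have h1 := h.1.sq_iteratedDeriv_le hj x
  have h2 := h.2.1.sq_iteratedDeriv_le hj x
  have a1 := sobolevSq_nonneg 4 U.u
  have a2 := sobolevSq_nonneg 4 U.v
  have a3 := sobolevSq_nonneg 1 U.η
  have hN : U.normX ^ 2 = sobolevSq 4 U.u + sobolevSq 4 U.v + sobolevSq 1 U.η :=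
    Real.sq_sqrt (by positivity)
  have hN0 : 0 ≤ U.normX := Real.sqrt_nonneg _
  constructor <;> refine abs_le_of_sq_le_sq ?_ (by positivity) <;> nlinarith

end ShallowWater
end

noncomputable section
namespace ShallowWater
open PerC
namespace IsoData
variable {D : IsoData}

/-! ### Solutions of the reduced equations are profiles of waves -/

theorem thin_apply (t s : ℝ) (p : PerC) (x : AddCircle (2 * Real.pi)) :
    D.thin t s p x = 1 - t * D.slowness s * p x := rfl

theorem thick_apply {t s : ℝ} {p : PerC} (h : ∀ x, 0 < D.thin t s p x)
    (x : AddCircle (2 * Real.pi)) : D.thick t s p x = (D.thin t s p x)⁻¹ := by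
  have hu : IsUnit (D.thin t s p) :=
    (ContinuousMap.isUnit_iff_forall_ne_zero _).mpr fun x => (h x).ne'
  have h1 := congrArg (fun F : PerC => F x) (Ring.inverse_mul_cancel _ hu)
  simp only [ContinuousMap.mul_apply, ContinuousMap.one_apply] at h1
  exact eq_inv_of_mul_eq_one_left h1

theorem thickAvg_pos {t s : ℝ} {p : PerC} (h : ∀ x, 0 < D.thin t s p x) :
    0 < D.thickAvg t s p := by
  refine avg_pos (fun x => ?_) fun h0 => ?_
  · rw [thick_apply h]
    exact (inv_pos.mpr (h _)).le
  · have h1 := congrArg (fun F : PerC => F ((0 : ℝ) : AddCircle (2 * Real.pi))) h0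
    simp only [thick_apply h, ContinuousMap.zero_apply] at h1
    exact (inv_pos.mpr (h _)).ne' h1

theorem isDeriv_thick {t s : ℝ} {p p' : PerC} (h : ∀ x, 0 < D.thin t s p x) (hp : IsDeriv p p') :
    IsDeriv (D.thick t s p) ((t * D.slowness s) • (p' * (D.thick t s p * D.thick t s p))) := by
  intro x
  have h1 := (((hp x).const_mul (t * D.slowness s)).const_sub 1).fun_inv (h x).ne'
  have e : (fun y : ℝ => D.thick t s p (y : AddCircle (2 * Real.pi)))
      = fun y : ℝ => (1 - t * D.slowness s * p (y : AddCircle (2 * Real.pi)))⁻¹ :=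
    funext fun y => by rw [thick_apply h, thin_apply]
  rw [e]
  refine h1.congr_deriv ?_
  rw [← thin_apply]
  simp only [ContinuousMap.smul_apply, ContinuousMap.mul_apply, thick_apply h, smul_eq_mul]
  ring

variable (D)

/-- The surface deviation of the wave with velocity `t p` parallel to the wave vector. -/
def elev (t s : ℝ) (p : PerC) : PerC := D.H₀ • ((D.thickAvg t s p)⁻¹ • D.thick t s p - 1)

/-- The derivative of the surface deviation; `p'` stands for the derivative of `p`. -/
def elevDeriv (t s : ℝ) (p p' : PerC) : PerC :=
  (D.H₀ * (t * D.slowness s) / D.thickAvg t s p) • (p' * (D.thick t s p * D.thick t s p))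

/-- The first component of the velocity with components `t p`, `t q` along and across the wave
vector. -/
def velX (k₁ k₂ t : ℝ) (p q : PerC) : PerC := (t / D.kc) • (k₁ • p - k₂ • q)

/-- The second component of the velocity with components `t p`, `t q` along and across the wave
vector. -/
def velY (k₁ k₂ t : ℝ) (p q : PerC) : PerC := (t / D.kc) • (k₂ • p + k₁ • q)

/-- The profile with velocity `t (p, q)`, `(p, q) = (1 + ∂)⁻⁴ w`, along and across the wave
vector. -/
def profile (k₁ k₂ t s : ℝ) (w : PerC2) : Profile where
  u := fun ξ => D.velX k₁ k₂ t (jet 0 w.1) (jet 0 w.2) (ξ : AddCircle (2 * Real.pi))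
  v := fun ξ => D.velY k₁ k₂ t (jet 0 w.1) (jet 0 w.2) (ξ : AddCircle (2 * Real.pi))
  η := fun ξ => D.elev t s (jet 0 w.1) (ξ : AddCircle (2 * Real.pi))

variable {D}

theorem isDeriv_elev {t s : ℝ} {p p' : PerC} (h : ∀ x, 0 < D.thin t s p x) (hp : IsDeriv p p') :
    IsDeriv (D.elev t s p) (D.elevDeriv t s p p') := by
  intro x
  have h1 := ((((isDeriv_thick h hp) x).const_mul (D.thickAvg t s p)⁻¹).sub_const 1).const_mul D.H₀
  refine h1.congr_deriv ?_
  simp only [elevDeriv, ContinuousMap.smul_apply, ContinuousMap.mul_apply, smul_eq_mul]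
  ring

theorem avg_elev {t s : ℝ} {p : PerC} (h : ∀ x, 0 < D.thin t s p x) : avg (D.elev t s p) = 0 := by
  have hm := thickAvg_pos h
  rw [elev, map_smul, map_sub, map_smul, avg_one, smul_eq_mul, smul_eq_mul]
  change D.H₀ * ((D.thickAvg t s p)⁻¹ * D.thickAvg t s p - 1) = 0
  rw [inv_mul_cancel₀ hm.ne', sub_self, mul_zero]

theorem isDeriv_velX (k₁ k₂ t : ℝ) {p q p' q' : PerC} (hp : IsDeriv p p') (hq : IsDeriv q q') :
    IsDeriv (D.velX k₁ k₂ t p q) (D.velX k₁ k₂ t p' q') :=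
  ((hp.smul k₁).sub (hq.smul k₂)).smul _

theorem isDeriv_velY (k₁ k₂ t : ℝ) {p q p' q' : PerC} (hp : IsDeriv p p') (hq : IsDeriv q q') :
    IsDeriv (D.velY k₁ k₂ t p q) (D.velY k₁ k₂ t p' q') :=
  ((hp.smul k₂).add (hq.smul k₁)).smul _

section Pointwise

variable {k₁ k₂ t κ α s : ℝ} {p₀ p₁ p₂ q₀ q₁ q₂ : PerC}

theorem elev_thickness (hD : D.Pos) (h : ∀ x, 0 < D.thin t s p₀ x)
    (x : AddCircle (2 * Real.pi)) :
    D.H₀ + D.elev t s p₀ x = D.H₀ / (D.thickAvg t s p₀ * D.thin t s p₀ x) ∧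
      0 < D.H₀ + D.elev t s p₀ x := by
  have hm := thickAvg_pos h
  have hx := h x
  have hH := hD.H₀
  have e : D.H₀ + D.elev t s p₀ x = D.H₀ / (D.thickAvg t s p₀ * D.thin t s p₀ x) := by
    simp only [elev, ContinuousMap.smul_apply, ContinuousMap.sub_apply, ContinuousMap.one_apply,
      smul_eq_mul, thick_apply h]
    field_simp
    ring
  exact ⟨e, by rw [e]; positivity⟩

theorem advection_eq (hD : D.Pos) (hk : k₁ ^ 2 + k₂ ^ 2 = D.kc ^ 2) (hs : s < D.ωc)
    (x : AddCircle (2 * Real.pi)) :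
    k₁ * D.velX k₁ k₂ t p₀ q₀ x + k₂ * D.velY k₁ k₂ t p₀ q₀ x = D.kc * (t * p₀ x) ∧
    (1 + κ) * (k₁ * D.velX k₁ k₂ t p₀ q₀ x + k₂ * D.velY k₁ k₂ t p₀ q₀ x - (D.ωc - s))
      = -((1 + κ) * (D.ωc - s)) * D.thin t s p₀ x := by
  have hkc := hD.kc_pos
  have hs' : D.ωc - s ≠ 0 := (sub_pos.mpr hs).ne'
  have e : k₁ * D.velX k₁ k₂ t p₀ q₀ x + k₂ * D.velY k₁ k₂ t p₀ q₀ x = D.kc * (t * p₀ x) := by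
    simp only [velX, velY, ContinuousMap.smul_apply, ContinuousMap.sub_apply,
      ContinuousMap.add_apply, smul_eq_mul]
    field_simp
    linear_combination t * p₀ x * hk
  refine ⟨e, ?_⟩
  rw [e, thin_apply, slowness]
  field_simp
  ring

theorem mass_eq (hD : D.Pos) (hk : k₁ ^ 2 + k₂ ^ 2 = D.kc ^ 2) (hs : s < D.ωc)
    (h : ∀ x, 0 < D.thin t s p₀ x) (x : AddCircle (2 * Real.pi)) :
    (1 + κ) * (k₁ * D.velX k₁ k₂ t p₀ q₀ x + k₂ * D.velY k₁ k₂ t p₀ q₀ x - (D.ωc - s))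
        * D.elevDeriv t s p₀ p₁ x
      = -(D.H₀ + D.elev t s p₀ x) *
        ((1 + κ) * (k₁ * D.velX k₁ k₂ t p₁ q₁ x + k₂ * D.velY k₁ k₂ t p₁ q₁ x)) := by
  have hm := thickAvg_pos h
  have hx := h x
  have hs' : 0 < D.ωc - s := sub_pos.mpr hs
  rw [(advection_eq hD hk hs x).2, (advection_eq (p₀ := p₁) hD hk hs (κ := κ) x).1,
    (elev_thickness hD h x).1]
  simp only [elevDeriv, ContinuousMap.smul_apply, ContinuousMap.mul_apply, smul_eq_mul,
    thick_apply h, slowness]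
  field_simp

theorem speed_vel (hD : D.Pos) (hk : k₁ ^ 2 + k₂ ^ 2 = D.kc ^ 2) (ht : 0 ≤ t)
    (x : AddCircle (2 * Real.pi)) :
    √(D.velX k₁ k₂ t p₀ q₀ x ^ 2 + D.velY k₁ k₂ t p₀ q₀ x ^ 2) = t * speed p₀ q₀ x := by
  have hkc := hD.kc_pos
  have e : D.velX k₁ k₂ t p₀ q₀ x ^ 2 + D.velY k₁ k₂ t p₀ q₀ x ^ 2
      = t ^ 2 * (p₀ x ^ 2 + q₀ x ^ 2) := by
    simp only [velX, velY, ContinuousMap.smul_apply, ContinuousMap.sub_apply,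
      ContinuousMap.add_apply, smul_eq_mul]
    field_simp
    linear_combination t ^ 2 * (p₀ x ^ 2 + q₀ x ^ 2) * hk
  rw [e, speed_apply, Real.sqrt_mul (by positivity), Real.sqrt_sq ht]

/-- The momentum equations, except for the terms of fourth order, in terms of the velocity
components along and across the wave vector. -/
theorem momentum_eq (hD : D.Pos) (hk : k₁ ^ 2 + k₂ ^ 2 = D.kc ^ 2) (ht : 0 ≤ t) (hs : s < D.ωc)
    (h : ∀ x, 0 < D.thin t s p₀ x) (x : AddCircle (2 * Real.pi)) :
    (1 + κ) * (k₁ * D.velX k₁ k₂ t p₀ q₀ x + k₂ * D.velY k₁ k₂ t p₀ q₀ x - (D.ωc - s))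
        * D.velX k₁ k₂ t p₁ q₁ x
      - (D.f * D.velY k₁ k₂ t p₀ q₀ x - D.g * ((1 + κ) * k₁) * D.elevDeriv t s p₀ p₁ x
        - D.b * (D.kc * (1 + κ)) ^ 2 * D.velX k₁ k₂ t p₂ q₂ x
        - (D.Cc - α * D.H₀
            + D.Q * √(D.velX k₁ k₂ t p₀ q₀ x ^ 2 + D.velY k₁ k₂ t p₀ q₀ x ^ 2))
          / (D.H₀ + D.elev t s p₀ x) * D.velX k₁ k₂ t p₀ q₀ x)
      = D.velX k₁ k₂ t (D.smooth₁ t κ α s p₀ p₁ p₂ 0 q₀ + t • D.drag t s p₀ q₀ p₀)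
          (D.smooth₂ t κ α s p₀ q₀ q₁ q₂ 0 + t • D.drag t s p₀ q₀ q₀) x ∧
    (1 + κ) * (k₁ * D.velX k₁ k₂ t p₀ q₀ x + k₂ * D.velY k₁ k₂ t p₀ q₀ x - (D.ωc - s))
        * D.velY k₁ k₂ t p₁ q₁ x
      - (-D.f * D.velX k₁ k₂ t p₀ q₀ x - D.g * ((1 + κ) * k₂) * D.elevDeriv t s p₀ p₁ x
        - D.b * (D.kc * (1 + κ)) ^ 2 * D.velY k₁ k₂ t p₂ q₂ x
        - (D.Cc - α * D.H₀
            + D.Q * √(D.velX k₁ k₂ t p₀ q₀ x ^ 2 + D.velY k₁ k₂ t p₀ q₀ x ^ 2))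
          / (D.H₀ + D.elev t s p₀ x) * D.velY k₁ k₂ t p₀ q₀ x)
      = D.velY k₁ k₂ t (D.smooth₁ t κ α s p₀ p₁ p₂ 0 q₀ + t • D.drag t s p₀ q₀ p₀)
          (D.smooth₂ t κ α s p₀ q₀ q₁ q₂ 0 + t • D.drag t s p₀ q₀ q₀) x := by
  have hm := thickAvg_pos h
  have hx := h x
  have hkc := hD.kc_pos
  have hH := hD.H₀
  have hdrag : (D.Cc - α * D.H₀ + D.Q * (t * speed p₀ q₀ x)) / (D.H₀ + D.elev t s p₀ x)
      = ((D.d * D.kc ^ 4 - α) + t * (D.Q / D.H₀) * speed p₀ q₀ x) * D.thickAvg t s p₀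
        * D.thin t s p₀ x := by
    rw [(elev_thickness hD h x).1, hD.Cc_eq]
    field_simp
  rw [(advection_eq hD hk hs x).2, speed_vel hD hk ht, hdrag]
  have hkne := hkc.ne'
  simp only [velX, velY, elevDeriv, smooth₁, smooth₂, drag, ContinuousMap.smul_apply,
    ContinuousMap.mul_apply, ContinuousMap.sub_apply, ContinuousMap.add_apply,
    ContinuousMap.zero_apply, smul_eq_mul]
  generalize speed p₀ q₀ x = sp
  generalize D.thin t s p₀ x = T
  generalize D.thick t s p₀ x = H
  generalize D.slowness s = r
  constructor
  · field_simp
    ring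
  · field_simp
    ring

end Pointwise

theorem smooth₁_top (t κ α s : ℝ) (p₀ p₁ p₂ p₄ q₀ : PerC) : D.smooth₁ t κ α s p₀ p₁ p₂ p₄ q₀
    = D.smooth₁ t κ α s p₀ p₁ p₂ 0 q₀ + (D.d * (D.kc * (1 + κ)) ^ 4) • p₄ := by
  rw [smooth₁, smooth₁, smul_zero]
  abel

theorem smooth₂_top (t κ α s : ℝ) (p₀ q₀ q₁ q₂ q₄ : PerC) : D.smooth₂ t κ α s p₀ q₀ q₁ q₂ q₄
    = D.smooth₂ t κ α s p₀ q₀ q₁ q₂ 0 + (D.d * (D.kc * (1 + κ)) ^ 4) • q₄ := by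
  rw [smooth₂, smooth₂, smul_zero]
  abel

theorem iteratedDeriv_profile (k₁ k₂ t s : ℝ) (w : PerC2) {j : ℕ} (hj : j ≤ 4) :
    iteratedDeriv j (D.profile k₁ k₂ t s w).u = (fun ξ : ℝ =>
      D.velX k₁ k₂ t (jet j w.1) (jet j w.2) (ξ : AddCircle (2 * Real.pi))) ∧
    iteratedDeriv j (D.profile k₁ k₂ t s w).v = fun ξ : ℝ =>
      D.velY k₁ k₂ t (jet j w.1) (jet j w.2) (ξ : AddCircle (2 * Real.pi)) :=
  ⟨iteratedDeriv_of_isDeriv (F := fun j => D.velX k₁ k₂ t (jet j w.1) (jet j w.2))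
      (fun _ hj => isDeriv_velX _ _ _ (isDeriv_jet hj _) (isDeriv_jet hj _)) hj,
    iteratedDeriv_of_isDeriv (F := fun j => D.velY k₁ k₂ t (jet j w.1) (jet j w.2))
      (fun _ hj => isDeriv_velY _ _ _ (isDeriv_jet hj _) (isDeriv_jet hj _)) hj⟩

theorem memX_profile (k₁ k₂ : ℝ) {t s : ℝ} {w : PerC2} (h : ∀ x, 0 < D.thin t s (jet 0 w.1) x) :
    (D.profile k₁ k₂ t s w).MemX :=
  ⟨isPerSobolevSucc_of_isDeriv (F := fun j => D.velX k₁ k₂ t (jet j w.1) (jet j w.2))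
      fun _ hj => isDeriv_velX _ _ _ (isDeriv_jet hj _) (isDeriv_jet hj _),
    isPerSobolevSucc_of_isDeriv (F := fun j => D.velY k₁ k₂ t (jet j w.1) (jet j w.2))
      fun _ hj => isDeriv_velY _ _ _ (isDeriv_jet hj _) (isDeriv_jet hj _),
    isPerSobolevSucc_of_isDeriv (m := 0) (F := fun j => if j = 0 then D.elev t s (jet 0 w.1)
      else D.elevDeriv t s (jet 0 w.1) (jet 1 w.1)) fun j hj => by
        obtain rfl : j = 0 := by omega
        exact isDeriv_elev h (isDeriv_jet (by norm_num) _)⟩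

/-- Solutions of the reduced equations are profiles of waves. -/
theorem isWave_profile (hD : D.Pos) {k₁ k₂ t κ α s : ℝ} (hk : k₁ ^ 2 + k₂ ^ 2 = D.kc ^ 2)
    (ht : 0 ≤ t) (hs : s < D.ωc) {w : PerC2} (h : ∀ x, 0 < D.thin t s (jet 0 w.1) x)
    (hres : D.residual t κ α s w = 0) : D.IsWave k₁ k₂ α s κ (D.profile k₁ k₂ t s w) := by
  refine ⟨memX_profile k₁ k₂ h, ?_, Filter.Eventually.of_forall fun z => ?_⟩
  · have h1 := avg_elev h
    rw [avg_apply] at h1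
    exact (mul_eq_zero.mp h1).resolve_left (by have := Real.pi_pos; positivity)
  · rw [solvesAt_travel_iff hk]
    generalize (1 + κ) * k₁ * z.2.1 + (1 + κ) * k₂ * z.2.2 - (1 + κ) * (D.ωc - s) * z.1 = ζ
    obtain ⟨u1, v1⟩ := iteratedDeriv_profile (D := D) k₁ k₂ t s w (j := 1) (by norm_num)
    obtain ⟨u2, v2⟩ := iteratedDeriv_profile (D := D) k₁ k₂ t s w (j := 2) (by norm_num)
    obtain ⟨u4, v4⟩ := iteratedDeriv_profile (D := D) k₁ k₂ t s w (j := 4) (by norm_num)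
    rw [iteratedDeriv_one] at u1 v1
    have η1 : deriv (D.profile k₁ k₂ t s w).η ζ
        = D.elevDeriv t s (jet 0 w.1) (jet 1 w.1) (ζ : AddCircle (2 * Real.pi)) :=
      (isDeriv_elev h (isDeriv_jet (by norm_num) _) ζ).deriv
    obtain ⟨m1, m2⟩ := momentum_eq (κ := κ) (α := α) (p₁ := jet 1 w.1) (p₂ := jet 2 w.1)
      (q₀ := jet 0 w.2) (q₁ := jet 1 w.2) (q₂ := jet 2 w.2) hD hk ht hs h
      (ζ : AddCircle (2 * Real.pi))
    have r1 := congrArg Prod.fst hres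
    have r2 := congrArg Prod.snd hres
    simp only [residual, Prod.fst_zero, Prod.snd_zero] at r1 r2
    rw [smooth₁_top, add_right_comm] at r1
    rw [smooth₂_top, add_right_comm] at r2
    rw [eq_neg_of_add_eq_zero_left r1, eq_neg_of_add_eq_zero_left r2] at m1 m2
    refine ⟨(elev_thickness hD h _).2, ?_, ?_, ?_⟩
    · rw [u1, η1, u2, u4]
      simp only [profile]
      simp only [velX, velY, ContinuousMap.smul_apply, ContinuousMap.sub_apply,
        ContinuousMap.neg_apply, ContinuousMap.add_apply, smul_eq_mul] at m1 ⊢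
      linear_combination m1
    · rw [v1, η1, v2, v4]
      simp only [profile]
      simp only [velX, velY, ContinuousMap.smul_apply, ContinuousMap.sub_apply,
        ContinuousMap.neg_apply, ContinuousMap.add_apply, smul_eq_mul] at m2 ⊢
      linear_combination m2
    · rw [u1, v1, η1]
      exact mass_eq hD hk hs h _

end IsoData
end ShallowWater
end

noncomputable section
namespace ShallowWater
open PerC

/-! ### Profiles of waves solve the reduced equations -/

theorem IsPerSobolevSucc.exists_perC {m : ℕ} {w : ℝ → ℝ} (h : IsPerSobolevSucc m w) :
    ∃ F : ℕ → PerC, (∀ j ≤ m, ∀ x : ℝ, F j (x : AddCircle (2 * Real.pi)) = iteratedDeriv j w x) ∧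
      ∀ j < m, IsDeriv (F j) (F (j + 1)) := by
  obtain ⟨hc, hd⟩ := contDiff_nat_iff_iteratedDeriv.mp h.2.1
  have hF : ∀ j : ℕ, ∃ F : PerC, j ≤ m →
      ∀ x : ℝ, F (x : AddCircle (2 * Real.pi)) = iteratedDeriv j w x := by
    intro j
    by_cases hj : j ≤ m
    · exact ⟨ofPeriodic _ (hc j hj) (periodic_iteratedDeriv h.1 j), fun _ _ => rfl⟩
    · exact ⟨0, fun h => absurd h hj⟩
  choose F hF using hF
  refine ⟨F, hF, fun j hj x => ?_⟩
  rw [hF (j + 1) hj, iteratedDeriv_succ, funext (hF j hj.le)]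
  exact (hd j hj x).hasDerivAt

theorem PerC.IsDeriv.absolutelyContinuousOnInterval {f f' : PerC} (h : IsDeriv f f') (a b : ℝ) :
    AbsolutelyContinuousOnInterval (fun x : ℝ => f (x : AddCircle (2 * Real.pi))) a b := by
  refine ContDiffOn.absolutelyContinuousOnInterval (ContDiff.contDiffOn ?_)
  rw [contDiff_one_iff_deriv, funext fun x => (h x).deriv]
  exact ⟨fun x => (h x).differentiableAt, continuous_coe _⟩

namespace IsoData
variable {D : IsoData}

theorem vel_rotate (hD : D.Pos) {k₁ k₂ : ℝ} (hk : k₁ ^ 2 + k₂ ^ 2 = D.kc ^ 2) (u v : PerC) :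
    D.velX k₁ k₂ 1 ((1 / D.kc) • (k₁ • u + k₂ • v)) ((1 / D.kc) • (k₁ • v - k₂ • u)) = u ∧
    D.velY k₁ k₂ 1 ((1 / D.kc) • (k₁ • u + k₂ • v)) ((1 / D.kc) • (k₁ • v - k₂ • u)) = v := by
  have hkc := hD.kc_pos
  constructor <;> refine ContinuousMap.ext fun x => ?_ <;>
    simp only [velX, velY, ContinuousMap.smul_apply, ContinuousMap.sub_apply,
      ContinuousMap.add_apply, smul_eq_mul] <;> field_simp
  · linear_combination u x * hk
  · linear_combination v x * hk

theorem rotate_vel (hD : D.Pos) {k₁ k₂ : ℝ} (hk : k₁ ^ 2 + k₂ ^ 2 = D.kc ^ 2) (p q : PerC) :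
    (1 / D.kc) • (k₁ • D.velX k₁ k₂ 1 p q + k₂ • D.velY k₁ k₂ 1 p q) = p ∧
    (1 / D.kc) • (k₁ • D.velY k₁ k₂ 1 p q - k₂ • D.velX k₁ k₂ 1 p q) = q := by
  have hkc := hD.kc_pos
  constructor <;> refine ContinuousMap.ext fun x => ?_ <;>
    simp only [velX, velY, ContinuousMap.smul_apply, ContinuousMap.sub_apply,
      ContinuousMap.add_apply, smul_eq_mul] <;> field_simp
  · linear_combination p x * hk
  · linear_combination q x * hk

/-- The conservation of mass determines the surface deviation. -/
theorem eq_elev_of_mass (hD : D.Pos) {k₁ k₂ κ s : ℝ} (hk : k₁ ^ 2 + k₂ ^ 2 = D.kc ^ 2)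
    (hκ : -1 < κ) (hs : s < D.ωc) {η : ℝ → ℝ} (hη : IsPerSobolevSucc 0 η)
    (hmean : ∫ ξ in (0 : ℝ)..(2 * Real.pi), η ξ = 0) {p₀ p₁ q₀ q₁ : PerC} (hp : IsDeriv p₀ p₁)
    (hthin : ∀ x, 0 < D.thin 1 s p₀ x)
    (hmass : ∀ᵐ ζ : ℝ, (1 + κ) * (k₁ * D.velX k₁ k₂ 1 p₀ q₀ (ζ : AddCircle (2 * Real.pi))
        + k₂ * D.velY k₁ k₂ 1 p₀ q₀ (ζ : AddCircle (2 * Real.pi)) - (D.ωc - s)) * deriv η ζ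
      = -(D.H₀ + η ζ) * ((1 + κ) * (k₁ * D.velX k₁ k₂ 1 p₁ q₁ (ζ : AddCircle (2 * Real.pi))
        + k₂ * D.velY k₁ k₂ 1 p₁ q₁ (ζ : AddCircle (2 * Real.pi))))) (ζ : ℝ) :
    η ζ = D.elev 1 s p₀ (ζ : AddCircle (2 * Real.pi)) := by
  have hs' : 0 < D.ωc - s := sub_pos.mpr hs
  have hm := thickAvg_pos hthin
  obtain ⟨hper, hC, hac, -⟩ := hη
  rw [iteratedDeriv_zero] at hac
  have hthinD : IsDeriv (D.thin 1 s p₀) (-((1 * D.slowness s) • p₁)) := fun x =>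
    ((hp x).const_mul (1 * D.slowness s)).const_sub 1
  have hacT := hthinD.absolutelyContinuousOnInterval 0 (2 * Real.pi)
  have hacη : AbsolutelyContinuousOnInterval (fun x => D.H₀ + η x) 0 (2 * Real.pi) :=
    (ContDiffOn.absolutelyContinuousOnInterval contDiffOn_const).add hac
  -- the flux of mass relative to the wave, up to a factor
  set F : ℝ → ℝ := fun x => (D.H₀ + η x) * D.thin 1 s p₀ (x : AddCircle (2 * Real.pi)) with hF
  have hacF : AbsolutelyContinuousOnInterval F 0 (2 * Real.pi) := hacη.mul hacT
  have hFper : Function.Periodic F (2 * Real.pi) := fun x => by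
    simp only [hF]
    rw [hper x]
    congr 1
    exact periodic_coe _ x
  have hdF : ∀ x : ℝ, HasDerivAt F 0 x := by
    refine hasDerivAt_of_ae_deriv_eq (g := 0) hFper hacF ?_
    filter_upwards [hmass, hac.boundedVariationOn.ae_differentiableAt_of_mem_uIcc]
      with x hx hd hmem
    have h1 := ((hd hmem).hasDerivAt.const_add D.H₀).mul (hthinD x)
    have h2 : deriv F x = _ := h1.deriv
    rw [h2, (advection_eq hD hk hs _).2, (advection_eq (κ := κ) hD hk hs _).1] at *
    simp only [ContinuousMap.neg_apply, ContinuousMap.smul_apply, smul_eq_mul,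
      ContinuousMap.zero_apply, slowness]
    have hκ' : (1 + κ) ≠ 0 := by linarith
    have h3 : (D.ωc - s) * D.thin 1 s p₀ (x : AddCircle (2 * Real.pi)) * deriv η x
        = (D.H₀ + η x) * (D.kc * p₁ (x : AddCircle (2 * Real.pi))) := by
      apply mul_left_cancel₀ hκ'
      linear_combination -hx
    field_simp
    linear_combination h3
  have hconst : ∀ x : ℝ, F x = F 0 := fun x =>
    is_const_of_deriv_eq_zero (fun y => (hdF y).differentiableAt) (fun y => (hdF y).deriv) x 0
  -- the constant is determined by the mean of the surface deviation
  have hform : ∀ x : ℝ, η x = F 0 * D.thick 1 s p₀ (x : AddCircle (2 * Real.pi)) - D.H₀ := by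
    intro x
    have hx := (hthin (x : AddCircle (2 * Real.pi))).ne'
    rw [← hconst x, thick_apply hthin, hF]
    field_simp
    ring
  have hc : F 0 * D.thickAvg 1 s p₀ = D.H₀ := by
    have h1 : avg (F 0 • D.thick 1 s p₀ - D.H₀ • (1 : PerC)) = 0 := by
      rw [avg_eq_of_coe (g := η) fun x => by rw [hform]; simp, hmean, mul_zero]
    rw [map_sub, map_smul, map_smul, avg_one, smul_eq_mul, smul_eq_mul, mul_one] at h1
    exact sub_eq_zero.mp h1
  rw [hform, elev]
  simp only [ContinuousMap.smul_apply, ContinuousMap.sub_apply, ContinuousMap.one_apply,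
    smul_eq_mul]
  rw [← hc]
  field_simp

/-- The profile of a wave has enough regularity to solve the reduced equations: the conservation of
mass makes the surface deviation a smooth function of the velocity, and the momentum equations then
show that the fourth derivatives of the velocity are continuous. -/
theorem exists_eq_profile (hD : D.Pos) {k₁ k₂ κ α s : ℝ} (hk : k₁ ^ 2 + k₂ ^ 2 = D.kc ^ 2)
    (hκ : -1 < κ) (hs : s < D.ωc) {U : Profile} (hU : D.IsWave k₁ k₂ α s κ U)
    (hsmall : ∀ ζ, D.slowness s * ((k₁ * U.u ζ + k₂ * U.v ζ) / D.kc) < 1) :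
    ∃ w : PerC2, D.residual 1 κ α s w = 0 ∧ U = D.profile k₁ k₂ 1 s w ∧
      ∀ x, 0 < D.thin 1 s (jet 0 w.1) x := by
  obtain ⟨⟨hu, hv, hη⟩, hmean, hsol⟩ := hU
  have hkc := hD.kc_pos
  have hd := hD.d
  have hae : ∀ᵐ ζ : ℝ, D.ProfileEq k₁ k₂ α s κ U ζ := by
    refine ae_of_ae_phase (ℓ₁ := (1 + κ) * k₁) (ℓ₂ := (1 + κ) * k₂)
      (ω := (1 + κ) * (D.ωc - s)) ?_ (hsol.mono fun z hz => ?_)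
    · exact mul_ne_zero (by linarith) (sub_pos.mpr hs).ne'
    · exact (solvesAt_travel_iff hk α s κ U _ _ _).mp hz
  -- `p j`, `q j`: the derivatives of the velocity components along and across the wave vector
  obtain ⟨F, hF, hF'⟩ := hu.exists_perC
  obtain ⟨G, hG, hG'⟩ := hv.exists_perC
  set p : ℕ → PerC := fun j => (1 / D.kc) • (k₁ • F j + k₂ • G j) with hp
  set q : ℕ → PerC := fun j => (1 / D.kc) • (k₁ • G j - k₂ • F j) with hq
  have hpd : ∀ j < 3, IsDeriv (p j) (p (j + 1)) := fun j hj =>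
    (((hF' j hj).smul k₁).add ((hG' j hj).smul k₂)).smul _
  have hqd : ∀ j < 3, IsDeriv (q j) (q (j + 1)) := fun j hj =>
    (((hG' j hj).smul k₁).sub ((hF' j hj).smul k₂)).smul _
  have hX : ∀ j, D.velX k₁ k₂ 1 (p j) (q j) = F j := fun j => (vel_rotate hD hk _ _).1
  have hY : ∀ j, D.velY k₁ k₂ 1 (p j) (q j) = G j := fun j => (vel_rotate hD hk _ _).2
  have hF0 : ∀ x : ℝ, F 0 (x : AddCircle (2 * Real.pi)) = U.u x := fun x => by
    rw [hF 0 (by norm_num), iteratedDeriv_zero]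
  have hG0 : ∀ x : ℝ, G 0 (x : AddCircle (2 * Real.pi)) = U.v x := fun x => by
    rw [hG 0 (by norm_num), iteratedDeriv_zero]
  have hF1 : ∀ x : ℝ, F 1 (x : AddCircle (2 * Real.pi)) = deriv U.u x := fun x => by
    rw [hF 1 (by norm_num), iteratedDeriv_one]
  have hG1 : ∀ x : ℝ, G 1 (x : AddCircle (2 * Real.pi)) = deriv U.v x := fun x => by
    rw [hG 1 (by norm_num), iteratedDeriv_one]
  have hthin : ∀ x, 0 < D.thin 1 s (p 0) x := by
    intro y
    obtain ⟨x, rfl⟩ := QuotientAddGroup.mk_surjective y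
    have h1 := hsmall x
    rw [thin_apply, one_mul, sub_pos]
    refine lt_of_eq_of_lt ?_ h1
    change D.slowness s * (1 / D.kc * (k₁ * F 0 (x : AddCircle (2 * Real.pi))
      + k₂ * G 0 (x : AddCircle (2 * Real.pi)))) = _
    rw [hF0, hG0]
    ring
  have helev : ∀ x : ℝ, U.η x = D.elev 1 s (p 0) (x : AddCircle (2 * Real.pi)) := by
    refine eq_elev_of_mass hD hk hκ hs hη hmean (q₀ := q 0) (q₁ := q 1) (hpd 0 (by norm_num))
      hthin (hae.mono fun x hx => ?_)
    rw [hX, hY, hX, hY, hF0, hG0, hF1, hG1]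
    exact hx.mass
  have hη1 : ∀ x : ℝ, deriv U.η x = D.elevDeriv 1 s (p 0) (p 1) (x : AddCircle (2 * Real.pi)) := by
    intro x
    rw [funext helev]
    exact (isDeriv_elev hthin (hpd 0 (by norm_num)) x).deriv
  set c := D.d * (D.kc * (1 + κ)) ^ 4 with hc
  have hc0 : 0 < c := by
    have : 0 < 1 + κ := by linarith
    positivity
  set S₁ := D.smooth₁ 1 κ α s (p 0) (p 1) (p 2) 0 (q 0) + (1 : ℝ) • D.drag 1 s (p 0) (q 0) (p 0)
    with hS₁
  set S₂ := D.smooth₂ 1 κ α s (p 0) (q 0) (q 1) (q 2) 0 + (1 : ℝ) • D.drag 1 s (p 0) (q 0) (q 0)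
    with hS₂
  set p₄ := (-c⁻¹) • S₁ with hp₄
  set q₄ := (-c⁻¹) • S₂ with hq₄
  -- almost everywhere, the fourth derivatives are given by the lower order terms
  have htop : ∀ᵐ x : ℝ, deriv (iteratedDeriv 3 U.u) x
        = D.velX k₁ k₂ 1 p₄ q₄ (x : AddCircle (2 * Real.pi)) ∧
      deriv (iteratedDeriv 3 U.v) x = D.velY k₁ k₂ 1 p₄ q₄ (x : AddCircle (2 * Real.pi)) := by
    refine hae.mono fun x hx => ?_
    obtain ⟨m1, m2⟩ := momentum_eq (κ := κ) (α := α) (p₁ := p 1) (p₂ := p 2) (q₀ := q 0)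
      (q₁ := q 1) (q₂ := q 2) hD hk zero_le_one hs hthin (x : AddCircle (2 * Real.pi))
    rw [← hS₁, ← hS₂] at m1 m2
    have h1 := hx.momentum_x
    have h2 := hx.momentum_y
    rw [← iteratedDeriv_succ, ← iteratedDeriv_succ]
    simp only [hX, hY, hF0, hG0, hF1, hG1, hF 2 (by norm_num), hG 2 (by norm_num), ← helev,
      ← hη1] at m1 m2
    have e1 : D.velX k₁ k₂ 1 p₄ q₄ (x : AddCircle (2 * Real.pi))
        = -c⁻¹ * D.velX k₁ k₂ 1 S₁ S₂ (x : AddCircle (2 * Real.pi)) := by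
      simp only [velX, hp₄, hq₄, ContinuousMap.smul_apply, ContinuousMap.sub_apply, smul_eq_mul]
      ring
    have e2 : D.velY k₁ k₂ 1 p₄ q₄ (x : AddCircle (2 * Real.pi))
        = -c⁻¹ * D.velY k₁ k₂ 1 S₁ S₂ (x : AddCircle (2 * Real.pi)) := by
      simp only [velY, hp₄, hq₄, ContinuousMap.smul_apply, ContinuousMap.add_apply, smul_eq_mul]
      ring
    have h3 : c * iteratedDeriv 4 U.u x
        = -D.velX k₁ k₂ 1 S₁ S₂ (x : AddCircle (2 * Real.pi)) := by
      rw [← m1, hc]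
      linear_combination h1
    have h4 : c * iteratedDeriv 4 U.v x
        = -D.velY k₁ k₂ 1 S₁ S₂ (x : AddCircle (2 * Real.pi)) := by
      rw [← m2, hc]
      linear_combination h2
    rw [e1, e2, neg_mul, neg_mul, ← mul_neg, ← mul_neg, ← h3, ← h4,
      inv_mul_cancel_left₀ hc0.ne', inv_mul_cancel_left₀ hc0.ne']
    exact ⟨rfl, rfl⟩
  have hFd : IsDeriv (F 3) (D.velX k₁ k₂ 1 p₄ q₄) := by
    intro x
    rw [funext (hF 3 le_rfl)]
    exact hasDerivAt_of_ae_deriv_eq (periodic_iteratedDeriv hu.1 3) hu.2.2.1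
      (htop.mono fun y hy _ => hy.1) x
  have hGd : IsDeriv (G 3) (D.velY k₁ k₂ 1 p₄ q₄) := by
    intro x
    rw [funext (hG 3 le_rfl)]
    exact hasDerivAt_of_ae_deriv_eq (periodic_iteratedDeriv hv.1 3) hv.2.2.1
      (htop.mono fun y hy _ => hy.2) x
  have hp3 : IsDeriv (p 3) p₄ := by
    have := ((hFd.smul k₁).add (hGd.smul k₂)).smul (1 / D.kc)
    rwa [(rotate_vel hD hk p₄ q₄).1] at this
  have hq3 : IsDeriv (q 3) q₄ := by
    have := ((hGd.smul k₁).sub (hFd.smul k₂)).smul (1 / D.kc)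
    rwa [(rotate_vel hD hk p₄ q₄).2] at this
  -- a function with four continuous derivatives is in the range of `(1 + ∂)⁻⁴`
  have hjets : ∀ {P₀ P₁ P₂ P₃ P₄ : PerC}, IsDeriv P₀ P₁ → IsDeriv P₁ P₂ → IsDeriv P₂ P₃ →
      IsDeriv P₃ P₄ → ∃ w : PerC, jet 0 w = P₀ ∧ jet 1 w = P₁ ∧ jet 2 w = P₂ ∧ jet 4 w = P₄ := by
    intro P₀ P₁ P₂ P₃ P₄ h0 h1 h2 h3
    set w := P₀ + (4 : ℝ) • P₁ + (6 : ℝ) • P₂ + (4 : ℝ) • P₃ + P₄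
    have j0 : jet 0 w = P₀ := exists_jet_eq h0 h1 h2 h3
    have j1 : jet 1 w = P₁ := by
      have := isDeriv_jet (j := 0) (by norm_num) w
      rw [j0] at this
      exact this.unique h0
    have j2 : jet 2 w = P₂ := by
      have := isDeriv_jet (j := 1) (by norm_num) w
      rw [j1] at this
      exact this.unique h1
    have j3 : jet 3 w = P₃ := by
      have := isDeriv_jet (j := 2) (by norm_num) w
      rw [j2] at this
      exact this.unique h2
    have j4 : jet 4 w = P₄ := by
      have := isDeriv_jet (j := 3) (by norm_num) w
      rw [j3] at this
      exact this.unique h3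
    exact ⟨w, j0, j1, j2, j4⟩
  obtain ⟨w₁, a0, a1, a2, a4⟩ : ∃ w : PerC, jet 0 w = p 0 ∧ jet 1 w = p 1 ∧ jet 2 w = p 2 ∧
      jet 4 w = p₄ :=
    hjets (hpd 0 (by norm_num)) (hpd 1 (by norm_num)) (hpd 2 (by norm_num)) hp3
  obtain ⟨w₂, b0, b1, b2, b4⟩ : ∃ w : PerC, jet 0 w = q 0 ∧ jet 1 w = q 1 ∧ jet 2 w = q 2 ∧
      jet 4 w = q₄ :=
    hjets (hqd 0 (by norm_num)) (hqd 1 (by norm_num)) (hqd 2 (by norm_num)) hq3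
  have hcancel : ∀ S : PerC, S + c • (-c⁻¹) • S = 0 := fun S => by
    rw [smul_smul, mul_neg, mul_inv_cancel₀ hc0.ne', neg_smul, one_smul, add_neg_cancel]
  refine ⟨(w₁, w₂), Prod.ext ?_ ?_, Profile.ext (funext fun x => ?_) (funext fun x => ?_)
    (funext fun x => ?_), ?_⟩
  · simp only [residual, a0, a1, a2, a4, b0]
    rw [smooth₁_top, add_right_comm, ← hS₁, hp₄, ← hc, hcancel]
    rfl
  · simp only [residual, a0, b0, b1, b2, b4]
    rw [smooth₂_top, add_right_comm, ← hS₂, hq₄, ← hc, hcancel]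
    rfl
  · change U.u x = D.velX k₁ k₂ 1 (jet 0 w₁) (jet 0 w₂) (x : AddCircle (2 * Real.pi))
    rw [a0, b0, hX, hF0]
  · change U.v x = D.velY k₁ k₂ 1 (jet 0 w₁) (jet 0 w₂) (x : AddCircle (2 * Real.pi))
    rw [a0, b0, hY, hG0]
  · change U.η x = D.elev 1 s (jet 0 w₁) (x : AddCircle (2 * Real.pi))
    rw [a0, helev]
  · rw [a0]
    exact hthin

end IsoData
end ShallowWater
end

noncomputable section
namespace ShallowWater
open PerC

/-! ### Symmetries of the reduced equations -/

theorem PerC.jet_shift (θ : ℝ) (w : PerC) {j : ℕ} (hj : j ≤ 4) :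
    jet j (shift θ w) = shift θ (jet j w) := by
  induction j with
  | zero => exact jet_zero_shift θ w
  | succ j ih =>
    have h := isDeriv_jet (j := j) (by omega) (shift θ w)
    rw [ih (by omega)] at h
    exact h.unique ((isDeriv_jet (by omega) w).shift θ)

theorem PerC.norm_shift_le (θ : ℝ) (f : PerC) : ‖shift θ f‖ ≤ ‖f‖ :=
  (norm_le_iff (norm_nonneg _)).mpr fun x => by
    rw [shift_coe]
    exact abs_apply_le f _

/-- A function is recovered from its jets. -/
theorem PerC.eq_sum_jet (w : PerC) :
    w = jet 0 w + (4 : ℝ) • jet 1 w + (6 : ℝ) • jet 2 w + (4 : ℝ) • jet 3 w + jet 4 w := by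
  rw [← sub_eq_zero]
  refine eq_zero_of_jet_zero_eq_zero ?_
  rw [map_sub, exists_jet_eq (isDeriv_jet (by norm_num) w) (isDeriv_jet (by norm_num) w)
    (isDeriv_jet (by norm_num) w) (isDeriv_jet (by norm_num) w), sub_self]

/-- Translation of pairs of periodic functions. -/
def shift2 (θ : ℝ) (w : PerC2) : PerC2 := (shift θ w.1, shift θ w.2)

theorem norm_shift2_le (θ : ℝ) (w : PerC2) : ‖shift2 θ w‖ ≤ ‖w‖ :=
  max_le_max (norm_shift_le θ w.1) (norm_shift_le θ w.2)

namespace IsoData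
variable {D : IsoData}

theorem thick_shift (θ : ℝ) {t s : ℝ} {p : PerC} (h : ∀ x, 0 < D.thin t s p x) :
    D.thick t s (shift θ p) = shift θ (D.thick t s p) ∧
      D.thickAvg t s (shift θ p) = D.thickAvg t s p := by
  have h1 : D.thick t s (shift θ p) = shift θ (D.thick t s p) := by
    have h' : ∀ x, 0 < D.thin t s (shift θ p) x := fun x => h (x + (θ : AddCircle _))
    refine ContinuousMap.ext fun x => ?_
    rw [thick_apply h']
    exact (thick_apply h (x + (θ : AddCircle _))).symm
  exact ⟨h1, by rw [thickAvg, h1, avg_shift]; rfl⟩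

theorem residual_shift (θ : ℝ) {t κ α s : ℝ} {w : PerC2}
    (h : ∀ x, 0 < D.thin t s (jet 0 w.1) x) :
    D.residual t κ α s (shift2 θ w) = shift2 θ (D.residual t κ α s w) := by
  have hj : ∀ (v : PerC), jet 0 (shift θ v) = shift θ (jet 0 v) ∧ jet 1 (shift θ v)
      = shift θ (jet 1 v) ∧ jet 2 (shift θ v) = shift θ (jet 2 v) ∧
      jet 4 (shift θ v) = shift θ (jet 4 v) := fun v =>
    ⟨jet_shift θ v (by norm_num), jet_shift θ v (by norm_num), jet_shift θ v (by norm_num),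
      jet_shift θ v (by norm_num)⟩
  obtain ⟨h1, h2⟩ := thick_shift θ h
  obtain ⟨p0, p1, p2, p4⟩ := hj w.1
  obtain ⟨q0, q1, q2, q4⟩ := hj w.2
  simp only [residual, shift2, p0, p1, p2, p4, q0, q1, q2, q4, smooth₁, smooth₂, drag, h1, h2]
  rfl

theorem profile_shift (k₁ k₂ θ : ℝ) {t s : ℝ} {w : PerC2}
    (h : ∀ x, 0 < D.thin t s (jet 0 w.1) x) :
    D.profile k₁ k₂ t s (shift2 θ w) = (D.profile k₁ k₂ t s w).shift θ := by
  obtain ⟨h1, h2⟩ := thick_shift θ h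
  have p0 := jet_shift θ w.1 (j := 0) (by norm_num)
  have q0 := jet_shift θ w.2 (j := 0) (by norm_num)
  have e1 : D.velX k₁ k₂ t (jet 0 (shift θ w.1)) (jet 0 (shift θ w.2))
      = shift θ (D.velX k₁ k₂ t (jet 0 w.1) (jet 0 w.2)) := by rw [p0, q0]; rfl
  have e2 : D.velY k₁ k₂ t (jet 0 (shift θ w.1)) (jet 0 (shift θ w.2))
      = shift θ (D.velY k₁ k₂ t (jet 0 w.1) (jet 0 w.2)) := by rw [p0, q0]; rfl
  have e3 : D.elev t s (jet 0 (shift θ w.1)) = shift θ (D.elev t s (jet 0 w.1)) := by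
    rw [p0, elev, h1, h2]
    rfl
  refine Profile.ext (funext fun x => ?_) (funext fun x => ?_) (funext fun x => ?_) <;>
    simp only [profile, shift2, e1, e2, e3, shift_coe, Profile.shift]

theorem thin_smul (t s : ℝ) (p : PerC) : D.thin 1 s (t • p) = D.thin t s p := by
  refine ContinuousMap.ext fun x => ?_
  rw [thin_apply, thin_apply, ContinuousMap.smul_apply, smul_eq_mul]
  ring

theorem thick_smul (t s : ℝ) (p : PerC) : D.thick 1 s (t • p) = D.thick t s p ∧
    D.thickAvg 1 s (t • p) = D.thickAvg t s p := by
  rw [thickAvg, thickAvg, thick, thick, thin_smul]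
  exact ⟨rfl, rfl⟩

theorem profile_smul (k₁ k₂ t s : ℝ) (w : PerC2) :
    D.profile k₁ k₂ 1 s (t • w) = D.profile k₁ k₂ t s w := by
  obtain ⟨h1, h2⟩ := thick_smul (D := D) t s (jet 0 w.1)
  refine Profile.ext (funext fun x => ?_) (funext fun x => ?_) (funext fun x => ?_)
  · simp only [profile, velX, Prod.smul_fst, Prod.smul_snd, map_smul, ContinuousMap.smul_apply,
      ContinuousMap.sub_apply, smul_eq_mul]
    ring
  · simp only [profile, velY, Prod.smul_fst, Prod.smul_snd, map_smul, ContinuousMap.smul_apply,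
      ContinuousMap.add_apply, smul_eq_mul]
    ring
  · simp only [profile, elev, Prod.smul_fst, map_smul, h1, h2]

/-- The velocity `t • w` in terms of the scaled unknown `w`: the velocity enters the layer thickness
through `t • w` only, and the drag is homogeneous of degree two. -/
theorem residual_smul {t : ℝ} (ht : 0 ≤ t) (κ α s : ℝ) (w : PerC2) :
    D.residual 1 κ α s (t • w) = t • D.residual t κ α s w := by
  obtain ⟨h1, h2⟩ := thick_smul (D := D) t s (jet 0 w.1)
  have h3 := thin_smul (D := D) t s (jet 0 w.1)
  have h4 : speed (t • jet 0 w.1) (t • jet 0 w.2) = t • speed (jet 0 w.1) (jet 0 w.2) := by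
    refine ContinuousMap.ext fun x => ?_
    simp only [speed_apply, ContinuousMap.smul_apply, smul_eq_mul]
    rw [mul_pow, mul_pow, ← mul_add, Real.sqrt_mul (by positivity), Real.sqrt_sq ht]
  refine Prod.ext (ContinuousMap.ext fun x => ?_) (ContinuousMap.ext fun x => ?_)
  · simp only [residual, Prod.smul_fst, Prod.smul_snd, map_smul, smooth₁, drag, h1, h2, h3, h4,
      ContinuousMap.smul_apply, ContinuousMap.add_apply, ContinuousMap.sub_apply,
      ContinuousMap.mul_apply, smul_eq_mul]
    ring
  · simp only [residual, Prod.smul_fst, Prod.smul_snd, map_smul, smooth₂, drag, h2, h3, h4,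
      ContinuousMap.smul_apply, ContinuousMap.add_apply,
      ContinuousMap.mul_apply, smul_eq_mul]
    ring

/-- Translation acts on the coordinates along the kernel by rotation. -/
theorem coord_shift2 (θ : ℝ) (w : PerC2) :
    D.coord₁ (shift2 θ w) = Real.cos θ * D.coord₁ w - Real.sin θ * D.coord₂ w ∧
    D.coord₂ (shift2 θ w) = Real.sin θ * D.coord₁ w + Real.cos θ * D.coord₂ w := by
  simp only [coord₁_apply, coord₂_apply, shift2, jet_zero_shift, coefC_shift, coefS_shift]
  constructor <;> ring

theorem exists_shift2_coord (D : IsoData) (w : PerC2) :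
    ∃ θ : ℝ, D.coord₁ (shift2 θ w) = √(D.coord₁ w ^ 2 + D.coord₂ w ^ 2) ∧
      D.coord₂ (shift2 θ w) = 0 := by
  set z : ℂ := ⟨D.coord₁ w, D.coord₂ w⟩ with hz
  have hn : ‖z‖ = √(D.coord₁ w ^ 2 + D.coord₂ w ^ 2) := by
    rw [Complex.norm_def, Complex.normSq_apply]
    congr 1
    simp only [hz]
    ring
  have h1 : ‖z‖ * Real.cos z.arg = D.coord₁ w := Complex.norm_mul_cos_arg z
  have h2 : ‖z‖ * Real.sin z.arg = D.coord₂ w := Complex.norm_mul_sin_arg z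
  refine ⟨-z.arg, ?_, ?_⟩
  · rw [(coord_shift2 _ _).1, Real.cos_neg, Real.sin_neg, ← h1, ← h2, h1, h2, ← hn, ← h1, ← h2]
    linear_combination ‖z‖ * Real.sin_sq_add_cos_sq z.arg
  · rw [(coord_shift2 _ _).2, Real.cos_neg, Real.sin_neg, ← h1, ← h2]
    ring

/-! ### Small waves are close to the kernel -/

/-- By the equation, a solution is small if the derivatives of the velocity up to order three are
small. -/
theorem exists_norm_lt_of_jet_lt (hD : D.Pos) {η : ℝ} (hη : 0 < η) : ∃ δ > 0, ∀ κ α s : ℝ,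
    ∀ w : PerC2, |κ| < δ → |α| < δ → |s| < δ →
      (∀ j ≤ 3, ‖jet j w.1‖ < δ ∧ ‖jet j w.2‖ < δ) → D.residual 1 κ α s w = 0 → ‖w‖ < η := by
  have hd := hD.d
  have hkc := hD.kc_pos
  -- the terms of order less than four, as a map of the parameters and the lower jets: it is
  -- continuous and vanishes at the origin
  set X := (ℝ × ℝ × ℝ) × (PerC × PerC × PerC) × (PerC × PerC × PerC)
  set S : X → PerC × PerC := fun x =>
    (D.smooth₁ 1 x.1.1 x.1.2.1 x.1.2.2 x.2.1.1 x.2.1.2.1 x.2.1.2.2 0 x.2.2.1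
        + (1 : ℝ) • D.drag 1 x.1.2.2 x.2.1.1 x.2.2.1 x.2.1.1,
      D.smooth₂ 1 x.1.1 x.1.2.1 x.1.2.2 x.2.1.1 x.2.2.1 x.2.2.2.1 x.2.2.2.2 0
        + (1 : ℝ) • D.drag 1 x.1.2.2 x.2.1.1 x.2.2.1 x.2.2.1) with hS
  have h10 : (1 : ℝ) • (0 : X).2.1.1 = 0 := smul_zero _
  have ct : ContDiffAt ℝ 0 (fun _ : X => (1 : ℝ)) 0 := contDiffAt_const
  have cκ : ContDiffAt ℝ 0 (fun x : X => x.1.1) 0 := by fun_prop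
  have cα : ContDiffAt ℝ 0 (fun x : X => x.1.2.1) 0 := by fun_prop
  have cs : ContDiffAt ℝ 0 (fun x : X => x.1.2.2) 0 := by fun_prop
  have cp0 : ContDiffAt ℝ 0 (fun x : X => x.2.1.1) 0 := by fun_prop
  have cp1 : ContDiffAt ℝ 0 (fun x : X => x.2.1.2.1) 0 := by fun_prop
  have cp2 : ContDiffAt ℝ 0 (fun x : X => x.2.1.2.2) 0 := by fun_prop
  have cq0 : ContDiffAt ℝ 0 (fun x : X => x.2.2.1) 0 := by fun_prop
  have cq1 : ContDiffAt ℝ 0 (fun x : X => x.2.2.2.1) 0 := by fun_prop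
  have cq2 : ContDiffAt ℝ 0 (fun x : X => x.2.2.2.2) 0 := by fun_prop
  have cz : ContDiffAt ℝ 0 (fun _ : X => (0 : PerC)) 0 := contDiffAt_const
  have c1 := (contDiffAt_smooth₁ hD ct cκ cα cs rfl cp0 cp1 cp2 cz cq0 h10).continuousAt
  have c2 := (contDiffAt_smooth₂ hD ct cκ cα cs rfl cp0 cq0 cq1 cq2 cz h10).continuousAt
  have cthin := (contDiffAt_thin hD ct cs rfl cp0).continuousAt
  have cavg := (contDiffAt_thickAvg hD ct cs rfl cp0 h10).continuousAt
  have cspeed : ContinuousAt (fun x : X => speed x.2.1.1 x.2.2.1) 0 := by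
    have hl : LipschitzWith 2 (fun x : PerC × PerC => speed x.1 x.2) :=
      LipschitzWith.of_dist_le_mul fun x y => by
        rw [dist_eq_norm, dist_eq_norm]
        have h1 := norm_fst_le (x - y)
        have h2 := norm_snd_le (x - y)
        refine (norm_speed_sub_le _ _ _ _).trans ?_
        change ‖(x - y).1‖ + ‖(x - y).2‖ ≤ 2 * ‖x - y‖
        linarith
    exact hl.continuous.continuousAt.comp (f := fun x : X => (x.2.1.1, x.2.2.1)) (by fun_prop)
  have cdrag : ∀ u : X → PerC, ContinuousAt u 0 →
      ContinuousAt (fun x : X => (1 : ℝ) • D.drag 1 x.1.2.2 x.2.1.1 x.2.2.1 (u x)) 0 := fun u hu =>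
    ((continuousAt_const.mul cavg).smul (cspeed.mul (hu.mul cthin))).const_smul (1 : ℝ)
  have cS : ContinuousAt S 0 :=
    (c1.add (cdrag _ cp0.continuousAt)).prodMk (c2.add (cdrag _ cq0.continuousAt))
  have hS0 : S 0 = 0 := by
    simp only [hS, Prod.fst_zero, Prod.snd_zero, smooth₁, smooth₂, drag, smul_zero, mul_zero,
      zero_mul, add_zero, sub_zero, Prod.mk_zero_zero]
  -- a lower bound of the coefficient of the fourth derivatives, for `|κ| ≤ 1 / 2`
  set c := D.d * (D.kc / 2) ^ 4 with hc
  have hc0 : 0 < c := by positivity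
  obtain ⟨δ, hδ, hball⟩ := Metric.continuousAt_iff.mp cS (c * (η / 2)) (by positivity)
  refine ⟨min (min δ (1 / 2)) (η / 32), by positivity, fun κ α s w hκ hα hs hj hres => ?_⟩
  have hm1 : min (min δ (1 / 2)) (η / 32) ≤ δ := (min_le_left _ _).trans (min_le_left _ _)
  have hm2 : min (min δ (1 / 2)) (η / 32) ≤ 1 / 2 := (min_le_left _ _).trans (min_le_right _ _)
  have hm3 : min (min δ (1 / 2)) (η / 32) ≤ η / 32 := min_le_right _ _
  obtain ⟨p0, q0⟩ := hj 0 (by norm_num)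
  obtain ⟨p1, q1⟩ := hj 1 (by norm_num)
  obtain ⟨p2, q2⟩ := hj 2 (by norm_num)
  obtain ⟨p3, q3⟩ := hj 3 (by norm_num)
  set x : X := ((κ, α, s), (jet 0 w.1, jet 1 w.1, jet 2 w.1), (jet 0 w.2, jet 1 w.2, jet 2 w.2))
    with hx
  have hxn : dist x 0 < δ := by
    rw [dist_zero_right]
    refine max_lt (max_lt ?_ (max_lt ?_ ?_)) (max_lt (max_lt ?_ (max_lt ?_ ?_))
      (max_lt ?_ (max_lt ?_ ?_))) <;> simp only [hx, Real.norm_eq_abs] <;> linarith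
  have hSx := hball hxn
  rw [hS0, dist_zero_right] at hSx
  have hcK : c ≤ D.d * (D.kc * (1 + κ)) ^ 4 := by
    have : 1 / 2 ≤ 1 + κ := by linarith [neg_abs_le κ]
    rw [hc]
    gcongr
    nlinarith
  have r1 := congrArg Prod.fst hres
  have r2 := congrArg Prod.snd hres
  simp only [residual, Prod.fst_zero, Prod.snd_zero] at r1 r2
  rw [smooth₁_top, add_right_comm] at r1
  rw [smooth₂_top, add_right_comm] at r2
  have key : ∀ s₀ p₄ : PerC, s₀ + (D.d * (D.kc * (1 + κ)) ^ 4) • p₄ = 0 → ‖s₀‖ < c * (η / 2) →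
      ‖p₄‖ < η / 2 := by
    intro s₀ p₄ h0 hs
    have h1 : s₀ = -((D.d * (D.kc * (1 + κ)) ^ 4) • p₄) := eq_neg_of_add_eq_zero_left h0
    rw [h1, norm_neg, norm_smul, Real.norm_eq_abs, abs_of_pos (hc0.trans_le hcK)] at hs
    have h2 : c * ‖p₄‖ < c * (η / 2) :=
      (mul_le_mul_of_nonneg_right hcK (norm_nonneg _)).trans_lt hs
    exact lt_of_mul_lt_mul_left h2 hc0.le
  have p4 := key _ _ r1 ((norm_fst_le (S x)).trans_lt hSx)
  have q4 := key _ _ r2 ((norm_snd_le (S x)).trans_lt hSx)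
  -- `(1 + ∂)⁴` has the binomial coefficients `1, 4, 6, 4, 1`, and `15 / 32 < 1 / 2`
  have hsum : ∀ v : PerC, ‖jet 0 v‖ < η / 32 → ‖jet 1 v‖ < η / 32 → ‖jet 2 v‖ < η / 32 →
      ‖jet 3 v‖ < η / 32 → ‖jet 4 v‖ < η / 2 → ‖v‖ < η := by
    intro v h0 h1 h2 h3 h4
    have e := eq_sum_jet v
    have n1 : ‖(4 : ℝ) • jet 1 v‖ = 4 * ‖jet 1 v‖ := by rw [norm_smul]; norm_num
    have n2 : ‖(6 : ℝ) • jet 2 v‖ = 6 * ‖jet 2 v‖ := by rw [norm_smul]; norm_num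
    have n3 : ‖(4 : ℝ) • jet 3 v‖ = 4 * ‖jet 3 v‖ := by rw [norm_smul]; norm_num
    calc ‖v‖ = ‖jet 0 v + (4 : ℝ) • jet 1 v + (6 : ℝ) • jet 2 v + (4 : ℝ) • jet 3 v + jet 4 v‖ := by
          rw [← e]
      _ ≤ ‖jet 0 v‖ + ‖(4 : ℝ) • jet 1 v‖ + ‖(6 : ℝ) • jet 2 v‖ + ‖(4 : ℝ) • jet 3 v‖
          + ‖jet 4 v‖ := norm_add₄_le.trans (le_refl _) |> fun h => (norm_add_le _ _).trans
            (add_le_add_left h _)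
      _ < η := by rw [n1, n2, n3]; linarith
  exact max_lt (hsum _ (p0.trans_le hm3) (p1.trans_le hm3) (p2.trans_le hm3) (p3.trans_le hm3) p4)
    (hsum _ (q0.trans_le hm3) (q1.trans_le hm3) (q2.trans_le hm3) (q3.trans_le hm3) q4)

/-- A small solution is close to its projection to the kernel, relative to its size. The scaling of
the velocity by `r` brings the solution into the domain of the quadratic approximation at the
origin, where the residual vanishes for all parameters. -/
theorem exists_norm_sub_proj_le (hD : D.Pos) : ∃ C > 0, ∃ ρ > 0, ∀ r > 0, r ≤ ρ → ∀ κ α s : ℝ,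
    ∀ w : PerC2, |κ| ≤ r → |α| ≤ r → |s| ≤ r → ‖w‖ ≤ r ^ 2 → D.residual 1 κ α s w = 0 →
      ‖w - D.proj w‖ ≤ C * r * ‖D.proj w‖ := by
  obtain ⟨B, hB, hBle⟩ := exists_norm_le_bordered hD
  obtain ⟨L, ⟨C, hC, ρ, hρ, hquad⟩, hL, -⟩ := exists_quadApprox_residualMap hD 0
  refine ⟨2 * (B * C), by positivity, min ρ (1 / (2 * (B * C))), by positivity, ?_⟩
  intro r hr hrρ κ α s w hκ hα hs hw hres
  -- in terms of `w / r` the amplitude parameter is `r`, of the same order as the other parameters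
  set v := r⁻¹ • w with hv
  have hwv : w = r • v := by rw [hv, smul_smul, mul_inv_cancel₀ hr.ne', one_smul]
  have hres' : D.residual r κ α s v = 0 := by
    rw [hwv, residual_smul hr.le] at hres
    exact (smul_eq_zero.mp hres).resolve_left hr.ne'
  have hvn : ‖v‖ ≤ r := by
    rw [hv, norm_smul, norm_inv, Real.norm_eq_abs, abs_of_pos hr, inv_mul_le_iff₀ hr, ← sq]
    exact hw
  have hres0 : D.residual r κ α s 0 = 0 := by
    simp only [residual, Prod.fst_zero, Prod.snd_zero, map_zero, smooth₁, smooth₂, drag,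
      smul_zero, mul_zero, zero_mul, add_zero, sub_zero, Prod.mk_zero_zero]
  have hn : ∀ y : PerC2, ‖y‖ ≤ r → ‖((r, κ, α, s, y) : Full) - fullPt 0‖ ≤ r := by
    intro y hy
    simp only [fullPt, Prod.mk_sub_mk, sub_zero]
    refine max_le ?_ (max_le hκ (max_le hα (max_le hs hy)))
    rw [Real.norm_eq_abs, abs_of_pos hr]
  have hq := hquad r (hrρ.trans (min_le_left _ _)) (r, κ, α, s, v) (r, κ, α, s, 0) (hn v hvn)
    (hn 0 (by simpa using hr.le))
  simp only [residualMap, hres', hres0, sub_self, zero_sub, norm_neg, Prod.mk_sub_mk, sub_zero,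
    hL] at hq
  simp only [Prod.fst_zero, Prod.snd_zero, map_zero, smul_zero, add_zero, sub_zero,
    Prod.mk_zero_zero] at hq
  have hvn' : ‖((0, 0, 0, 0, v) : Full)‖ = ‖v‖ := by
    simp [Prod.norm_def]
  rw [hvn'] at hq
  have hlin : ‖D.lin w‖ ≤ C * r * ‖w‖ := by
    rw [hwv, map_smul, norm_smul, norm_smul]
    calc ‖r‖ * ‖D.lin v‖ ≤ ‖r‖ * (C * r * ‖v‖) := by gcongr
      _ = _ := by ring
  have hbor : D.bordered (w - D.proj w) = D.lin w := by
    rw [bordered_apply, map_sub D.coord₁, map_sub D.coord₂, (coord_proj hD w).1,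
      (coord_proj hD w).2, sub_self, sub_self, zero_smul, zero_smul, sub_zero, add_zero, map_sub,
      proj_apply, lin_kerElt hD, sub_zero]
  have h1 := hBle (w - D.proj w)
  rw [hbor] at h1
  have h2 : ‖w - D.proj w‖ ≤ (B * C) * r * ‖w‖ := by
    refine h1.trans ?_
    calc B * ‖D.lin w‖ ≤ B * (C * r * ‖w‖) := by gcongr
      _ = _ := by ring
  have h3 : ‖w‖ ≤ ‖w - D.proj w‖ + ‖D.proj w‖ := by
    simpa using norm_add_le (w - D.proj w) (D.proj w)
  have h4 : (B * C) * r ≤ 1 / 2 := by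
    have : r ≤ 1 / (2 * (B * C)) := hrρ.trans (min_le_right _ _)
    rw [le_div_iff₀ (by positivity)] at this
    linarith
  have h5 : (B * C) * r * ‖w‖ ≤ (B * C) * r * ‖D.proj w‖ + 1 / 2 * ‖w - D.proj w‖ := by
    have h6 : (B * C) * r * ‖w‖ ≤ (B * C) * r * (‖w - D.proj w‖ + ‖D.proj w‖) := by gcongr
    have h7 := mul_le_mul_of_nonneg_right h4 (norm_nonneg (w - D.proj w))
    linarith
  linarith

end IsoData
end ShallowWater
end

noncomputable section
namespace ShallowWater
open PerC
namespace IsoData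

/-! ### All small waves lie on the branch -/

/-- The critical eigenfunction, corrected by the component of `x` complementary to the kernel:
the wave with amplitude `t` on the branch is `t` times this, for a suitable `x`. -/
def branchElt (D : IsoData) (x : PerC2) : PerC2 := D.kerElt 1 0 + (x - D.proj x)

variable {D : IsoData}

theorem coord_branchElt (hD : D.Pos) (x : PerC2) :
    D.coord₁ (D.branchElt x) = 1 ∧ D.coord₂ (D.branchElt x) = 0 := by
  obtain ⟨h1, h2⟩ := coord_kerElt hD 1 0
  obtain ⟨h3, h4⟩ := coord_proj hD x
  rw [branchElt, map_add, map_add, map_sub, map_sub, h1, h2, h3, h4]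
  constructor <;> ring

theorem kerElt_smul (a : ℝ) : D.kerElt a 0 = a • D.kerElt 1 0 := by
  simp only [kerElt, one_smul, zero_smul, add_zero]
  exact smul_comm _ _ _

theorem norm_kerElt_le {x y r : ℝ} (hx : |x| ≤ r) (hy : |y| ≤ r) :
    ‖D.kerElt x y‖ ≤ 4 * (‖D.eig‖ + ‖D.eigDeriv‖) * r := by
  have h1 : ‖x • D.eig‖ ≤ r * ‖D.eig‖ := by
    rw [norm_smul, Real.norm_eq_abs]
    gcongr
  have h2 : ‖y • D.eigDeriv‖ ≤ r * ‖D.eigDeriv‖ := by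
    rw [norm_smul, Real.norm_eq_abs]
    gcongr
  have h3 : ‖x • D.eig + y • D.eigDeriv‖ ≤ r * ‖D.eig‖ + r * ‖D.eigDeriv‖ :=
    (norm_add_le _ _).trans (add_le_add h1 h2)
  rw [kerElt, norm_smul, norm_neg, Real.norm_of_nonneg (by norm_num)]
  linarith

/-- Every small wave is a translate of a wave on the branch. After a translation that makes the
second coordinate vanish, the wave can be divided by its first coordinate, which is its amplitude;
uniqueness in the implicit function theorem applies to the quotient. -/
theorem exists_classification (hD : D.Pos) {ρ ρ' : ℝ} (hρ : 0 < ρ) (hρ' : 0 < ρ')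
    {ψ : ℝ × ℝ → PerC2}
    (huniq : ∀ z x, ‖z‖ < ρ → ‖x‖ < ρ' → D.branchMap (z, x) = 0 → x = ψ z) :
    ∃ σ > 0, ∀ κ α s w, |κ| < σ → |α| < σ → |s| < σ → ‖w‖ < σ →
      (∀ x, 0 < D.thin 1 s (jet 0 w.1) x) → D.residual 1 κ α s w = 0 →
      ∃ a θ : ℝ, a = √(D.coord₁ w ^ 2 + D.coord₂ w ^ 2) ∧
        shift2 θ w = a • D.branchElt (ψ (a, κ)) ∧
        (0 < a → α = D.coord₁ (ψ (a, κ)) ∧ s = D.coord₂ (ψ (a, κ))) := by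
  obtain ⟨C, hC, ρ₁, hρ₁, hsub⟩ := exists_norm_sub_proj_le hD
  set E := 4 * (‖D.eig‖ + ‖D.eigDeriv‖) with hE
  have hE0 : 0 ≤ E := by positivity
  set n := ‖D.kerElt 1 0‖ with hn
  have hn0 : 0 ≤ n := norm_nonneg _
  set r := min ρ₁ (ρ' / (2 * (C * n + 1))) with hr
  have hr0 : 0 < r := lt_min hρ₁ (by positivity)
  set σ := min (min r (r ^ 2)) (min (ρ' / (2 * (E + 1))) (ρ / (‖D.coord₁‖ + 1))) with hσ
  have hσ0 : 0 < σ := lt_min (lt_min hr0 (by positivity)) (lt_min (by positivity) (by positivity))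
  have hσ1 : σ ≤ r := (min_le_left _ _).trans (min_le_left _ _)
  have hσ2 : σ ≤ r ^ 2 := (min_le_left _ _).trans (min_le_right _ _)
  have hσ3 : σ ≤ ρ' / (2 * (E + 1)) := (min_le_right _ _).trans (min_le_left _ _)
  have hσ4 : σ ≤ ρ / (‖D.coord₁‖ + 1) := (min_le_right _ _).trans (min_le_right _ _)
  refine ⟨σ, hσ0, fun κ α s w hκ hα hs hw hthin hres => ?_⟩
  obtain ⟨θ, hθ1, hθ2⟩ := exists_shift2_coord D w
  set w' := shift2 θ w with hw'
  set a := √(D.coord₁ w ^ 2 + D.coord₂ w ^ 2) with ha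
  have ha0 : 0 ≤ a := Real.sqrt_nonneg _
  have hres' : D.residual 1 κ α s w' = 0 := by
    rw [hw', residual_shift θ hthin, hres]
    rfl
  have hw'n : ‖w'‖ < σ := (norm_shift2_le θ w).trans_lt hw
  have hproj : D.proj w' = a • D.kerElt 1 0 := by rw [proj_apply, hθ1, hθ2, kerElt_smul]
  have hle := hsub r hr0 (min_le_left _ _) κ α s w' (hκ.le.trans hσ1) (hα.le.trans hσ1)
    (hs.le.trans hσ1) (hw'n.le.trans hσ2) hres'
  have hpn : ‖D.proj w'‖ = a * n := by rw [hproj, norm_smul, Real.norm_of_nonneg ha0]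
  rw [hpn] at hle
  refine ⟨a, θ, rfl, ?_⟩
  -- a solution without amplitude vanishes
  rcases ha0.eq_or_lt with h0 | h0
  · rw [← h0] at hle hproj ⊢
    rw [zero_smul] at hproj ⊢
    rw [hproj, sub_zero, zero_mul, mul_zero] at hle
    exact ⟨norm_le_zero_iff.mp hle, fun h => absurd h (lt_irrefl _)⟩
  -- the unknown of the branch equation, with coordinates `α` and `s` along the kernel
  set y := a⁻¹ • (w' - D.proj w') with hy
  set x := y + D.kerElt α s with hx
  have hcy : D.coord₁ y = 0 ∧ D.coord₂ y = 0 := by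
    obtain ⟨h3, h4⟩ := coord_proj hD w'
    rw [hy, map_smul, map_smul, map_sub, map_sub, h3, h4]
    simp
  have hcx : D.coord₁ x = α ∧ D.coord₂ x = s := by
    obtain ⟨h3, h4⟩ := coord_kerElt hD α s
    rw [hx, map_add, map_add, hcy.1, hcy.2, h3, h4, zero_add, zero_add]
    exact ⟨rfl, rfl⟩
  have hxp : x - D.proj x = y := by
    rw [proj_apply, hcx.1, hcx.2, hx, add_sub_cancel_right]
  have hel : a • D.branchElt x = w' := by
    rw [branchElt, hxp, smul_add, ← hproj, hy, smul_smul, mul_inv_cancel₀ h0.ne', one_smul]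
    abel
  have hzero : D.branchMap ((a, κ), x) = 0 := by
    have h5 := residual_smul (D := D) ha0 κ α s (D.branchElt x)
    rw [hel, hres'] at h5
    rw [branchMap_apply, hcx.1, hcx.2]
    exact (smul_eq_zero.mp h5.symm).resolve_left h0.ne'
  have hyn : ‖y‖ ≤ C * n * r := by
    rw [hy, norm_smul, norm_inv, Real.norm_of_nonneg ha0, inv_mul_le_iff₀ h0]
    linarith
  have hrn : C * n * r < ρ' / 2 := by
    have h6 : r * (2 * (C * n + 1)) ≤ ρ' := by
      rw [← le_div_iff₀ (by positivity)]
      exact min_le_right _ _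
    linarith
  have hkn : ‖D.kerElt α s‖ < ρ' / 2 := by
    have h6 : σ * (2 * (E + 1)) ≤ ρ' := by
      rw [← le_div_iff₀ (by positivity)]
      exact hσ3
    have := norm_kerElt_le (D := D) hα.le hs.le
    linarith
  have hxn : ‖x‖ < ρ' := by
    have := norm_add_le y (D.kerElt α s)
    linarith
  have han : a < ρ := by
    have h6 : σ * (‖D.coord₁‖ + 1) ≤ ρ := by
      rw [← le_div_iff₀ (by positivity)]
      exact hσ4
    have h7 : a ≤ ‖D.coord₁‖ * ‖w'‖ := by
      rw [← hθ1]
      exact (le_abs_self _).trans (D.coord₁.le_opNorm w')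
    have h8 : ‖D.coord₁‖ * ‖w'‖ ≤ ‖D.coord₁‖ * σ := by gcongr
    linarith
  have hσρ : σ ≤ ρ := hσ4.trans (div_le_self hρ.le (by linarith [norm_nonneg D.coord₁]))
  have hzn : ‖((a, κ) : ℝ × ℝ)‖ < ρ := by
    rw [Prod.norm_def, Real.norm_of_nonneg ha0, Real.norm_eq_abs]
    exact max_lt han (hκ.trans_le hσρ)
  have hψ := huniq (a, κ) x hzn hxn hzero
  rw [← hψ, hcx.1, hcx.2]
  exact ⟨hel.symm, fun _ => ⟨rfl, rfl⟩⟩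

end IsoData
end ShallowWater
end

noncomputable section
namespace ShallowWater
open PerC

theorem PerC.exists_norm_jet_le : ∃ J > 0, ∀ j ≤ 4, ∀ w : PerC2,
    ‖jet j w.1‖ ≤ J * ‖w‖ ∧ ‖jet j w.2‖ ≤ J * ‖w‖ := by
  refine ⟨∑ j ∈ Finset.range 5, ‖jet j‖ + 1, by positivity, fun j hj w => ?_⟩
  have h1 : ‖jet j‖ ≤ ∑ j ∈ Finset.range 5, ‖jet j‖ + 1 := by
    have := Finset.single_le_sum (f := fun j => ‖jet j‖) (fun i _ => (jet i).opNorm_nonneg)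
      (Finset.mem_range.mpr (show j < 5 by omega))
    linarith
  constructor
  · exact ((jet j).le_opNorm _).trans (mul_le_mul h1 (norm_fst_le w) (norm_nonneg _) (by positivity))
  · exact ((jet j).le_opNorm _).trans (mul_le_mul h1 (norm_snd_le w) (norm_nonneg _) (by positivity))

namespace IsoData
variable {D : IsoData}

/-! ### The form of the waves -/

theorem slowness_pos_le (hD : D.Pos) {s : ℝ} (hs : |s| ≤ D.ωc / 2) :
    0 < D.slowness s ∧ D.slowness s ≤ 2 * D.kc / D.ωc := by
  have hω := hD.ωc_pos
  have hk := hD.kc_pos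
  have h1 : D.ωc / 2 ≤ D.ωc - s := by
    have := (abs_le.mp hs).2
    linarith
  have h2 : 0 < D.ωc - s := by linarith
  refine ⟨div_pos hk h2, ?_⟩
  rw [slowness, div_le_div_iff₀ h2 hω]
  nlinarith

theorem thin_pos (hD : D.Pos) {t s : ℝ} {p : PerC} (hs : |s| ≤ D.ωc / 2)
    (hp : |t| * ‖p‖ < D.ωc / (2 * D.kc)) (x : AddCircle (2 * Real.pi)) : 0 < D.thin t s p x := by
  obtain ⟨h1, h2⟩ := slowness_pos_le hD hs
  have hω := hD.ωc_pos
  have hk := hD.kc_pos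
  have h3 : t * p x ≤ |t| * ‖p‖ := by
    refine (le_abs_self _).trans ?_
    rw [abs_mul]
    gcongr
    exact ContinuousMap.norm_coe_le_norm p x
  have h4 : D.slowness s * (t * p x) < 1 := by
    rcases le_or_gt (t * p x) 0 with h0 | h0
    · have := mul_nonpos_of_nonneg_of_nonpos h1.le h0
      linarith
    · calc D.slowness s * (t * p x) ≤ (2 * D.kc / D.ωc) * (|t| * ‖p‖) := by gcongr
        _ < (2 * D.kc / D.ωc) * (D.ωc / (2 * D.kc)) := by gcongr
        _ = 1 := by field_simp
  rw [thin_apply]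
  linarith

variable (D)

/-- The surface deviation divided by `H₀ t`. -/
def elevQuot (t s : ℝ) (p : PerC) : PerC :=
  (D.slowness s / D.thickAvg t s p) • (p * D.thick t s p - avg (p * D.thick t s p) • 1)

/-- The derivative of the surface deviation divided by `H₀ t`. -/
def elevDerivQuot (t s : ℝ) (p p' : PerC) : PerC :=
  (D.slowness s / D.thickAvg t s p) • (p' * (D.thick t s p * D.thick t s p))

variable {D}

theorem elev_eq {t s : ℝ} {p : PerC} (h : ∀ x, 0 < D.thin t s p x) :
    D.elev t s p = (D.H₀ * t) • D.elevQuot t s p := by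
  have hm := thickAvg_pos h
  have h1 : D.thick t s p = 1 + (t * D.slowness s) • (p * D.thick t s p) := by
    refine ContinuousMap.ext fun x => ?_
    have hx := h x
    have e := thin_apply (D := D) t s p x
    simp only [ContinuousMap.add_apply, ContinuousMap.one_apply, ContinuousMap.smul_apply,
      ContinuousMap.mul_apply, thick_apply h, smul_eq_mul]
    field_simp
    rw [e]
    ring
  have h2 : D.thickAvg t s p = 1 + (t * D.slowness s) * avg (p * D.thick t s p) := by
    have := congrArg avg h1
    rwa [map_add, avg_one, map_smul, smul_eq_mul] at this
  refine ContinuousMap.ext fun x => ?_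
  have h3 := congrArg (fun F : PerC => F x) h1
  simp only [ContinuousMap.add_apply, ContinuousMap.one_apply, ContinuousMap.smul_apply,
    ContinuousMap.mul_apply, smul_eq_mul] at h3
  simp only [elev, elevQuot, ContinuousMap.sub_apply, ContinuousMap.one_apply,
    ContinuousMap.smul_apply, ContinuousMap.mul_apply, smul_eq_mul]
  have h4 : (D.thickAvg t s p)⁻¹ * D.thick t s p x - 1
      = (D.thick t s p x - D.thickAvg t s p) / D.thickAvg t s p := by
    field_simp
  rw [h4, show D.thick t s p x - D.thickAvg t s p = (t * D.slowness s) *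
    (p x * D.thick t s p x - avg (p * D.thick t s p)) by linear_combination h3 - h2]
  field_simp

theorem elevDeriv_eq (t s : ℝ) (p p' : PerC) :
    D.elevDeriv t s p p' = (D.H₀ * t) • D.elevDerivQuot t s p p' := by
  rw [elevDeriv, elevDerivQuot, smul_smul]
  congr 1
  ring

section Smoothness

variable {X : Type*} [NormedAddCommGroup X] [NormedSpace ℝ X] {x₀ : X} {n : WithTop ℕ∞}
  {t s : X → ℝ} {p p' : X → PerC}

theorem contDiffAt_elevQuot (hD : D.Pos) (ht : ContDiffAt ℝ n t x₀) (hs : ContDiffAt ℝ n s x₀)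
    (hs0 : s x₀ = 0) (hp : ContDiffAt ℝ n p x₀) (h1 : t x₀ • p x₀ = 0) :
    ContDiffAt ℝ n (fun x => D.elevQuot (t x) (s x) (p x)) x₀ := by
  have hthick := contDiffAt_thick hD ht hs hs0 hp h1
  have hne : D.thickAvg (t x₀) (s x₀) (p x₀) ≠ 0 := by
    rw [thickAvg_eq_one h1]; exact one_ne_zero
  have hq := (contDiffAt_slowness hD hs hs0).div (contDiffAt_thickAvg hD ht hs hs0 hp h1) hne
  have hm : ContDiffAt ℝ n (fun x => p x * D.thick (t x) (s x) (p x)) x₀ := hp.mul hthick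
  have ha : ContDiffAt ℝ n (fun x => avg (p x * D.thick (t x) (s x) (p x))) x₀ :=
    avg.contDiff.contDiffAt.comp x₀ hm
  exact hq.smul (hm.sub (ha.smul contDiffAt_const))

theorem contDiffAt_elevDerivQuot (hD : D.Pos) (ht : ContDiffAt ℝ n t x₀)
    (hs : ContDiffAt ℝ n s x₀) (hs0 : s x₀ = 0) (hp : ContDiffAt ℝ n p x₀)
    (hp' : ContDiffAt ℝ n p' x₀) (h1 : t x₀ • p x₀ = 0) :
    ContDiffAt ℝ n (fun x => D.elevDerivQuot (t x) (s x) (p x) (p' x)) x₀ := by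
  have hthick := contDiffAt_thick hD ht hs hs0 hp h1
  have hne : D.thickAvg (t x₀) (s x₀) (p x₀) ≠ 0 := by
    rw [thickAvg_eq_one h1]; exact one_ne_zero
  have hq := (contDiffAt_slowness hD hs hs0).div (contDiffAt_thickAvg hD ht hs hs0 hp h1) hne
  exact hq.smul (hp'.mul (hthick.mul hthick))

end Smoothness

/-- A map of class `C¹` near the origin is approximated by its value there, to first order. -/
theorem exists_norm_sub_le_of_contDiffAt {X Y : Type*} [NormedAddCommGroup X] [NormedSpace ℝ X]
    [NormedAddCommGroup Y] [NormedSpace ℝ Y] {F : X → Y} (hF : ContDiffAt ℝ 1 F 0) :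
    ∃ K > 0, ∃ ρ > 0, ∀ x, ‖x‖ < ρ → ‖F x - F 0‖ ≤ K * ‖x‖ := by
  obtain ⟨K, t, ht, hK⟩ := hF.exists_lipschitzOnWith
  obtain ⟨ρ, hρ, hball⟩ := Metric.mem_nhds_iff.mp ht
  refine ⟨K + 1, by positivity, ρ, hρ, fun x hx => ?_⟩
  have h1 := hK.dist_le_mul x (hball (mem_ball_zero_iff.mpr hx)) 0
    (hball (Metric.mem_ball_self hρ))
  rw [dist_eq_norm, dist_eq_norm, sub_zero] at h1
  linarith [norm_nonneg x]

theorem branchElt_zero (D : IsoData) : D.branchElt 0 = D.kerElt 1 0 := by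
  rw [branchElt, map_zero, sub_zero, add_zero]

/-- On the branch, the surface deviation and its derivative have the asserted leading order. -/
theorem exists_elev_sub_le (hD : D.Pos) : ∃ K > 0, ∃ ρ > 0, ∀ (t : ℝ) (x : PerC2),
    ‖((t, x) : ℝ × PerC2)‖ < ρ →
    ‖D.elevQuot t (D.coord₂ x) (jet 0 (D.branchElt x).1) - (2 * D.kc ^ 2) • cosC‖
      ≤ K * ‖((t, x) : ℝ × PerC2)‖ ∧
    ‖D.elevDerivQuot t (D.coord₂ x) (jet 0 (D.branchElt x).1) (jet 1 (D.branchElt x).1)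
      - (2 * D.kc ^ 2) • -sinC‖ ≤ K * ‖((t, x) : ℝ × PerC2)‖ := by
  have hω := hD.ωc_pos
  obtain ⟨j0, j1, -⟩ := jet_kerElt (D := D) 1 0
  rw [one_smul, zero_smul, sub_zero cosC] at j0
  rw [zero_smul, sub_zero (-1 • sinC)] at j1
  have ht : ContDiffAt ℝ 1 (fun z : ℝ × PerC2 => z.1) 0 := contDiffAt_fst
  have hs : ContDiffAt ℝ 1 (fun z : ℝ × PerC2 => D.coord₂ z.2) 0 :=
    (D.coord₂ ∘L .snd ℝ ℝ PerC2).contDiff.contDiffAt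
  have hw : ContDiffAt ℝ 1 (fun z : ℝ × PerC2 => D.branchElt z.2) 0 :=
    contDiffAt_const.add (contDiffAt_snd.sub (D.proj ∘L .snd ℝ ℝ PerC2).contDiff.contDiffAt)
  have hp : ∀ j, ContDiffAt ℝ 1 (fun z : ℝ × PerC2 => jet j (D.branchElt z.2).1) 0 := fun j =>
    (jet j ∘L .fst ℝ PerC PerC).contDiff.contDiffAt.comp (0 : ℝ × PerC2) hw
  have hs0 : D.coord₂ (0 : ℝ × PerC2).2 = 0 := map_zero _
  have h1 : (0 : ℝ × PerC2).1 • jet 0 (D.branchElt (0 : ℝ × PerC2).2).1 = 0 := zero_smul ℝ _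
  obtain ⟨K, hK, ρ, hρ, hle⟩ := exists_norm_sub_le_of_contDiffAt
    (contDiffAt_elevQuot hD ht hs hs0 (hp 0) h1)
  obtain ⟨K', hK', ρ', hρ', hle'⟩ := exists_norm_sub_le_of_contDiffAt
    (contDiffAt_elevDerivQuot hD ht hs hs0 (hp 0) (hp 1) h1)
  have hsl : D.slowness 0 = D.kc / D.ωc := by rw [slowness, sub_zero D.ωc]
  have e0 : D.elevQuot 0 0 (jet 0 (D.kerElt 1 0).1) = (2 * D.kc ^ 2) • cosC := by
    rw [elevQuot, thick_eq_one (zero_smul ℝ _), thickAvg_eq_one (zero_smul ℝ _), j0, mul_one, hsl,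
      map_smul, avg_cos, smul_zero, zero_smul, sub_zero ((2 * D.kc * D.ωc) • cosC), smul_smul]
    congr 1
    field_simp
  have e1 : D.elevDerivQuot 0 0 (jet 0 (D.kerElt 1 0).1) (jet 1 (D.kerElt 1 0).1)
      = (2 * D.kc ^ 2) • -sinC := by
    rw [elevDerivQuot, thick_eq_one (zero_smul ℝ _), thickAvg_eq_one (zero_smul ℝ _), j1, mul_one,
      mul_one, hsl, neg_one_smul, smul_smul]
    congr 1
    field_simp
  refine ⟨max K K', lt_max_of_lt_left hK, min ρ ρ', lt_min hρ hρ', fun t x hx => ⟨?_, ?_⟩⟩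
  · have := hle (t, x) (hx.trans_le (min_le_left _ _))
    simp only [Prod.fst_zero, Prod.snd_zero, map_zero, branchElt_zero, e0] at this
    exact this.trans (mul_le_mul_of_nonneg_right (le_max_left _ _) (norm_nonneg _))
  · have := hle' (t, x) (hx.trans_le (min_le_right _ _))
    simp only [Prod.fst_zero, Prod.snd_zero, map_zero, branchElt_zero, e1] at this
    exact this.trans (mul_le_mul_of_nonneg_right (le_max_right _ _) (norm_nonneg _))

theorem abs_vel_le (hD : D.Pos) {k₁ k₂ t : ℝ} (hk : k₁ ^ 2 + k₂ ^ 2 = D.kc ^ 2) (ht : 0 ≤ t)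
    (p q : PerC) (x : ℝ) : |D.velX k₁ k₂ t p q x| ≤ t * (‖p‖ + ‖q‖) ∧
      |D.velY k₁ k₂ t p q x| ≤ t * (‖p‖ + ‖q‖) := by
  have hkc := hD.kc_pos
  have h1 : |k₁| ≤ D.kc := abs_le_of_sq_le_sq (by nlinarith) hkc.le
  have h2 : |k₂| ≤ D.kc := abs_le_of_sq_le_sq (by nlinarith) hkc.le
  have hp := abs_apply_le p x
  have hq := abs_apply_le q x
  have key : ∀ a b y z : ℝ, |a| ≤ D.kc → |b| ≤ D.kc → |y| ≤ ‖p‖ → |z| ≤ ‖q‖ →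
      |t / D.kc * (a * y + b * z)| ≤ t * (‖p‖ + ‖q‖) := by
    intro a b y z ha hb hy hz
    have h3 : |a * y + b * z| ≤ D.kc * ‖p‖ + D.kc * ‖q‖ := by
      refine (abs_add_le _ _).trans ?_
      rw [abs_mul, abs_mul]
      gcongr
    rw [abs_mul, abs_of_nonneg (by positivity)]
    calc _ ≤ t / D.kc * (D.kc * ‖p‖ + D.kc * ‖q‖) := by gcongr
      _ = _ := by field_simp
  constructor
  · have := key k₁ (-k₂) _ _ h1 (by rwa [abs_neg]) hp hq
    rwa [neg_mul, ← sub_eq_add_neg] at this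
  · exact key k₂ k₁ _ _ h2 h1 hp hq

theorem leading_vel (hD : D.Pos) (k₁ k₂ t : ℝ) (x : ℝ) :
    (D.leading k₁ k₂ t).u x = D.velX k₁ k₂ t (jet 0 (D.kerElt 1 0).1) (jet 0 (D.kerElt 1 0).2) x ∧
    (D.leading k₁ k₂ t).v x = D.velY k₁ k₂ t (jet 0 (D.kerElt 1 0).1) (jet 0 (D.kerElt 1 0).2) x := by
  have hkc := hD.kc_pos
  obtain ⟨p0, -, -, -, -, q0, -⟩ := jet_kerElt (D := D) 1 0
  rw [p0, q0]
  simp only [leading, velX, velY, ContinuousMap.smul_apply, ContinuousMap.sub_apply,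
    ContinuousMap.add_apply, cosC_coe, sinC_coe, smul_eq_mul]
  constructor <;> field_simp <;> ring

/-- The waves on the branch have the asserted leading order, with an error that is uniform in the
direction of the wave vector. -/
theorem exists_normX_sub_leading_le (hD : D.Pos) : ∃ C > 0, ∃ ρ > 0, ∀ (t : ℝ) (x : PerC2),
    0 ≤ t → ‖((t, x) : ℝ × PerC2)‖ < ρ →
    (∀ y, 0 < D.thin t (D.coord₂ x) (jet 0 (D.branchElt x).1) y) →
    ∀ k₁ k₂ θ : ℝ, k₁ ^ 2 + k₂ ^ 2 = D.kc ^ 2 →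
      ((D.profile k₁ k₂ t (D.coord₂ x) (D.branchElt x) - D.leading k₁ k₂ t).shift θ).normX
        ≤ C * (t * ‖((t, x) : ℝ × PerC2)‖) := by
  have hH := hD.H₀
  obtain ⟨J, hJ, hjet⟩ := PerC.exists_norm_jet_le
  obtain ⟨K, hK, ρ, hρ, hel⟩ := exists_elev_sub_le hD
  set P := 1 + ‖D.proj‖ with hP
  set B := 2 * J * P + D.H₀ * K with hB
  have hB0 : 0 < B := by positivity
  refine ⟨9 * B, by positivity, ρ, hρ, fun t x ht hz hthin k₁ k₂ θ hk => ?_⟩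
  obtain ⟨he, he'⟩ := hel t x hz
  set m := ‖((t, x) : ℝ × PerC2)‖ with hm
  have hm0 : 0 ≤ m := norm_nonneg _
  set s := D.coord₂ x with hs
  set y := x - D.proj x with hy
  have hyn : ‖y‖ ≤ P * m := by
    have h1 : ‖x‖ ≤ m := le_max_right _ _
    have h2 := norm_sub_le x (D.proj x)
    have h3 := D.proj.le_opNorm x
    calc ‖y‖ ≤ (1 + ‖D.proj‖) * ‖x‖ := by linarith
      _ ≤ P * m := by gcongr
  have hbr : D.branchElt x = D.kerElt 1 0 + y := rfl
  have hu : (D.profile k₁ k₂ t s (D.branchElt x) - D.leading k₁ k₂ t).u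
      = (D.profile k₁ k₂ t s y).u := by
    funext ξ
    change (D.profile k₁ k₂ t s (D.branchElt x)).u ξ - (D.leading k₁ k₂ t).u ξ = _
    rw [(leading_vel hD k₁ k₂ t ξ).1, hbr]
    simp only [profile, velX, Prod.fst_add, Prod.snd_add, map_add, ContinuousMap.smul_apply,
      ContinuousMap.sub_apply, ContinuousMap.add_apply, smul_eq_mul]
    ring
  have hv : (D.profile k₁ k₂ t s (D.branchElt x) - D.leading k₁ k₂ t).v
      = (D.profile k₁ k₂ t s y).v := by
    funext ξ
    change (D.profile k₁ k₂ t s (D.branchElt x)).v ξ - (D.leading k₁ k₂ t).v ξ = _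
    rw [(leading_vel hD k₁ k₂ t ξ).2, hbr]
    simp only [profile, velY, Prod.fst_add, Prod.snd_add, map_add, ContinuousMap.smul_apply,
      ContinuousMap.add_apply, smul_eq_mul]
    ring
  -- the error of the surface deviation and its derivative
  set F : ℕ → PerC := fun j => if j = 0
    then D.elev t s (jet 0 (D.branchElt x).1) - (D.H₀ * t) • ((2 * D.kc ^ 2) • cosC)
    else D.elevDeriv t s (jet 0 (D.branchElt x).1) (jet 1 (D.branchElt x).1)
      - (D.H₀ * t) • ((2 * D.kc ^ 2) • -sinC) with hF
  have hFd : ∀ j < 1, IsDeriv (F j) (F (j + 1)) := by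
    intro j hj
    obtain rfl : j = 0 := by omega
    exact (isDeriv_elev hthin (isDeriv_jet (by norm_num) _)).sub ((isDeriv_cosC.smul _).smul _)
  have hη : (D.profile k₁ k₂ t s (D.branchElt x) - D.leading k₁ k₂ t).η
      = fun ξ : ℝ => F 0 (ξ : AddCircle (2 * Real.pi)) := by
    funext ξ
    change (D.profile k₁ k₂ t s (D.branchElt x)).η ξ - (D.leading k₁ k₂ t).η ξ = _
    simp only [profile, leading, hF, if_true, ContinuousMap.sub_apply, ContinuousMap.smul_apply,
      cosC_coe, smul_eq_mul]
    ring
  have hFn : ∀ j ≤ 1, ‖F j‖ ≤ D.H₀ * K * (t * m) := by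
    have key : ∀ G G' : PerC, ‖G - G'‖ ≤ K * m →
        ‖(D.H₀ * t) • G - (D.H₀ * t) • G'‖ ≤ D.H₀ * K * (t * m) := by
      intro G G' h
      rw [← smul_sub, norm_smul, Real.norm_of_nonneg (by positivity)]
      calc _ ≤ D.H₀ * t * (K * m) := by gcongr
        _ = _ := by ring
    intro j hj
    interval_cases j
    · simp only [hF, if_true, elev_eq hthin]
      exact key _ _ he
    · simp only [hF, one_ne_zero, if_false, elevDeriv_eq]
      exact key _ _ he'
  have hJB : ∀ j ≤ 4, t * (‖jet j y.1‖ + ‖jet j y.2‖) ≤ B * (t * m) := by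
    intro j hj
    obtain ⟨h1, h2⟩ := hjet j hj y
    calc t * (‖jet j y.1‖ + ‖jet j y.2‖) ≤ t * (J * (P * m) + J * (P * m)) := by
          gcongr
          · exact h1.trans (by gcongr)
          · exact h2.trans (by gcongr)
      _ = 2 * J * P * (t * m) := by ring
      _ ≤ B * (t * m) := by
        gcongr
        have : 0 < D.H₀ * K := by positivity
        linarith
  set V := D.profile k₁ k₂ t s (D.branchElt x) - D.leading k₁ k₂ t with hV
  have h9 := Profile.normX_le (U := V.shift θ) (B := B * (t * m)) (by positivity)
    (fun j hj ξ => ?_) (fun j hj ξ => ?_) (fun j hj ξ => ?_)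
  · linarith
  · change |iteratedDeriv j (fun ξ => V.u (ξ + θ)) ξ| ≤ _
    rw [iteratedDeriv_comp_add_const, hu, (iteratedDeriv_profile k₁ k₂ t s y hj).1]
    exact (abs_vel_le hD hk ht _ _ _).1.trans (hJB j hj)
  · change |iteratedDeriv j (fun ξ => V.v (ξ + θ)) ξ| ≤ _
    rw [iteratedDeriv_comp_add_const, hv, (iteratedDeriv_profile k₁ k₂ t s y hj).2]
    exact (abs_vel_le hD hk ht _ _ _).2.trans (hJB j hj)
  · change |iteratedDeriv j (fun ξ => V.η (ξ + θ)) ξ| ≤ _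
    rw [iteratedDeriv_comp_add_const, hη, iteratedDeriv_of_isDeriv hFd hj]
    refine (abs_apply_le _ _).trans ((hFn j hj).trans ?_)
    gcongr
    have : 0 < 2 * J * P := by positivity
    linarith

end IsoData
end ShallowWater
end

noncomputable section
namespace ShallowWater
open PerC

theorem Profile.shift_neg_shift (θ : ℝ) (U : Profile) : (U.shift θ).shift (-θ) = U := by
  ext ξ <;> simp [Profile.shift]

namespace IsoData

/-! ### The amplitude of a wave -/

/-- The amplitude: the modulus of the projection to the kernel of the linearisation. It is invariant
under translation. -/
def amp (D : IsoData) (w : PerC2) : ℝ := √(D.coord₁ w ^ 2 + D.coord₂ w ^ 2)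

variable {D : IsoData}

theorem amp_shift2 (θ : ℝ) (w : PerC2) : D.amp (shift2 θ w) = D.amp w := by
  rw [amp, amp, (coord_shift2 θ w).1, (coord_shift2 θ w).2]
  congr 1
  linear_combination (D.coord₁ w ^ 2 + D.coord₂ w ^ 2) * Real.sin_sq_add_cos_sq θ

theorem amp_smul_branchElt (hD : D.Pos) {a : ℝ} (ha : 0 ≤ a) (x : PerC2) :
    D.amp (a • D.branchElt x) = a := by
  obtain ⟨h1, h2⟩ := coord_branchElt hD x
  rw [amp, map_smul, map_smul, h1, h2, smul_eq_mul, smul_eq_mul, mul_one, mul_zero,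
    zero_pow two_ne_zero, add_zero, Real.sqrt_sq ha]

theorem exists_amp_le (hD : D.Pos) : ∃ c > 0, ∀ (w : PerC2) (m : ℝ),
    ‖jet 0 w.1‖ ≤ m → ‖jet 0 w.2‖ ≤ m → D.amp w ≤ c * m := by
  have hk := hD.kc_pos
  have hω := hD.ωc_pos
  set N := D.kc * (D.ωc ^ 2 + D.f ^ 2) with hN
  have hN0 : 0 < N := by positivity
  set Z := ‖coefC‖ + ‖coefS‖ with hZ
  have hZ0 : 0 ≤ Z := add_nonneg coefC.opNorm_nonneg coefS.opNorm_nonneg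
  refine ⟨2 * ((D.ωc + |D.f|) * Z / N) + 1, by positivity, fun w m hp hq => ?_⟩
  have hm : 0 ≤ m := (norm_nonneg _).trans hp
  have hc : ∀ f : PerC, ‖f‖ ≤ m → |coefC f| ≤ Z * m ∧ |coefS f| ≤ Z * m := by
    intro f hf
    have h1 := coefC.le_opNorm_of_le hf
    have h2 := coefS.le_opNorm_of_le hf
    rw [Real.norm_eq_abs] at h1 h2
    have h3 := mul_nonneg coefC.opNorm_nonneg hm
    have h4 := mul_nonneg coefS.opNorm_nonneg hm
    constructor <;> rw [hZ, add_mul] <;> linarith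
  have key : ∀ y z : ℝ, |y| ≤ Z * m → |z| ≤ Z * m →
      |(D.ωc * y + D.f * z) / N| ≤ (D.ωc + |D.f|) * Z / N * m := by
    intro y z hy hz
    have h1 : |D.ωc * y + D.f * z| ≤ D.ωc * (Z * m) + |D.f| * (Z * m) := by
      refine (abs_add_le _ _).trans ?_
      rw [abs_mul, abs_mul, abs_of_pos hω]
      gcongr
    rw [abs_div, abs_of_pos hN0, div_le_iff₀ hN0]
    calc _ ≤ _ := h1
      _ = _ := by field_simp
  have h1 : |D.coord₁ w| ≤ (D.ωc + |D.f|) * Z / N * m := by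
    rw [coord₁_apply]
    exact key _ _ (hc _ hp).1 (hc _ hq).2
  have h2 : |D.coord₂ w| ≤ (D.ωc + |D.f|) * Z / N * m := by
    have e : D.coord₂ w = (D.ωc * (-coefS (jet 0 w.1)) + D.f * coefC (jet 0 w.2)) / N := by
      rw [coord₂_apply, hN]
      congr 1
      ring
    rw [e]
    exact key _ _ (by rw [abs_neg]; exact (hc _ hp).2) (hc _ hq).1
  have h3 : D.amp w ≤ |D.coord₁ w| + |D.coord₂ w| := by
    refine Real.sqrt_le_iff.mpr ⟨by positivity, ?_⟩
    nlinarith [sq_abs (D.coord₁ w), sq_abs (D.coord₂ w), abs_nonneg (D.coord₁ w),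
      abs_nonneg (D.coord₂ w), mul_nonneg (abs_nonneg (D.coord₁ w)) (abs_nonneg (D.coord₂ w))]
  linarith

theorem norm_jet_le_of_profile (hD : D.Pos) {k₁ k₂ s m : ℝ} (hk : k₁ ^ 2 + k₂ ^ 2 = D.kc ^ 2)
    (hm : 0 ≤ m) {w : PerC2} {j : ℕ} (hj : j ≤ 4)
    (h : ∀ ξ, |iteratedDeriv j (D.profile k₁ k₂ 1 s w).u ξ| ≤ m ∧
      |iteratedDeriv j (D.profile k₁ k₂ 1 s w).v ξ| ≤ m) :
    ‖jet j w.1‖ ≤ 2 * m ∧ ‖jet j w.2‖ ≤ 2 * m := by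
  have hkc := hD.kc_pos
  obtain ⟨e1, e2⟩ := iteratedDeriv_profile (D := D) k₁ k₂ 1 s w hj
  rw [e1, e2] at h
  set X := D.velX k₁ k₂ 1 (jet j w.1) (jet j w.2) with hX
  set Y := D.velY k₁ k₂ 1 (jet j w.1) (jet j w.2) with hY
  have h1 : ‖X‖ ≤ m := (norm_le_iff hm).mpr fun ξ => (h ξ).1
  have h2 : ‖Y‖ ≤ m := (norm_le_iff hm).mpr fun ξ => (h ξ).2
  have a1 : |k₁| ≤ D.kc := abs_le_of_sq_le_sq (by nlinarith) hkc.le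
  have a2 : |k₂| ≤ D.kc := abs_le_of_sq_le_sq (by nlinarith) hkc.le
  obtain ⟨r1, r2⟩ := rotate_vel hD hk (jet j w.1) (jet j w.2)
  rw [← hX, ← hY] at r1 r2
  have b : ∀ (k : ℝ) (Z : PerC), |k| ≤ D.kc → ‖Z‖ ≤ m → ‖k • Z‖ ≤ D.kc * m := by
    intro k Z hk' hZ
    rw [norm_smul, Real.norm_eq_abs]
    gcongr
  have c : ∀ Z : PerC, ‖Z‖ ≤ D.kc * m + D.kc * m → ‖(1 / D.kc) • Z‖ ≤ 2 * m := by
    intro Z hZ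
    rw [norm_smul, Real.norm_of_nonneg (by positivity), one_div, inv_mul_le_iff₀ hkc]
    linarith
  rw [← r1, ← r2]
  exact ⟨c _ ((norm_add_le _ _).trans (add_le_add (b _ _ a1 h1) (b _ _ a2 h2))),
    c _ ((norm_sub_le _ _).trans (add_le_add (b _ _ a1 h2) (b _ _ a2 h1)))⟩

theorem profile_injective (hD : D.Pos) {k₁ k₂ s s' : ℝ} (hk : k₁ ^ 2 + k₂ ^ 2 = D.kc ^ 2)
    {w w' : PerC2} (h : D.profile k₁ k₂ 1 s w = D.profile k₁ k₂ 1 s' w') : w = w' := by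
  have hu : D.velX k₁ k₂ 1 (jet 0 w.1) (jet 0 w.2) = D.velX k₁ k₂ 1 (jet 0 w'.1) (jet 0 w'.2) :=
    ext_coe fun ξ => congrFun (congrArg Profile.u h) ξ
  have hv : D.velY k₁ k₂ 1 (jet 0 w.1) (jet 0 w.2) = D.velY k₁ k₂ 1 (jet 0 w'.1) (jet 0 w'.2) :=
    ext_coe fun ξ => congrFun (congrArg Profile.v h) ξ
  obtain ⟨r1, r2⟩ := rotate_vel hD hk (jet 0 w.1) (jet 0 w.2)
  obtain ⟨r1', r2'⟩ := rotate_vel hD hk (jet 0 w'.1) (jet 0 w'.2)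
  rw [hu, hv] at r1 r2
  have key : ∀ a b : PerC, jet 0 a = jet 0 b → a = b := fun a b hab =>
    sub_eq_zero.mp (eq_zero_of_jet_zero_eq_zero (by rw [map_sub, hab, sub_self]))
  exact Prod.ext (key _ _ (r1.symm.trans r1')) (key _ _ (r2.symm.trans r2'))

theorem leading_neg (k₁ k₂ A : ℝ) : D.leading k₁ k₂ (-A) = (D.leading k₁ k₂ A).shift Real.pi := by
  ext ξ <;> simp only [leading, Profile.shift, Real.cos_add_pi, Real.sin_add_pi] <;> ring

theorem profile_shift_pi_shift_pi (k₁ k₂ s : ℝ) (w : PerC2) :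
    ((D.profile k₁ k₂ 1 s w).shift Real.pi).shift Real.pi = D.profile k₁ k₂ 1 s w := by
  have e : ∀ ξ : ℝ, ξ + Real.pi + Real.pi = ξ + 2 * Real.pi := fun ξ => by ring
  ext ξ <;> simp only [profile, Profile.shift, e] <;> exact periodic_coe _ ξ

/-! ### The waves on the branch -/

/-- The wave with amplitude `a` on the branch `ψ`, for the wave number parameter `κ`. -/
def wave (D : IsoData) (ψ : ℝ × ℝ → PerC2) (κ a : ℝ) : PerC2 := a • D.branchElt (ψ (a, κ))

/-- The profiles of the waves on the branch, for the parameters `(α, s, κ, A)`. A negative amplitude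
means a translation by half a period. -/
def waveProfile (D : IsoData) (ψ : ℝ × ℝ → PerC2) (k₁ k₂ : ℝ) (z : ℝ × ℝ × ℝ × ℝ) : Profile :=
  if z.2.2.2 < 0 then
    (D.profile k₁ k₂ 1 z.2.1 (D.wave ψ z.2.2.1 |z.2.2.2|)).shift Real.pi
  else D.profile k₁ k₂ 1 z.2.1 (D.wave ψ z.2.2.1 |z.2.2.2|)

theorem waveProfile_of_nonneg {ψ : ℝ × ℝ → PerC2} {k₁ k₂ α s κ A : ℝ} (hA : 0 ≤ A) :
    D.waveProfile ψ k₁ k₂ (α, s, κ, A) = D.profile k₁ k₂ 1 s (D.wave ψ κ A) := by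
  simp only [waveProfile, not_lt.mpr hA, if_false, abs_of_nonneg hA]

theorem wave_zero (ψ : ℝ × ℝ → PerC2) (κ : ℝ) : D.wave ψ κ 0 = 0 := zero_smul _ _

theorem thin_zero (t s : ℝ) (x : AddCircle (2 * Real.pi)) :
    0 < D.thin t s (jet 0 (0 : PerC2).1) x := by
  rw [thin_apply, Prod.fst_zero, map_zero, ContinuousMap.zero_apply, mul_zero, sub_zero (1 : ℝ)]
  exact one_pos

theorem waveProfile_neg (ψ : ℝ × ℝ → PerC2) (k₁ k₂ α s κ A : ℝ) :
    D.waveProfile ψ k₁ k₂ (α, s, κ, -A) = (D.waveProfile ψ k₁ k₂ (α, s, κ, A)).shift Real.pi := by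
  rcases lt_trichotomy A 0 with hA | hA | hA
  · simp only [waveProfile, not_lt.mpr (neg_nonneg.mpr hA.le), hA, if_false, if_true, abs_neg]
    exact (profile_shift_pi_shift_pi _ _ _ _).symm
  · rw [hA, neg_zero, waveProfile_of_nonneg le_rfl, wave_zero, ← profile_shift _ _ _ (thin_zero 1 s)]
    congr 1
  · simp only [waveProfile, neg_neg_iff_pos.mpr hA, not_lt.mpr hA.le, if_false, if_true, abs_neg]

/-- The profiles of waves with small velocity, in the topology of continuous third derivatives, and
small amplitude. -/
def smallProfiles (D : IsoData) (k₁ k₂ δ ε : ℝ) : Set Profile :=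
  {U | (∀ j ≤ 3, ∀ ξ, |iteratedDeriv j U.u ξ| < δ ∧ |iteratedDeriv j U.v ξ| < δ) ∧
    ∀ s w, U = D.profile k₁ k₂ 1 s w → D.amp w < ε}

theorem exists_ball_subset_smallProfiles (hD : D.Pos) {δ ε : ℝ} (hδ : 0 < δ) (hε : 0 < ε) :
    ∃ r > 0, ∀ k₁ k₂ : ℝ, k₁ ^ 2 + k₂ ^ 2 = D.kc ^ 2 → ∀ U : Profile, U.MemX → U.normX < r →
      U ∈ D.smallProfiles k₁ k₂ δ ε := by
  obtain ⟨c, hc, hamp⟩ := exists_amp_le hD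
  refine ⟨min (δ / 2) (ε / (4 * c)), by positivity, fun k₁ k₂ hk U hU hn => ⟨fun j hj ξ => ?_, ?_⟩⟩
  · obtain ⟨h1, h2⟩ := hU.abs_iteratedDeriv_le hj ξ
    have h3 := hn.trans_le (min_le_left _ _)
    constructor <;> linarith
  · rintro s w rfl
    have h3 := hn.trans_le (min_le_right _ _)
    rw [lt_div_iff₀ (by positivity)] at h3
    obtain ⟨h1, h2⟩ := norm_jet_le_of_profile hD hk (m := 2 * (D.profile k₁ k₂ 1 s w).normX)
      (mul_nonneg two_pos.le (Real.sqrt_nonneg _)) (show 0 ≤ 4 by norm_num)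
      fun ξ => hU.abs_iteratedDeriv_le (by norm_num) ξ
    have := hamp w _ h1 h2
    linarith

theorem profile_mem_smallProfiles (hD : D.Pos) {k₁ k₂ s δ ε : ℝ} (hk : k₁ ^ 2 + k₂ ^ 2 = D.kc ^ 2)
    {w : PerC2} (hw : ∀ j ≤ 3, ‖jet j w.1‖ + ‖jet j w.2‖ < δ) (ha : D.amp w < ε) :
    D.profile k₁ k₂ 1 s w ∈ D.smallProfiles k₁ k₂ δ ε := by
  refine ⟨fun j hj ξ => ?_, fun s' w' h => ?_⟩
  · obtain ⟨e1, e2⟩ := iteratedDeriv_profile (D := D) k₁ k₂ 1 s w (hj.trans (by norm_num))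
    obtain ⟨h1, h2⟩ := abs_vel_le hD hk zero_le_one (jet j w.1) (jet j w.2) ξ
    rw [e1, e2]
    have := hw j hj
    rw [one_mul] at h1 h2
    exact ⟨h1.trans_lt this, h2.trans_lt this⟩
  · rwa [← profile_injective hD hk h]

end IsoData
end ShallowWater
end

noncomputable section
namespace ShallowWater
open PerC
namespace IsoData

/-! ### The bifurcation equations -/

/-- The remainder of the first bifurcation equation, for the branch `ψ`. -/
def remainder₁ (D : IsoData) (ψ : ℝ × ℝ → PerC2) (z : ℝ × ℝ × ℝ × ℝ) : ℝ :=
  D.coord₂ (ψ (|z.2.2.2|, z.2.2.1)) - z.2.2.1 * (D.f ^ 2 / D.ωc)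

/-- The remainder of the second bifurcation equation, for the branch `ψ`. -/
def remainder₂ (D : IsoData) (ψ : ℝ × ℝ → PerC2) (z : ℝ × ℝ × ℝ × ℝ) : ℝ :=
  D.ampCoeff * |z.2.2.2| - D.coord₁ (ψ (|z.2.2.2|, z.2.2.1))

variable {D : IsoData} {ψ : ℝ × ℝ → PerC2}

/-- The nontrivial solutions of the bifurcation equations are the points of the branch. -/
theorem bifEqs_iff {α s κ A : ℝ} : D.BifEqs (D.remainder₁ ψ) (D.remainder₂ ψ) α s κ A ↔
    A = 0 ∨ (α = D.coord₁ (ψ (|A|, κ)) ∧ s = D.coord₂ (ψ (|A|, κ))) := by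
  have h1 : -s + κ * (D.f ^ 2 / D.ωc) + D.remainder₁ ψ (α, s, κ, A) = D.coord₂ (ψ (|A|, κ)) - s := by
    simp only [remainder₁]
    ring
  have h2 : α - D.ampCoeff * |A| + D.remainder₂ ψ (α, s, κ, A) = α - D.coord₁ (ψ (|A|, κ)) := by
    simp only [remainder₂]
    ring
  rw [BifEqs, h1, h2, eq_comm (a := (0 : ℝ)), eq_comm (a := (0 : ℝ)), mul_eq_zero, mul_eq_zero,
    sub_eq_zero, sub_eq_zero, eq_comm (a := D.coord₂ _)]
  tauto

/-- The waves on the branch solve the reduced equations; at zero amplitude the wave is trivial and the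
parameters are arbitrary. -/
theorem residual_wave {ρ : ℝ} (hzero : ∀ z, ‖z‖ < ρ → D.branchMap (z, ψ z) = 0) {α s κ a : ℝ}
    (ha : 0 ≤ a) (hz : ‖((a, κ) : ℝ × ℝ)‖ < ρ)
    (h : a = 0 ∨ (α = D.coord₁ (ψ (a, κ)) ∧ s = D.coord₂ (ψ (a, κ)))) :
    D.residual 1 κ α s (D.wave ψ κ a) = 0 := by
  rw [wave, residual_smul ha]
  rcases h with h | ⟨h1, h2⟩
  · rw [h, zero_smul]
  · have := hzero (a, κ) hz
    rw [branchMap_apply, ← h1, ← h2] at this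
    rw [branchElt, this, smul_zero]

/-- At zero amplitude the branch follows the threshold of instability of the trivial flow. -/
theorem coord₁_branch_zero (hD : D.Pos) {κ : ℝ} (h : D.branchMap ((0, κ), ψ (0, κ)) = 0) :
    D.coord₁ (ψ (0, κ)) = D.threshold κ := by
  rw [branchMap_apply] at h
  refine eq_threshold_of_residual_eq_zero h ?_
  have := (coord_branchElt hD (ψ (0, κ))).1
  rw [branchElt] at this
  rw [this]
  exact one_ne_zero

/-- The waves on the branch are small if their amplitude is. -/
theorem exists_norm_jet_wave_lt {ρ K : ℝ} (hρ : 0 < ρ) (hK : 1 ≤ K)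
    (hψ : ∀ z, ‖z‖ < ρ → ‖ψ z‖ ≤ K * ‖z‖) {m : ℝ} (hm : 0 < m) :
    ∃ ε > 0, ∀ κ a : ℝ, ‖((a, κ) : ℝ × ℝ)‖ < ε → ∀ j ≤ 4,
      ‖jet j (D.wave ψ κ a).1‖ + ‖jet j (D.wave ψ κ a).2‖ < m := by
  obtain ⟨J, hJ, hjet⟩ := PerC.exists_norm_jet_le
  set n := ‖D.kerElt 1 0‖ + (1 + ‖D.proj‖) * (K * ρ) with hn
  have hn0 : 0 ≤ n := by positivity
  refine ⟨min ρ (m / (2 * (J * n + 1))), by positivity, fun κ a hz j hj => ?_⟩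
  have h1 := hz.trans_le (min_le_left _ _)
  have h2 := hz.trans_le (min_le_right _ _)
  rw [lt_div_iff₀ (by positivity)] at h2
  have ha : |a| ≤ ‖((a, κ) : ℝ × ℝ)‖ := le_max_left _ _
  set x := ψ (a, κ) with hx
  have hxn : ‖x‖ ≤ K * ρ := (hψ _ h1).trans (by gcongr)
  have hb : ‖D.branchElt x‖ ≤ n := by
    rw [branchElt]
    have h3 := norm_add_le (D.kerElt 1 0) (x - D.proj x)
    have h4 := norm_sub_le x (D.proj x)
    have h5 := D.proj.le_opNorm x
    have h6 : (1 + ‖D.proj‖) * ‖x‖ ≤ (1 + ‖D.proj‖) * (K * ρ) := by gcongr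
    linarith
  have hw : ‖D.wave ψ κ a‖ ≤ ‖((a, κ) : ℝ × ℝ)‖ * n := by
    rw [wave, norm_smul, Real.norm_eq_abs]
    gcongr
  obtain ⟨h7, h8⟩ := hjet j hj (D.wave ψ κ a)
  have h9 : J * ‖D.wave ψ κ a‖ ≤ J * (‖((a, κ) : ℝ × ℝ)‖ * n) := by gcongr
  have h10 : 0 ≤ ‖((a, κ) : ℝ × ℝ)‖ := norm_nonneg _
  linarith

/-- The profile of the trivial wave does not depend on the speed. -/
theorem profile_zero_eq (k₁ k₂ s s' : ℝ) :
    D.profile k₁ k₂ 1 s (0 : PerC2) = D.profile k₁ k₂ 1 s' (0 : PerC2) := by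
  have h0 : (1 : ℝ) • jet 0 (0 : PerC2).1 = 0 := by rw [Prod.fst_zero, map_zero, smul_zero]
  ext ξ
  · rfl
  · rfl
  · simp only [profile, elev, thick_eq_one h0, thickAvg_eq_one h0]

theorem waveProfile_eq_shift (ψ : ℝ × ℝ → PerC2) (k₁ k₂ α s κ A : ℝ) :
    ∃ θ : ℝ, D.waveProfile ψ k₁ k₂ (α, s, κ, A)
        = (D.profile k₁ k₂ 1 s (D.wave ψ κ |A|)).shift θ ∧
      D.leading k₁ k₂ A = (D.leading k₁ k₂ |A|).shift θ := by
  rcases lt_or_ge A 0 with hA | hA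
  · refine ⟨Real.pi, by simp only [waveProfile, hA, if_true], ?_⟩
    rw [← leading_neg, abs_of_neg hA, neg_neg]
  · refine ⟨0, ?_, ?_⟩
    · rw [waveProfile_of_nonneg hA, abs_of_nonneg hA]
      ext ξ <;> simp only [Profile.shift, add_zero]
    · rw [abs_of_nonneg hA]
      ext ξ <;> simp only [Profile.shift, add_zero]

/-- The waves near the trivial flow correspond to the solutions of the bifurcation equations, and
their form is determined by the amplitude to leading order. -/
theorem exists_correspondence (hD : D.Pos) {ρ ρ' K : ℝ} (hρ : 0 < ρ) (hρ' : 0 < ρ') (hK : 1 ≤ K)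
    (hzero : ∀ z, ‖z‖ < ρ → D.branchMap (z, ψ z) = 0)
    (huniq : ∀ z x, ‖z‖ < ρ → ‖x‖ < ρ' → D.branchMap (z, x) = 0 → x = ψ z)
    (hψ : ∀ z, ‖z‖ < ρ → ‖ψ z‖ ≤ K * ‖z‖) :
    ∃ M > 0, ∃ ε₀ > 0, ∀ ε > 0, ε ≤ ε₀ → ∃ δ > 0, ∀ k₁ k₂ : ℝ, k₁ ^ 2 + k₂ ^ 2 = D.kc ^ 2 →
      ∃ N : Set Profile, (∀ U : Profile, U.MemX → U.normX < δ → U ∈ N) ∧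
        ∀ α ∈ Ioo (-ε) ε, ∀ s ∈ Ioo (-ε) ε, ∀ κ ∈ Ioo (-ε) ε,
          (∀ A ∈ Ioo (-ε) ε, D.BifEqs (D.remainder₁ ψ) (D.remainder₂ ψ) α s κ A →
            D.waveProfile ψ k₁ k₂ (α, s, κ, A) ∈ N ∧
            D.IsWave k₁ k₂ α s κ (D.waveProfile ψ k₁ k₂ (α, s, κ, A)) ∧
            (D.waveProfile ψ k₁ k₂ (α, s, κ, A) - D.leading k₁ k₂ A).normX
              ≤ M * (|A| * (|A| + |κ|))) ∧
          (∀ U ∈ N, D.IsWave k₁ k₂ α s κ U →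
            ∃! A : ℝ, A ∈ Ico 0 ε ∧ D.BifEqs (D.remainder₁ ψ) (D.remainder₂ ψ) α s κ A ∧
              ∃ θ : ℝ, U = (D.waveProfile ψ k₁ k₂ (α, s, κ, A)).shift θ) := by
  have hkc := hD.kc_pos
  have hω := hD.ωc_pos
  obtain ⟨σ, hσ, hclass⟩ := exists_classification hD hρ hρ' huniq
  obtain ⟨δ₀, hδ₀, hjets⟩ := exists_norm_lt_of_jet_lt hD hσ
  obtain ⟨C, hC, ρ₁, hρ₁, herr⟩ := exists_normX_sub_leading_le hD
  -- velocities below `δ₁` keep the layer thickness positive, and those of waves make `w` small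
  set δ₁ := min (δ₀ / 4) (D.ωc / (8 * D.kc)) with hδ₁
  have hδ₁0 : 0 < δ₁ := by positivity
  have hδ₁a : δ₁ ≤ δ₀ / 4 := min_le_left _ _
  have hδ₁b : δ₁ ≤ D.ωc / (8 * D.kc) := min_le_right _ _
  have hω8 : D.ωc / (2 * D.kc) = 4 * (D.ωc / (8 * D.kc)) := by field_simp; norm_num
  have hω80 : 0 < D.ωc / (8 * D.kc) := by positivity
  obtain ⟨ε₁, hε₁, hsmall⟩ := exists_norm_jet_wave_lt (D := D) hρ hK hψ hδ₁0
  set ε₀ := min (min (min ε₁ σ) (min δ₀ (D.ωc / 2))) (min ρ (min (ρ₁ / K) 1)) with hε₀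
  refine ⟨C * K, by positivity, ε₀, by positivity, fun ε hε hεle => ?_⟩
  have e1 : ε ≤ ε₁ := by simp only [hε₀, le_min_iff] at hεle; tauto
  have e2 : ε ≤ σ := by simp only [hε₀, le_min_iff] at hεle; tauto
  have e3 : ε ≤ δ₀ := by simp only [hε₀, le_min_iff] at hεle; tauto
  have e4 : ε ≤ D.ωc / 2 := by simp only [hε₀, le_min_iff] at hεle; tauto
  have e5 : ε ≤ ρ := by simp only [hε₀, le_min_iff] at hεle; tauto
  have e6 : K * ε ≤ ρ₁ := by
    have : ε ≤ ρ₁ / K := by simp only [hε₀, le_min_iff] at hεle; tauto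
    rwa [le_div_iff₀ (by linarith), mul_comm] at this
  have e7 : ε ≤ 1 := by simp only [hε₀, le_min_iff] at hεle; tauto
  obtain ⟨δ, hδ, hball⟩ := exists_ball_subset_smallProfiles hD hδ₁0 hε
  refine ⟨δ, hδ, fun k₁ k₂ hk => ⟨D.smallProfiles k₁ k₂ δ₁ ε, hball k₁ k₂ hk, ?_⟩⟩
  intro α hα s hs κ hκ
  have hα' : |α| < ε := abs_lt.mpr hα
  have hs' : |s| < ε := abs_lt.mpr hs
  have hκ' : |κ| < ε := abs_lt.mpr hκ
  have hz : ∀ a, 0 ≤ a → a < ε → ‖((a, κ) : ℝ × ℝ)‖ < ε := fun a ha ha' =>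
    max_lt (by rwa [Real.norm_of_nonneg ha]) hκ'
  have hthin : ∀ a, 0 ≤ a → a < ε → ∀ x, 0 < D.thin 1 s (jet 0 (D.wave ψ κ a).1) x := by
    intro a ha ha' x
    refine thin_pos hD (hs'.le.trans e4) ?_ x
    have h1 := hsmall κ a ((hz a ha ha').trans_le e1) 0 (by norm_num)
    have h2 := norm_nonneg (jet 0 (D.wave ψ κ a).2)
    rw [abs_one, one_mul]
    linarith
  constructor
  · intro A hA hbif
    rw [bifEqs_iff] at hbif
    have hA' : |A| < ε := abs_lt.mpr hA
    have hA0 := abs_nonneg A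
    obtain ⟨θ, hθ, hθ'⟩ := waveProfile_eq_shift (D := D) ψ k₁ k₂ α s κ A
    have hth := hthin |A| hA0 hA'
    have hzA := hz |A| hA0 hA'
    have hres : D.residual 1 κ α s (shift2 θ (D.wave ψ κ |A|)) = 0 := by
      rw [residual_shift θ hth, residual_wave hzero hA0 (hzA.trans_le e5)
        (hbif.imp_left fun h => by rw [h, abs_zero])]
      rfl
    have hjw : ∀ j ≤ 3, ‖jet j (shift2 θ (D.wave ψ κ |A|)).1‖
        + ‖jet j (shift2 θ (D.wave ψ κ |A|)).2‖ < δ₁ := by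
      intro j hj
      have hj4 : j ≤ 4 := hj.trans (by norm_num)
      refine lt_of_le_of_lt (add_le_add ?_ ?_) (hsmall κ |A| (hzA.trans_le e1) j hj4)
      · rw [shift2, jet_shift θ _ hj4]
        exact norm_shift_le θ _
      · rw [shift2, jet_shift θ _ hj4]
        exact norm_shift_le θ _
    refine ⟨?_, ?_, ?_⟩
    · rw [hθ, ← profile_shift k₁ k₂ θ hth]
      refine profile_mem_smallProfiles hD hk hjw ?_
      rwa [amp_shift2, wave, amp_smul_branchElt hD hA0]
    · rw [hθ, ← profile_shift k₁ k₂ θ hth]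
      refine isWave_profile hD hk zero_le_one (by linarith [hs.2]) (thin_pos hD (hs'.le.trans e4) ?_)
        hres
      have h1 := hjw 0 (by norm_num)
      have h2 := norm_nonneg (jet 0 (shift2 θ (D.wave ψ κ |A|)).2)
      rw [abs_one, one_mul]
      linarith
    · set x := ψ (|A|, κ) with hx
      have hxn : ‖x‖ ≤ K * ‖((|A|, κ) : ℝ × ℝ)‖ := hψ _ (hzA.trans_le e5)
      have hpair : ‖((|A|, x) : ℝ × PerC2)‖ ≤ K * ‖((|A|, κ) : ℝ × ℝ)‖ := by
        refine max_le ?_ hxn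
        have : ‖|A|‖ ≤ ‖((|A|, κ) : ℝ × ℝ)‖ := le_max_left _ _
        exact this.trans (le_mul_of_one_le_left (norm_nonneg _) hK)
      have hsum : ‖((|A|, κ) : ℝ × ℝ)‖ ≤ |A| + |κ| := by
        refine max_le ?_ ?_
        · rw [Real.norm_eq_abs, abs_abs]
          linarith [abs_nonneg κ]
        · rw [Real.norm_eq_abs]
          linarith
      have hprof : D.profile k₁ k₂ 1 s (D.wave ψ κ |A|)
          = D.profile k₁ k₂ |A| (D.coord₂ x) (D.branchElt x) := by
        rw [← profile_smul k₁ k₂ |A|]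
        -- at zero amplitude `s` is arbitrary, but both profiles vanish
        rcases hbif with h | ⟨-, h⟩
        · rw [h, abs_zero, wave_zero, zero_smul]
          exact profile_zero_eq _ _ _ _
        · rw [← h]
          rfl
      have hthx : ∀ y, 0 < D.thin |A| (D.coord₂ x) (jet 0 (D.branchElt x).1) y := by
        rcases hbif with h | ⟨-, h⟩
        · intro y
          rw [thin_apply, h, abs_zero, zero_mul, zero_mul, sub_zero (1 : ℝ)]
          exact one_pos
        · rw [← h]
          intro y
          have := hth y
          rwa [wave, Prod.smul_fst, map_smul, thin_smul] at this
      have hlt : ‖((|A|, x) : ℝ × PerC2)‖ < ρ₁ := by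
        have : K * ‖((|A|, κ) : ℝ × ℝ)‖ < K * ε := by gcongr
        linarith
      have h1 := herr |A| x hA0 hlt hthx k₁ k₂ θ hk
      rw [hθ, hθ', hprof]
      refine h1.trans ?_
      calc C * (|A| * ‖((|A|, x) : ℝ × PerC2)‖) ≤ C * (|A| * (K * (|A| + |κ|))) := by
            gcongr
            exact hpair.trans (by gcongr)
        _ = C * K * (|A| * (|A| + |κ|)) := by ring
  · rintro U ⟨hUd, hUa⟩ hwave
    have hslow := slowness_pos_le hD (hs'.le.trans e4)
    have hk1 : |k₁| ≤ D.kc := abs_le_of_sq_le_sq (by nlinarith) hkc.le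
    have hk2 : |k₂| ≤ D.kc := abs_le_of_sq_le_sq (by nlinarith) hkc.le
    obtain ⟨w, hres, hU, hth⟩ := exists_eq_profile hD hk (by linarith [hκ.1]) (by linarith [hs.2])
      hwave fun ζ => by
        obtain ⟨h1, h2⟩ := hUd 0 (by norm_num) ζ
        rw [iteratedDeriv_zero] at h1 h2
        have h3 : k₁ * U.u ζ + k₂ * U.v ζ ≤ D.kc * δ₁ + D.kc * δ₁ := by
          refine (le_abs_self _).trans ((abs_add_le _ _).trans ?_)
          rw [abs_mul, abs_mul]
          gcongr
        have h4 : (k₁ * U.u ζ + k₂ * U.v ζ) / D.kc ≤ 2 * δ₁ := by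
          rw [div_le_iff₀ hkc]
          linarith
        calc _ ≤ D.slowness s * (2 * δ₁) := mul_le_mul_of_nonneg_left h4 hslow.1.le
          _ ≤ (2 * D.kc / D.ωc) * (2 * (D.ωc / (8 * D.kc))) := by gcongr; exact hslow.2
          _ = 1 / 2 := by field_simp; norm_num
          _ < 1 := by norm_num
    have hwn : ‖w‖ < σ := by
      refine hjets κ α s w (hκ'.trans_le e3) (hα'.trans_le e3) (hs'.trans_le e3) (fun j hj => ?_)
        hres
      obtain ⟨h1, h2⟩ := norm_jet_le_of_profile (s := s) (w := w) (m := δ₁) hD hk hδ₁0.le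
        (show j ≤ 4 by omega) fun ξ => by
          rw [← hU]
          exact ⟨(hUd j hj ξ).1.le, (hUd j hj ξ).2.le⟩
      constructor <;> linarith
    obtain ⟨a, θ, ha, hθ, hpar⟩ := hclass κ α s w (hκ'.trans_le e2) (hα'.trans_le e2)
      (hs'.trans_le e2) hwn hth hres
    have ha0 : 0 ≤ a := ha ▸ Real.sqrt_nonneg _
    have haε : a < ε := by
      rw [ha]
      exact hUa s w hU
    refine ⟨a, ⟨⟨ha0, haε⟩, ?_, -θ, ?_⟩, ?_⟩
    · rw [bifEqs_iff, abs_of_nonneg ha0]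
      rcases ha0.eq_or_lt with h | h
      · exact Or.inl h.symm
      · exact Or.inr (hpar h)
    · rw [waveProfile_of_nonneg ha0, wave, ← hθ, profile_shift k₁ k₂ θ hth, ← hU,
        Profile.shift_neg_shift]
    -- uniqueness: the amplitude is invariant under translation
    · rintro A ⟨hA, -, θ', hA'⟩
      rw [waveProfile_of_nonneg hA.1, ← profile_shift k₁ k₂ θ' (hthin A hA.1 hA.2), hU] at hA'
      have h1 := profile_injective hD hk hA'
      have h2 : D.amp w = A := by rw [h1, amp_shift2, wave, amp_smul_branchElt hD hA.1]
      rw [ha, ← h2, amp]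

end IsoData
end ShallowWater
end

open ShallowWater
theorem theoremt (D : IsoData) (hg : 0 < D.g) (hH : 0 < D.H₀) (hb : 0 < D.b) (hd : 0 < D.d)
    (hQ : 0 < D.Q) :
    0 < D.I₁ ∧ 0 < D.I₂ ∧
    ∃ (ε δ M : ℝ) (R₁ R₂ : ℝ × ℝ × ℝ × ℝ → ℝ) (αb sb : ℝ × ℝ → ℝ),
      0 < ε ∧ ε < 1 ∧ 0 < δ ∧ 0 < M ∧
      -- the remainder terms
      ContinuousOn R₁ (Ioo (-ε) ε ×ˢ Ioo (-ε) ε ×ˢ Ioo (-ε) ε ×ˢ Ioo (-ε) ε) ∧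
      ContinuousOn R₂ (Ioo (-ε) ε ×ˢ Ioo (-ε) ε ×ˢ Ioo (-ε) ε ×ˢ Ioo (-ε) ε) ∧
      (∀ α ∈ Ioo (-ε) ε, ∀ s ∈ Ioo (-ε) ε, ∀ κ ∈ Ioo (-ε) ε, ∀ A ∈ Ioo (-ε) ε,
        |R₁ (α, s, κ, A)| ≤ M * (A ^ 2 + (α ^ 2 + s ^ 2 + κ ^ 2)) ∧
        |R₂ (α, s, κ, A)| ≤ M * (A ^ 2 + (α ^ 2 + s ^ 2 + κ ^ 2))) ∧
      -- the nontrivial solutions of the bifurcation equations form a branch over the amplitude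
      -- and the wave number, along which `α` increases strictly with the amplitude
      ContinuousOn αb (Ico 0 ε ×ˢ Ioo (-ε) ε) ∧
      ContinuousOn sb (Ico 0 ε ×ˢ Ioo (-ε) ε) ∧
      (∀ a ∈ Ico 0 ε, ∀ κ ∈ Ioo (-ε) ε,
        |αb (a, κ) - D.ampCoeff * a| ≤ M * (a ^ 2 + κ ^ 2) ∧
        |sb (a, κ) - κ * (D.f ^ 2 / D.ωc)| ≤ M * (a ^ 2 + κ ^ 2)) ∧
      (∀ κ ∈ Ioo (-ε) ε, StrictMonoOn (fun a => αb (a, κ)) (Ico 0 ε)) ∧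
      (∀ α ∈ Ioo (-ε) ε, ∀ s ∈ Ioo (-ε) ε, ∀ κ ∈ Ioo (-ε) ε, ∀ A ∈ Ioo (-ε) ε, A ≠ 0 →
        (D.BifEqs R₁ R₂ α s κ A ↔ α = αb (|A|, κ) ∧ s = sb (|A|, κ))) ∧
      ∀ k₁ k₂ : ℝ, √(k₁ ^ 2 + k₂ ^ 2) = D.kc →
        -- the branch bifurcates into the region where the trivial flow is unstable
        (∀ α ∈ Ioo (-ε) ε, ∀ κ ∈ Ioo (-ε) ε,
          (TrivialFlowUnstable (D.params α) ((1 + κ) * k₁) ((1 + κ) * k₂) ↔ αb (0, κ) < α)) ∧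
        -- one-to-one correspondence, and form of the waves
        ∃ (N : Set Profile) (Φ : ℝ × ℝ × ℝ × ℝ → Profile),
          (∀ U : Profile, U.MemX → U.normX < δ → U ∈ N) ∧
          ∀ α ∈ Ioo (-ε) ε, ∀ s ∈ Ioo (-ε) ε, ∀ κ ∈ Ioo (-ε) ε,
            (∀ A ∈ Ioo (-ε) ε, D.BifEqs R₁ R₂ α s κ A →
              Φ (α, s, κ, A) ∈ N ∧ D.IsWave k₁ k₂ α s κ (Φ (α, s, κ, A)) ∧
              (Φ (α, s, κ, A) - D.leading k₁ k₂ A).normX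
                ≤ M * (|A| * (|A| + (|α| + |s| + |κ|))) ∧
              D.BifEqs R₁ R₂ α s κ (-A) ∧
              Φ (α, s, κ, -A) = (Φ (α, s, κ, A)).shift Real.pi) ∧
            (∀ U ∈ N, D.IsWave k₁ k₂ α s κ U →
              ∃! A : ℝ, A ∈ Ico 0 ε ∧ D.BifEqs R₁ R₂ α s κ A ∧
                ∃ θ : ℝ, U = (Φ (α, s, κ, A)).shift θ) := by
  have hD : D.Pos := ⟨hg, hH, hb, hd, hQ⟩
  refine ⟨IsoData.I₁_pos hD, IsoData.I₂_pos hD, ?_⟩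
  have hc := IsoData.ampCoeff_pos hD
  obtain ⟨ρ, hρ, ρ', hρ', K, hK, C, hC, ψ, hzero, huniq, hψ0, hlip, hslope⟩ :=
    IsoData.exists_branch hD
  have hψ : ∀ z, ‖z‖ < ρ → ‖ψ z‖ ≤ K * ‖z‖ := fun z hz => by
    have := hlip z 0 hz (by rwa [norm_zero])
    rwa [hψ0, sub_zero, sub_zero] at this
  obtain ⟨M, hM, ε₀, hε₀, hcorr⟩ :=
    IsoData.exists_correspondence hD hρ hρ' hK hzero huniq hψ
  -- the last bound makes the slope of `α` positive on the whole branch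
  set ε := min (min ε₀ (1 / 2)) (min (ρ / 2) (D.ampCoeff / (2 * C))) with hε
  have hε0 : 0 < ε := by positivity
  have e1 : ε ≤ ε₀ := (min_le_left _ _).trans (min_le_left _ _)
  have e2 : ε ≤ 1 / 2 := (min_le_left _ _).trans (min_le_right _ _)
  have e3 : ε ≤ ρ / 2 := (min_le_right _ _).trans (min_le_left _ _)
  have e4 : C * ε < D.ampCoeff := by
    have h1 : ε ≤ D.ampCoeff / (2 * C) := (min_le_right _ _).trans (min_le_right _ _)
    rw [le_div_iff₀ (by positivity)] at h1
    linarith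
  obtain ⟨δ, hδ, hcorr⟩ := hcorr ε hε0 e1
  have hin : ∀ {a κ : ℝ}, |a| < ε → κ ∈ Ioo (-ε) ε → ‖((a, κ) : ℝ × ℝ)‖ < ε := fun ha hκ =>
    max_lt ha (abs_lt.mpr hκ)
  have hερ : ε < ρ := by linarith
  have hcont : ContinuousOn ψ (Metric.ball 0 ρ) := by
    refine LipschitzOnWith.continuousOn (K := K.toNNReal)
      (LipschitzOnWith.of_dist_le_mul fun z hz z' hz' => ?_)
    rw [mem_ball_zero_iff] at hz hz'
    rw [Real.coe_toNNReal K (by linarith), dist_eq_norm, dist_eq_norm]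
    exact hlip z z' hz hz'
  have hcont₁ : ContinuousOn ψ (Ico 0 ε ×ˢ Ioo (-ε) ε) := hcont.mono fun z hz =>
    mem_ball_zero_iff.mpr
      ((hin (by rw [abs_of_nonneg hz.1.1]; exact hz.1.2) hz.2).trans hερ)
  have hcont₂ : ContinuousOn (fun z : ℝ × ℝ × ℝ × ℝ => ψ (|z.2.2.2|, z.2.2.1))
      (Ioo (-ε) ε ×ˢ Ioo (-ε) ε ×ˢ Ioo (-ε) ε ×ˢ Ioo (-ε) ε) := by
    refine hcont.comp (by fun_prop) fun z hz => mem_ball_zero_iff.mpr ?_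
    exact (hin (by rw [abs_abs]; exact abs_lt.mpr hz.2.2.2) hz.2.2.1).trans hερ
  have hest : ∀ a κ : ℝ, |a| < ε → κ ∈ Ioo (-ε) ε →
      |D.coord₁ (ψ (a, κ)) - D.ampCoeff * a| ≤ (C + M) * (a ^ 2 + κ ^ 2) ∧
      |D.coord₂ (ψ (a, κ)) - κ * (D.f ^ 2 / D.ωc)| ≤ (C + M) * (a ^ 2 + κ ^ 2) := by
    intro a κ ha hκ
    have h1 := hslope ‖((a, κ) : ℝ × ℝ)‖ ((hin ha hκ).trans hερ) (a, κ) 0 le_rfl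
      (by rw [norm_zero]; exact norm_nonneg _)
    rw [hψ0, sub_zero, sub_zero, Prod.fst_zero, Prod.snd_zero, sub_zero, sub_zero] at h1
    have h2 : ‖((a, κ) : ℝ × ℝ)‖ * ‖((a, κ) : ℝ × ℝ)‖ ≤ a ^ 2 + κ ^ 2 := by
      rcases max_choice ‖a‖ ‖κ‖ with h | h <;>
        rw [Prod.norm_def, h, Real.norm_eq_abs, abs_mul_abs_self] <;>
        nlinarith [sq_nonneg a, sq_nonneg κ]
    have h3 : C * ‖((a, κ) : ℝ × ℝ)‖ * ‖((a, κ) : ℝ × ℝ)‖ ≤ (C + M) * (a ^ 2 + κ ^ 2) := by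
      rw [mul_assoc]
      gcongr
      linarith
    exact ⟨h1.1.trans h3, h1.2.trans h3⟩
  refine ⟨ε, δ, C + M, D.remainder₁ ψ, D.remainder₂ ψ, fun z => D.coord₁ (ψ z),
    fun z => D.coord₂ (ψ z), hε0, by linarith, hδ, by positivity, ?_, ?_, ?_,
    D.coord₁.continuous.comp_continuousOn hcont₁, D.coord₂.continuous.comp_continuousOn hcont₁,
    ?_, ?_, ?_, ?_⟩
  · exact (D.coord₂.continuous.comp_continuousOn hcont₂).sub (by fun_prop)
  · exact ContinuousOn.sub (by fun_prop) (D.coord₁.continuous.comp_continuousOn hcont₂)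
  · intro α _ s _ κ hκ A hA
    obtain ⟨h1, h2⟩ := hest |A| κ (by rw [abs_abs]; exact abs_lt.mpr hA) hκ
    have h3 : (C + M) * (|A| ^ 2 + κ ^ 2) ≤ (C + M) * (A ^ 2 + (α ^ 2 + s ^ 2 + κ ^ 2)) := by
      rw [sq_abs]
      gcongr
      nlinarith [sq_nonneg α, sq_nonneg s]
    refine ⟨h2.trans h3, ?_⟩
    rw [IsoData.remainder₂, abs_sub_comm]
    exact h1.trans h3
  · exact fun a ha κ hκ => hest a κ (by rw [abs_of_nonneg ha.1]; exact ha.2) hκ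
  · intro κ hκ a ha a' ha' haa
    have hn : ∀ b ∈ Ico 0 ε, ‖((b, κ) : ℝ × ℝ)‖ ≤ ε := fun b hb =>
      (hin (by rw [abs_of_nonneg hb.1]; exact hb.2) hκ).le
    have h1 := (abs_le.mp (hslope ε hερ (a', κ) (a, κ) (hn a' ha') (hn a ha)).1).1
    have h2 : ‖((a', κ) : ℝ × ℝ) - (a, κ)‖ = a' - a := by
      rw [Prod.mk_sub_mk, sub_self, Prod.norm_def, norm_zero,
        Real.norm_of_nonneg (by linarith), max_eq_left (by linarith)]
    rw [h2, map_sub] at h1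
    have h3 : C * ε * (a' - a) < D.ampCoeff * (a' - a) :=
      mul_lt_mul_of_pos_right e4 (by linarith)
    simp only at h1 ⊢
    linarith
  · intro α _ s _ κ _ A _ hA0
    rw [IsoData.bifEqs_iff, or_iff_right hA0]
  · intro k₁ k₂ hk'
    have hk : k₁ ^ 2 + k₂ ^ 2 = D.kc ^ 2 := by rw [← hk', Real.sq_sqrt (by positivity)]
    refine ⟨fun α _ κ hκ => ?_, ?_⟩
    · have h0 : ‖((0, κ) : ℝ × ℝ)‖ < ρ := (hin (by rwa [abs_zero]) hκ).trans hερ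
      change _ ↔ D.coord₁ (ψ (0, κ)) < α
      rw [IsoData.coord₁_branch_zero hD (hzero _ h0)]
      refine IsoData.trivialFlowUnstable_iff hD ?_
      linear_combination (1 + κ) ^ 2 * hk
    · obtain ⟨N, hN, h⟩ := hcorr k₁ k₂ hk
      refine ⟨N, D.waveProfile ψ k₁ k₂, hN, fun α hα s hs κ hκ =>
        ⟨fun A hA hbif => ?_, (h α hα s hs κ hκ).2⟩⟩
      obtain ⟨h1, h2, h3⟩ := (h α hα s hs κ hκ).1 A hA hbif
      refine ⟨h1, h2, h3.trans ?_, ?_, IsoData.waveProfile_neg ψ k₁ k₂ α s κ A⟩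
      · have hα0 := abs_nonneg α
        have hs0 := abs_nonneg s
        gcongr <;> linarith
      · rw [IsoData.bifEqs_iff, abs_neg, neg_eq_zero]
        exact IsoData.bifEqs_iff.mp hbif
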